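/- **Setting.** Let $T>0$ and let $a\in L^\infty([0,T])$ satisfy $a\ge 0$ a.e., $a\not\equiv 0$, and $a(T-t)=a(t)$ for a.e. $t\in[0,T]$ ($a$ is even). Let $L^2(\mathbb T)=L^2([0,T])$ and let $H^2(\mathbb T)$ be the space of $u\in H^2([0,T])$ with $u(0)=u(T)$ and $u'(0)=u'(T)$, with the inner product $(u,v)_{H^2}=\int_0^T (uv+u'v'+u''v'')\,dt$. The subscripts $\mathrm{ev}$ and $\mathrm{odd}$ denote the subspaces of functions with $u(T-t)=u(t)$, respectively $u(T-t)=-u(t)$, for a.e. $t\in[0,T]$. Elements of $H^2(\mathbb T)$ are identified with their continuous representatives. Put $$\mathfrak F:\mathbb R\times H^2(\mathbb T)\to L^2(\mathbb T),\qquad \mathfrak F(\lambda,u)=u''+\lambda u+a(t)u^3,\qquad \mathcal T=\{(\lambda,0):\lambda\in\mathbb R\},\qquad \sigma_k=\Big(\frac{2\pi k}{T}\Big)^2 .$$ A point $(\lambda_0,0)$ is a *bifurcation point* from $\mathcal T$ if, for all sufficiently small $r>0$, the ball $B_r(\lambda_0,0)$ contains some $(\lambda,u)\notin\mathcal T$ with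 $\mathfrak F(\lambda,u)=0$. Balls are taken in $\mathbb R\times H^2(\mathbb T)$ with the norm $\max(|\lambda|,\|u\|_{H^2})$. Let $\mathfrak L(\lambda)=\partial_u\mathfrak F(\lambda,0)$ and let $\Sigma$ be the set of $\lambda$ for which $\mathfrak L(\lambda):H^2(\mathbb T)\to L^2(\mathbb T)$ is not an isomorphism; let $\Sigma_{\mathrm{ev}}$, $\Sigma_{\mathrm{odd}}$ be the corresponding sets for $\mathfrak L(\lambda):H^2_{\mathrm{ev}}(\mathbb T)\to L^2_{\mathrm{ev}}(\mathbb T)$ and $\mathfrak L(\lambda):H^2_{\mathrm{odd}}(\mathbb T)\to L^2_{\mathrm{odd}}(\mathbb T)$. Let $$\mathfrak S=(\mathfrak F^{-1}(0)\setminus\mathcal T)\cup\{(\lambda,0):\lambda\in\Sigma\}$$ be the set of non-trivial solutions, and for $*\in\{\mathrm{ev},\mathrm{odd}\}$ let $\mathfrak S_{*}=\{(\lambda,u)\in\mathfrak F^{-1}(0)\setminus\mathcal T: u\in H^2_{*}(\mathbb T)\}\cup\{(\lambda,0):\lambda\in\Sigma_{*}\}$. Let $\mathscr C_k$ be the connected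 component of $\mathfrak S$ containing $(\sigma_k,0)$, and $\mathscr C_{*,k}$ the connected component of $\mathfrak S_*$ containing $(\sigma_k,0)$. For $C\subset\mathbb R\times H^2(\mathbb T)$ put $-C=\{(\lambda,-u):(\lambda,u)\in C\}$. **Branch pairs.** Let $U$ be one of $H^2(\mathbb T)$, $H^2_{\mathrm{ev}}(\mathbb T)$, $H^2_{\mathrm{odd}}(\mathbb T)$; let $\mathfrak S_U$ be the corresponding set $\mathfrak S$, $\mathfrak S_{\mathrm{ev}}$, $\mathfrak S_{\mathrm{odd}}$, let $\mathscr C_{U}$ be its connected component containing $(\sigma,0)$, and let $\varphi\in U$, $\rho>0$. We say that $C^+,C^-$ *are the two branches of $\mathfrak S_U$ at $(\sigma,0)$ in direction $\varphi$ with radius $\rho$* if: * there are $\varepsilon>0$ and $C^\infty$ maps $\Lambda:(-\varepsilon,\varepsilon)\to\mathbb R$ and $\Gamma:(-\varepsilon,\varepsilon)\to\{u\in U:(u,\varphi)_{H^2}=0\}$ with $\Lambda(0)=\sigma$, $\Gamma(0)=0$ and $\mathfrak F\big(\Lambda(s),s(\varphi+\Gamma(s))\big)=0$ for $|s|<\varepsilon$,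 such that $C^+=\{(\Lambda(s),s(\varphi+\Gamma(s))):0<s<\varepsilon\}$ and $C^-=\{(\Lambda(s),s(\varphi+\Gamma(s))):-\varepsilon<s<0\}$; * with disjoint unions, $\mathfrak S_U\cap B_\rho(\sigma,0)=C^+\uplus C^-\uplus\{(\sigma,0)\}$ and $B_\rho(\sigma,0)\cap(\mathscr C_U\setminus\{(\sigma,0)\})=C^+\uplus C^-$; * $-C^+=C^-$. **Theorem 3.10.** In this setting: 1. The bifurcation points of $\mathfrak F$ from $\mathcal T$ are exactly the points $(\sigma_k,0)$, $k\in\mathbb N\cup\{0\}$. 2. For every $k\in\mathbb N\cup\{0\}$ the component $\mathscr C_k\subset\mathfrak S$ emanates from $(\sigma_k,0)$: $(\sigma_k,0)\in\mathscr C_k$ and $(\sigma_k,0)\in\overline{\mathscr C_k\setminus\mathcal T}$. 3. There is $\rho>0$ for which $\mathfrak S$ has two branches $\mathscr C^{+}_{0,\mathrm{loc}},\mathscr C^{-}_{0,\mathrm{loc}}$ at $(\sigma_0,0)$ in direction $1$ with radius $\rho$; they consist of positive even solutions and of negative even solutions, respectively. 4. For every $k\ge 1$, $\mathscr C_{\mathrm{ev},k}\subset\mathscr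 C_k$ and $\mathscr C_{\mathrm{odd},k}\subset\mathscr C_k$, and there is $\rho>0$ for which $\mathfrak S_{\mathrm{ev}}$ has two branches $\mathscr C^{\pm}_{\mathrm{ev},k,\mathrm{loc}}$ at $(\sigma_k,0)$ in direction $\sqrt{2/T}\,\cos(2\pi kt/T)$ with radius $\rho$, and $\mathfrak S_{\mathrm{odd}}$ has two branches $\mathscr C^{\pm}_{\mathrm{odd},k,\mathrm{loc}}$ at $(\sigma_k,0)$ in direction $\sqrt{2/T}\,\sin(2\pi kt/T)$ with radius $\rho$; these branches consist of even, respectively odd, solutions with exactly $2k$ zeros in $[0,T)$. -/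

import Mathlib

open MeasureTheory Set
open scoped ContDiff ENNReal

noncomputable section

namespace PeriodicBif

/-- Lebesgue measure on the period interval `[0,T]`. -/
abbrev mu (T : ℝ) : Measure ℝ := volume.restrict (Ioc 0 T)

/-- `L²(𝕋) = L²([0,T])`. -/
abbrev L2 (T : ℝ) : Type := Lp ℝ 2 (mu T)

/-- `L^∞([0,T])`, the space of weights. -/
abbrev Linf (T : ℝ) : Type := Lp ℝ ∞ (mu T)

/-- `v` is the weak derivative of `u` on `(0,T)`. -/
def HasWeakDeriv (T : ℝ) (u v : L2 T) : Prop :=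
  ∀ φ : ℝ → ℝ, ContDiff ℝ ∞ φ → HasCompactSupport φ → tsupport φ ⊆ Ioo 0 T →
    ∫ t, u t * deriv φ t ∂(mu T) = -∫ t, v t * φ t ∂(mu T)

/-- `u` has a continuous representative on `[0,T]` that takes the same value at `0` and at `T`. -/
def HasPeriodicRep (T : ℝ) (u : L2 T) : Prop :=
  ∃ h : ℝ → ℝ, ContinuousOn h (Icc 0 T) ∧ u =ᵐ[mu T] h ∧ h 0 = h T

theorem integrable_mul_test {T : ℝ} (u : L2 T) {φ : ℝ → ℝ} (h1 : Continuous φ)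
    (h2 : HasCompactSupport φ) : Integrable (fun t => u t * φ t) (mu T) :=
  MemLp.integrable_mul (Lp.memLp u) (h1.memLp_of_hasCompactSupport (p := 2) h2)

theorem HasWeakDeriv.zero (T : ℝ) : HasWeakDeriv T 0 0 := by
  intro φ _ _ _
  have h : ∀ ψ : ℝ → ℝ, ∫ t, (0 : L2 T) t * ψ t ∂(mu T) = 0 := by
    intro ψ
    rw [integral_congr_ae (g := fun _ => (0 : ℝ)), integral_zero]
    filter_upwards [Lp.coeFn_zero ℝ 2 (mu T)] with t ht
    rw [ht]
    simp
  rw [h, h, neg_zero]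

theorem HasWeakDeriv.add {T : ℝ} {u v u' v' : L2 T} (h : HasWeakDeriv T u v)
    (h' : HasWeakDeriv T u' v') : HasWeakDeriv T (u + u') (v + v') := by
  intro φ h1 h2 h3
  have key : ∀ (x y : L2 T) (ψ : ℝ → ℝ), Continuous ψ → HasCompactSupport ψ →
      ∫ t, (x + y : L2 T) t * ψ t ∂(mu T)
        = ∫ t, x t * ψ t ∂(mu T) + ∫ t, y t * ψ t ∂(mu T) := by
    intro x y ψ c1 c2
    rw [← integral_add (integrable_mul_test x c1 c2) (integrable_mul_test y c1 c2)]
    apply integral_congr_ae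
    filter_upwards [Lp.coeFn_add x y] with t ht
    rw [ht, Pi.add_apply, add_mul]
  rw [key _ _ _ (h1.continuous_deriv (by simp)) h2.deriv, key _ _ _ h1.continuous h2,
    h φ h1 h2 h3, h' φ h1 h2 h3]
  ring

theorem HasWeakDeriv.smul {T : ℝ} {u v : L2 T} (c : ℝ) (h : HasWeakDeriv T u v) :
    HasWeakDeriv T (c • u) (c • v) := by
  intro φ h1 h2 h3
  have key : ∀ (x : L2 T) (ψ : ℝ → ℝ),
      ∫ t, (c • x : L2 T) t * ψ t ∂(mu T) = c * ∫ t, x t * ψ t ∂(mu T) := by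
    intro x ψ
    rw [← integral_const_mul]
    apply integral_congr_ae
    filter_upwards [Lp.coeFn_smul c x] with t ht
    rw [ht, Pi.smul_apply, smul_eq_mul, mul_assoc]
  rw [key, key, h φ h1 h2 h3]
  ring

theorem HasPeriodicRep.zero (T : ℝ) : HasPeriodicRep T 0 :=
  ⟨fun _ => 0, continuousOn_const, Lp.coeFn_zero ℝ 2 (mu T), rfl⟩

theorem HasPeriodicRep.add {T : ℝ} {u v : L2 T} (h : HasPeriodicRep T u)
    (h' : HasPeriodicRep T v) : HasPeriodicRep T (u + v) := by
  obtain ⟨f, f1, f2, f3⟩ := h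
  obtain ⟨g, g1, g2, g3⟩ := h'
  refine ⟨f + g, f1.add g1, ?_, by simp [f3, g3]⟩
  exact (Lp.coeFn_add u v).trans (f2.add g2)

theorem HasPeriodicRep.smul {T : ℝ} {u : L2 T} (c : ℝ) (h : HasPeriodicRep T u) :
    HasPeriodicRep T (c • u) := by
  obtain ⟨f, f1, f2, f3⟩ := h
  refine ⟨c • f, f1.const_smul c, ?_, by simp [f3]⟩
  exact (Lp.coeFn_smul c u).trans (f2.const_smul c)

/-- `H²(𝕋)`: the functions `u ∈ H²([0,T])` with `u(0) = u(T)` and `u'(0) = u'(T)`, each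
recorded as the triple `(u, u', u'')` of its weak derivatives in `L²`.  The inherited norm is
`‖u‖² = ‖u‖²_{L²} + ‖u'‖²_{L²} + ‖u''‖²_{L²}`, and likewise for the inner product. -/
def H2 (T : ℝ) : Submodule ℝ (PiLp 2 (fun _ : Fin 3 => L2 T)) where
  carrier := {f | HasWeakDeriv T (f 0) (f 1) ∧ HasWeakDeriv T (f 1) (f 2) ∧
    HasPeriodicRep T (f 0) ∧ HasPeriodicRep T (f 1)}
  zero_mem' := ⟨HasWeakDeriv.zero T, HasWeakDeriv.zero T, HasPeriodicRep.zero T,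
    HasPeriodicRep.zero T⟩
  add_mem' := fun h h' => ⟨h.1.add h'.1, h.2.1.add h'.2.1, h.2.2.1.add h'.2.2.1,
    h.2.2.2.add h'.2.2.2⟩
  smul_mem' := fun c _ h => ⟨h.1.smul c, h.2.1.smul c, h.2.2.1.smul c, h.2.2.2.smul c⟩

/-- The derivative of order `j ∈ {0,1,2}` of `u ∈ H²(𝕋)`, as an element of `L²`. -/
def D {T : ℝ} (j : Fin 3) (u : H2 T) : L2 T := u.1 j

/-- The pointwise values `u(t)`, `t ∈ [0,T]`, of `u ∈ H²(𝕋)`, that is, its continuous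
representative (unique on `[0,T]`; values outside of `[0,T]` are never used). -/
def val {T : ℝ} (u : H2 T) : ℝ → ℝ := Classical.choose u.2.2.2.1

theorem val_continuousOn {T : ℝ} (u : H2 T) : ContinuousOn (val u) (Icc 0 T) :=
  (Classical.choose_spec u.2.2.2.1).1

theorem val_ae_eq {T : ℝ} (u : H2 T) : D 0 u =ᵐ[mu T] val u :=
  (Classical.choose_spec u.2.2.2.1).2.1

theorem memLp_cubic {T : ℝ} (a : Linf T) (u : H2 T) :
    MemLp (fun t => a t * (val u t) ^ 3) 2 (mu T) := by
  obtain ⟨C, hC⟩ := isCompact_Icc.exists_bound_of_continuousOn ((val_continuousOn u).pow 3)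
  have hm : AEStronglyMeasurable (fun t => (val u t) ^ 3) (mu T) :=
    (((Lp.aestronglyMeasurable (D 0 u)).congr (val_ae_eq u)).pow 3)
  have hb : MemLp (fun t => (val u t) ^ 3) 2 (mu T) := by
    refine MemLp.of_bound hm C ?_
    filter_upwards [ae_restrict_mem measurableSet_Ioc] with t ht
    exact hC t (Ioc_subset_Icc_self ht)
  exact hb.mul (Lp.memLp a)

/-- The operator `𝔉(λ,u) = u'' + λ u + a(t) u³` from `ℝ × H²(𝕋)` to `L²(𝕋)`. -/
def F {T : ℝ} (a : Linf T) (p : ℝ × H2 T) : L2 T :=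
  D 2 p.2 + p.1 • D 0 p.2 + (memLp_cubic a p.2).toLp

/-- `σ_k = (2πk/T)²`. -/
def sigma (T : ℝ) (k : ℕ) : ℝ := (2 * Real.pi * k / T) ^ 2

/-- The set `𝒯` of trivial solutions. -/
def trivialSet (T : ℝ) : Set (ℝ × H2 T) := {p | p.2 = 0}

/-- `p` is a bifurcation point of `𝔉` from the trivial branch: `p = (λ₀,0)`, and every small
ball about `p` holds a non-trivial solution. -/
def IsBifurcationPoint {T : ℝ} (a : Linf T) (p : ℝ × H2 T) : Prop :=
  p ∈ trivialSet T ∧ ∃ r₀ > 0, ∀ r, 0 < r → r < r₀ →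
    ∃ q ∈ Metric.ball p r, F a q = 0 ∧ q ∉ trivialSet T

theorem quasiMeasurePreserving_reflect (T : ℝ) :
    Measure.QuasiMeasurePreserving (fun t : ℝ => T - t) (mu T) (mu T) := by
  have h := (Measure.measurePreserving_sub_left (volume : Measure ℝ) T).restrict_preimage
    (measurableSet_Ioc (a := (0 : ℝ)) (b := T))
  have h2 : (fun t : ℝ => T - t) ⁻¹' Ioc 0 T = Ico 0 T := by
    ext t
    simp only [mem_preimage, mem_Ioc, mem_Ico]
    constructor <;> rintro ⟨h, h'⟩ <;> constructor <;> linarith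
  rw [h2, ← restrict_Ioo_eq_restrict_Ico, restrict_Ioo_eq_restrict_Ioc] at h
  exact h.quasiMeasurePreserving

/-- The functions `u ∈ L²(𝕋)` with `u(T - t) = c u(t)` for almost every `t ∈ [0,T]`. -/
def L2sym (T c : ℝ) : Submodule ℝ (L2 T) where
  carrier := {u | ∀ᵐ t ∂(mu T), u (T - t) = c * u t}
  zero_mem' := by
    have h := Lp.coeFn_zero ℝ 2 (mu T)
    filter_upwards [h, (quasiMeasurePreserving_reflect T).ae h] with t h1 h2
    rw [h1, h2]; simp
  add_mem' := by
    intro u v hu hv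
    have h := Lp.coeFn_add u v
    filter_upwards [hu, hv, h, (quasiMeasurePreserving_reflect T).ae h] with t h1 h2 h3 h4
    rw [h3, h4]; simp [h1, h2, mul_add]
  smul_mem' := by
    intro r u hu
    have h := Lp.coeFn_smul r u
    filter_upwards [hu, h, (quasiMeasurePreserving_reflect T).ae h] with t h1 h3 h4
    rw [h3, h4]; simp [h1]; ring

/-- `L²_ev(𝕋)`, the even functions. -/
def L2ev (T : ℝ) : Submodule ℝ (L2 T) := L2sym T 1

/-- `L²_odd(𝕋)`, the odd functions. -/
def L2odd (T : ℝ) : Submodule ℝ (L2 T) := L2sym T (-1)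

/-- The functions `u ∈ H²(𝕋)` that, as functions, lie in the subspace `V` of `L²(𝕋)`. -/
def H2in {T : ℝ} (V : Submodule ℝ (L2 T)) : Submodule ℝ (H2 T) where
  carrier := {u | D 0 u ∈ V}
  zero_mem' := V.zero_mem
  add_mem' := fun h h' => V.add_mem h h'
  smul_mem' := fun c _ h => V.smul_mem c h

/-- `H²_ev(𝕋)`. -/
def H2ev (T : ℝ) : Submodule ℝ (H2 T) := H2in (L2ev T)

/-- `H²_odd(𝕋)`. -/
def H2odd (T : ℝ) : Submodule ℝ (H2 T) := H2in (L2odd T)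

/-- The linearization `𝔏(λ) = ∂_u 𝔉(λ,0)`. -/
def linearization {T : ℝ} (a : Linf T) (lam : ℝ) : H2 T →L[ℝ] L2 T :=
  fderiv ℝ (fun u => F a (lam, u)) 0

/-- The generalized spectrum of `𝔏(λ)` seen as an operator from the subspace `U` of `H²(𝕋)`
to the subspace `V` of `L²(𝕋)`: the `λ` for which it is not an isomorphism of `U` onto `V`. -/
def genSpectrum {T : ℝ} (a : Linf T) (U : Submodule ℝ (H2 T)) (V : Submodule ℝ (L2 T)) :
    Set ℝ :=
  {lam | ¬ ∃ e : U ≃L[ℝ] V, ∀ u : U, (e u : L2 T) = linearization a lam u}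

/-- The set of non-trivial solutions of `𝔉 : ℝ × U → V`, together with the points `(λ,0)` for
`λ` in the generalized spectrum.  The choices `(⊤,⊤)`, `(H²_ev,L²_ev)` and `(H²_odd,L²_odd)` of
`(U,V)` give `𝔖`, `𝔖_ev` and `𝔖_odd`. -/
def nontrivialSolutions {T : ℝ} (a : Linf T) (U : Submodule ℝ (H2 T))
    (V : Submodule ℝ (L2 T)) : Set (ℝ × H2 T) :=
  {p | p.2 ∈ U ∧ F a p = 0 ∧ p ∉ trivialSet T} ∪ {p | p.2 = 0 ∧ p.1 ∈ genSpectrum a U V}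

/-- The connected component of `(λ,0)` in the set of non-trivial solutions. -/
def component {T : ℝ} (a : Linf T) (U : Submodule ℝ (H2 T)) (V : Submodule ℝ (L2 T))
    (lam : ℝ) : Set (ℝ × H2 T) :=
  connectedComponentIn (nontrivialSolutions a U V) (lam, 0)

theorem memLp_of_continuous (T : ℝ) {f : ℝ → ℝ} (hf : Continuous f) : MemLp f 2 (mu T) := by
  obtain ⟨C, hC⟩ := (isCompact_Icc (a := (0 : ℝ)) (b := T)).exists_bound_of_continuousOn
    hf.continuousOn
  refine MemLp.of_bound hf.aestronglyMeasurable C ?_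
  filter_upwards [ae_restrict_mem measurableSet_Ioc] with t ht
  exact hC t (Ioc_subset_Icc_self ht)

theorem hasWeakDeriv_of_hasDerivAt (T : ℝ) {f g : ℝ → ℝ} (hf : Continuous f)
    (hg : Continuous g) (h : ∀ t, HasDerivAt f (g t) t) :
    HasWeakDeriv T (memLp_of_continuous T hf).toLp (memLp_of_continuous T hg).toLp := by
  intro φ h1 h2 h3
  have e1 := integral_congr_ae (μ := mu T)
    ((memLp_of_continuous T hf).coeFn_toLp.mul (Filter.EventuallyEq.refl _ (deriv φ)))
  have e2 := integral_congr_ae (μ := mu T)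
    ((memLp_of_continuous T hg).coeFn_toLp.mul (Filter.EventuallyEq.refl _ φ))
  simp only [Pi.mul_apply] at e1 e2
  rw [e1, e2]
  · have hφ : ∀ t, t ∉ Ioo 0 T → φ t = 0 := fun t ht => by
      by_contra h0
      exact ht (h3 (subset_tsupport _ h0))
    rcases le_or_gt T 0 with hT | hT
    · simp [mu, Ioc_eq_empty (not_lt.mpr hT)]
    have hd : ∀ t, HasDerivAt φ (deriv φ t) t := fun t =>
      ((h1.differentiable (by simp)) t).hasDerivAt
    have := intervalIntegral.integral_mul_deriv_eq_deriv_mul (a := 0) (b := T)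
      (u := f) (v := φ) (u' := g) (v' := deriv φ) (fun t _ => h t) (fun t _ => hd t)
      (hg.intervalIntegrable _ _) ((h1.continuous_deriv (by simp)).intervalIntegrable _ _)
    rw [hφ 0 (by simp), hφ T (by simp), intervalIntegral.integral_of_le hT.le,
      intervalIntegral.integral_of_le hT.le] at this
    simpa using this

/-- A classical `T`-periodic function `f`, with `f' = g` and `g' = h`, as an element of `H²(𝕋)`. -/
def ofClassical (T : ℝ) (f g h : ℝ → ℝ) (hf : ∀ t, HasDerivAt f (g t) t)
    (hg : ∀ t, HasDerivAt g (h t) t) (hh : Continuous h) (hf0 : f 0 = f T) (hg0 : g 0 = g T) :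
    H2 T :=
  have cf : Continuous f := continuous_iff_continuousAt.2 fun t => (hf t).continuousAt
  have cg : Continuous g := continuous_iff_continuousAt.2 fun t => (hg t).continuousAt
  ⟨WithLp.toLp 2 ![(memLp_of_continuous T cf).toLp, (memLp_of_continuous T cg).toLp,
      (memLp_of_continuous T hh).toLp],
    hasWeakDeriv_of_hasDerivAt T cf cg hf, hasWeakDeriv_of_hasDerivAt T cg hh hg,
    ⟨f, cf.continuousOn, (memLp_of_continuous T cf).coeFn_toLp, hf0⟩,
    ⟨g, cg.continuousOn, (memLp_of_continuous T cg).coeFn_toLp, hg0⟩⟩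

/-- The constant function `1` in `H²(𝕋)`. -/
def oneFun (T : ℝ) : H2 T :=
  ofClassical T (fun _ => 1) (fun _ => 0) (fun _ => 0) (fun t => hasDerivAt_const t _)
    (fun t => hasDerivAt_const t _) continuous_const rfl rfl

theorem hasDerivAt_cos_mul (c w t : ℝ) :
    HasDerivAt (fun t => c * Real.cos (w * t)) (-(c * w) * Real.sin (w * t)) t := by
  have h := (((hasDerivAt_id t).const_mul w).cos).const_mul c
  exact h.congr_deriv (by simp only [id, mul_one]; ring)

theorem hasDerivAt_sin_mul (c w t : ℝ) :
    HasDerivAt (fun t => c * Real.sin (w * t)) ((c * w) * Real.cos (w * t)) t := by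
  have h := (((hasDerivAt_id t).const_mul w).sin).const_mul c
  exact h.congr_deriv (by simp only [id, mul_one]; ring)

theorem cos_period (T : ℝ) (k : ℕ) :
    Real.cos (2 * Real.pi * k / T * 0) = Real.cos (2 * Real.pi * k / T * T) := by
  rcases eq_or_ne T 0 with h | h
  · simp [h]
  · rw [div_mul_cancel₀ _ h, mul_zero, Real.cos_zero, mul_comm, Real.cos_nat_mul_two_pi]

theorem sin_period (T : ℝ) (k : ℕ) :
    Real.sin (2 * Real.pi * k / T * 0) = Real.sin (2 * Real.pi * k / T * T) := by
  rcases eq_or_ne T 0 with h | h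
  · simp [h]
  · rw [div_mul_cancel₀ _ h, mul_zero, Real.sin_zero,
      show 2 * Real.pi * (k : ℝ) = ((2 * k : ℕ) : ℝ) * Real.pi by push_cast; ring,
      Real.sin_nat_mul_pi]

/-- `φ_k(t) = √(2/T) cos(2πkt/T)` in `H²(𝕋)`. -/
def cosFun (T : ℝ) (k : ℕ) : H2 T :=
  ofClassical T (fun t => √(2 / T) * Real.cos (2 * Real.pi * k / T * t)) _ _
    (hasDerivAt_cos_mul _ _) (hasDerivAt_sin_mul _ _) (by fun_prop)
    (by rw [cos_period]) (by rw [sin_period])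

/-- `ϕ_k(t) = √(2/T) sin(2πkt/T)` in `H²(𝕋)`. -/
def sinFun (T : ℝ) (k : ℕ) : H2 T :=
  ofClassical T (fun t => √(2 / T) * Real.sin (2 * Real.pi * k / T * t)) _ _
    (hasDerivAt_sin_mul _ _) (hasDerivAt_cos_mul _ _) (by fun_prop)
    (by rw [sin_period]) (by rw [cos_period])

/-- The smooth solution curve `s ↦ (Λ(s), s(φ + Γ(s)))`, `|s| < ε`, through `(σ,0)`, with `Γ`
taking its values in the `H²`-orthogonal complement of `φ` in `U`. -/
structure IsSolutionCurve {T : ℝ} (a : Linf T) (U : Submodule ℝ (H2 T)) (sig : ℝ) (φ : H2 T)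
    (ε : ℝ) (Lam : ℝ → ℝ) (Gam : ℝ → H2 T) : Prop where
  smooth_Lam : ContDiffOn ℝ ∞ Lam (Ioo (-ε) ε)
  smooth_Gam : ContDiffOn ℝ ∞ Gam (Ioo (-ε) ε)
  Lam_zero : Lam 0 = sig
  Gam_zero : Gam 0 = 0
  Gam_mem : ∀ s ∈ Ioo (-ε) ε, Gam s ∈ U ∧ inner ℝ (Gam s) φ = 0
  solution : ∀ s ∈ Ioo (-ε) ε, F a (Lam s, s • (φ + Gam s)) = 0

/-- The part of the curve `s ↦ (Λ(s), s(φ + Γ(s)))` with `s ∈ I`. -/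
def arc {T : ℝ} (φ : H2 T) (Lam : ℝ → ℝ) (Gam : ℝ → H2 T) (I : Set ℝ) : Set (ℝ × H2 T) :=
  (fun s => (Lam s, s • (φ + Gam s))) '' I

/-- `-C = {(λ,-u) : (λ,u) ∈ C}`. -/
def negSet {T : ℝ} (C : Set (ℝ × H2 T)) : Set (ℝ × H2 T) := (fun p => (p.1, -p.2)) '' C

/-- In the ball of radius `ρ` about `(σ,0)`, the set of non-trivial solutions in `ℝ × U`, and also
its component through `(σ,0)`, consist of `(σ,0)` and of the two disjoint branches `Cp`, `Cm`,
which are the halves `0 < s < ε` and `-ε < s < 0` of a smooth solution curve tangent to `φ`, and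
are exchanged by `u ↦ -u`. -/
def IsBranchPair {T : ℝ} (a : Linf T) (U : Submodule ℝ (H2 T)) (V : Submodule ℝ (L2 T))
    (sig : ℝ) (φ : H2 T) (ρ : ℝ) (Cp Cm : Set (ℝ × H2 T)) : Prop :=
  (∃ ε > 0, ∃ (Lam : ℝ → ℝ) (Gam : ℝ → H2 T), IsSolutionCurve a U sig φ ε Lam Gam ∧
    Cp = arc φ Lam Gam (Ioo 0 ε) ∧ Cm = arc φ Lam Gam (Ioo (-ε) 0)) ∧
  Disjoint Cp Cm ∧ (sig, 0) ∉ Cp ∪ Cm ∧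
  nontrivialSolutions a U V ∩ Metric.ball (sig, 0) ρ = Cp ∪ Cm ∪ {(sig, 0)} ∧
  Metric.ball (sig, 0) ρ ∩ (component a U V sig \ {(sig, 0)}) = Cp ∪ Cm ∧
  negSet Cp = Cm

/-- `u` has exactly `n` zeros in `[0,T)`. -/
def HasExactlyZeros {T : ℝ} (u : H2 T) (n : ℕ) : Prop :=
  {t ∈ Ico 0 T | val u t = 0}.encard = n

end PeriodicBif

end

open PeriodicBif

open scoped Topology

noncomputable section

namespace PeriodicBif

/-! The cubic term is `O(‖u‖³)`, so the linearization at `(λ,0)` is `u'' + λu`, which multiplies the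
Fourier coefficients of wave number `k` by `λ - σ_k`. The trigonometric system is total
(`eq_zero_of_inner_trig`) and multipliers of order `-2` map `L²` into `H²` (`exists_multiplier`), so
injectivity, surjectivity and kernels can be read off coefficient by coefficient. The even and odd
spaces are cut out by the vanishing of coefficients (`IsSpectral`), and one argument treats all
three settings: `genSpectrum_eq` finds the spectrum. Off the spectrum the inverse of the
linearization dominates the remaining terms, which excludes bifurcation
(`IsBifurcationPoint.mem_genSpectrum`).

For `k ≥ 1` the eigenvalue `σ_k` is double in the full space but simple among even and among odd
functions; `σ_0` is simple already in the full space. At a simple eigenvalue with eigenfunction `φ`,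
put `λ = σ + m` and `u = s(φ + x)` with `x ⊥ φ`. The equation is `s` times an equation in `(s,m,x)`
to which the implicit function theorem applies (`exists_isLocalBranch`). It involves `s` only
through `s²`, so `m` and `x` are even in `s` and the two half-branches are exchanged by `u ↦ -u`. A
priori estimates put every small non-zero solution on the curve.

The exact description of the solutions in a ball needs more: `|Λ(s) - σ| ≤ ‖u(s)‖` and `‖u(s)‖` is
strictly increasing in `|s|`, so small balls cut the curve in a symmetric parameter interval
(`IsLocalBranch.exists_radius`). As the curve is connected, it lies in the component
(`IsLocalBranch.isBranchPair`).

Signs and zeros come from `H² ⊂ C¹`: `φ + x` is `C¹`-close to `φ`, and zeros are counted between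
consecutive extrema (`encard_zeros_of_close_cos`, `encard_zeros_of_close_sin`). At `σ_0` the branch
of even solutions must coincide with the full branch by uniqueness (`IsLocalBranch.eventually_eq`),
so the latter consists of even functions. -/

/-! ### Weak derivatives and primitives -/

theorem L2.integrable {T : ℝ} (v : L2 T) : Integrable v (mu T) :=
  (Lp.memLp v).integrable (by norm_num)

theorem L2.intervalIntegrable {T : ℝ} (hT : 0 < T) (v : L2 T) :
    IntervalIntegrable v volume 0 T := by
  rw [intervalIntegrable_iff_integrableOn_Ioc_of_le hT.le]
  exact L2.integrable v

theorem ae_mu_iff {T : ℝ} {p : ℝ → Prop} :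
    (∀ᵐ t ∂(mu T), p t) ↔ ∀ᵐ t, t ∈ Ioc 0 T → p t :=
  ae_restrict_iff' measurableSet_Ioc

/-- Integration by parts for two integral functions. -/
theorem integral_primitive_mul {T : ℝ} {f g : ℝ → ℝ}
    (hf : IntervalIntegrable f volume 0 T) (hg : IntervalIntegrable g volume 0 T) (c d : ℝ) :
    ∫ t in 0..T, f t * (d + ∫ s in 0..t, g s) + (c + ∫ s in 0..t, f s) * g t
      = (c + ∫ s in 0..T, f s) * (d + ∫ s in 0..T, g s) - c * d := by
  have ac : ∀ (c : ℝ) {f : ℝ → ℝ}, IntervalIntegrable f volume 0 T →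
      AbsolutelyContinuousOnInterval (fun t => c + ∫ s in 0..t, f s) 0 T := by
    intro c f hf
    have h1 : AbsolutelyContinuousOnInterval (fun _ : ℝ => c) 0 T :=
      contDiffOn_const.absolutelyContinuousOnInterval
    exact h1.add (hf.absolutelyContinuousOnInterval_intervalIntegral (by simp))
  have h := (ac c hf).integral_deriv_mul_eq_sub (ac d hg)
  have key : ∀ (c : ℝ) {f : ℝ → ℝ}, IntervalIntegrable f volume 0 T →
      ∀ᵐ t, t ∈ uIoc 0 T → deriv (fun t => c + ∫ s in 0..t, f s) t = f t := by
    intro c f hf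
    filter_upwards [hf.ae_hasDerivAt_integral] with t ht h
    exact ((ht (uIoc_subset_uIcc h) 0 (by simp)).const_add c).deriv
  simp only [intervalIntegral.integral_same, add_zero] at h
  rw [← h]
  apply intervalIntegral.integral_congr_ae
  filter_upwards [key c hf, key d hg] with t h1 h2 h3
  rw [h1 h3, h2 h3]

theorem hasDerivAt_primitive {f : ℝ → ℝ} (hf : Continuous f) (t : ℝ) :
    HasDerivAt (fun x => ∫ s in 0..x, f s) (f t) t :=
  intervalIntegral.integral_hasDerivAt_right (hf.intervalIntegrable _ _)
    (hf.stronglyMeasurableAtFilter _ _) hf.continuousAt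

/-- An integral function is weakly differentiable. -/
theorem hasWeakDeriv_of_primitive {T : ℝ} (hT : 0 < T) {u v : L2 T} {c : ℝ}
    (h : u =ᵐ[mu T] fun t => c + ∫ s in 0..t, v s) : HasWeakDeriv T u v := by
  intro φ h1 h2 h3
  have hφ : ∀ t, t ∉ Ioo 0 T → φ t = 0 := fun t ht => by
    by_contra h0
    exact ht (h3 (subset_tsupport _ h0))
  have cd : Continuous (deriv φ) := h1.continuous_deriv (by simp)
  have hp : ∀ t, ∫ s in 0..t, deriv φ s = φ t := by
    intro t
    rw [intervalIntegral.integral_deriv_eq_sub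
      (fun x _ => (h1.differentiable (by simp)) x) (cd.intervalIntegrable _ _), hφ 0 (by simp),
      sub_zero]
  -- The test function is itself the primitive of its derivative with constant `0`, and it vanishes
  -- at both ends, so there is no boundary term.
  have k := integral_primitive_mul (L2.intervalIntegrable hT v) (cd.intervalIntegrable 0 T) c 0
  simp only [zero_add, hp, mul_zero, hφ T (by simp), sub_zero] at k
  rw [intervalIntegral.integral_of_le hT.le, integral_add] at k
  · have e : ∫ t, u t * deriv φ t ∂(mu T) = ∫ t, (c + ∫ s in 0..t, v s) * deriv φ t ∂(mu T) := by
      apply integral_congr_ae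
      filter_upwards [h] with t ht
      rw [ht]
    rw [e]
    linarith
  · exact integrable_mul_test v h1.continuous h2
  · refine (integrable_mul_test u cd h2.deriv).congr ?_
    filter_upwards [h] with t ht
    rw [ht]

theorem continuous_primitive {T : ℝ} (hT : 0 < T) (v : L2 T) (c : ℝ) :
    ContinuousOn (fun t => c + ∫ s in 0..t, v s) (Icc 0 T) := by
  refine continuousOn_const.add ?_
  have := intervalIntegral.continuousOn_primitive_interval (a := 0) (b := T) (f := v)
    (μ := volume) ?_
  · rwa [uIcc_of_le hT.le] at this
  · rw [uIcc_of_le hT.le, integrableOn_Icc_iff_integrableOn_Ioc]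
    exact L2.integrable v

theorem memLp_of_continuousOn {T : ℝ} {f : ℝ → ℝ} (hf : ContinuousOn f (Icc 0 T)) :
    MemLp f 2 (mu T) := by
  obtain ⟨C, hC⟩ := isCompact_Icc.exists_bound_of_continuousOn hf
  refine MemLp.of_bound ((hf.mono Ioc_subset_Icc_self).aestronglyMeasurable measurableSet_Ioc) C ?_
  filter_upwards [ae_restrict_mem measurableSet_Ioc] with t ht
  exact hC t (Ioc_subset_Icc_self ht)

/-- A test function on `(0,T)` of mean zero is the derivative of a test function. -/
theorem exists_test_primitive {T : ℝ} {ψ : ℝ → ℝ} (h1 : ContDiff ℝ ∞ ψ)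
    (h2 : HasCompactSupport ψ) (h3 : tsupport ψ ⊆ Ioo 0 T) (h0 : ∫ t in 0..T, ψ t = 0) :
    ∃ φ : ℝ → ℝ, ContDiff ℝ ∞ φ ∧ HasCompactSupport φ ∧ tsupport φ ⊆ Ioo 0 T ∧ deriv φ = ψ := by
  by_cases hne : (tsupport ψ).Nonempty
  swap
  · have hz : ψ = 0 := by
      rw [not_nonempty_iff_eq_empty, tsupport_eq_empty_iff] at hne
      exact hne
    exact ⟨0, contDiff_const, HasCompactSupport.zero, by simp [tsupport], by
      rw [hz]; ext t; simp⟩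
  obtain ⟨α, hα, hα'⟩ := h2.isCompact.exists_isLeast hne
  obtain ⟨β, hβ, hβ'⟩ := h2.isCompact.exists_isGreatest hne
  have hψ : ∀ t, t ∉ Icc α β → ψ t = 0 := by
    intro t ht
    by_contra hc
    have := subset_tsupport ψ (Function.mem_support.2 hc)
    exact ht ⟨hα' this, hβ' this⟩
  have cψ := h1.continuous
  set φ : ℝ → ℝ := fun t => ∫ s in 0..t, ψ s with hφdef
  have hd : deriv φ = ψ := by
    ext t
    exact (hasDerivAt_primitive cψ t).deriv
  have hz : ∀ t, t ∉ Icc α β → φ t = 0 := by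
    intro t ht
    rcases not_and_or.1 ht with h | h
    · refine (intervalIntegral.integral_congr (g := fun _ => (0 : ℝ)) ?_).trans (by simp)
      intro s hs
      apply hψ
      intro hs'
      rcases mem_uIcc.1 hs with ⟨-, h5⟩ | ⟨-, h5⟩
      · exact h (hs'.1.trans h5)
      · linarith [(h3 hα).1, hs'.1]
    -- Beyond the support the mean-zero condition enters: the primitive from `0` equals the
    -- primitive from `T`, whose integrand vanishes there.
    · have e : φ t = (∫ s in 0..T, ψ s) + ∫ s in T..t, ψ s := by
        rw [hφdef, intervalIntegral.integral_add_adjacent_intervals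
          (cψ.intervalIntegrable _ _) (cψ.intervalIntegrable _ _)]
      rw [e, h0, zero_add]
      refine (intervalIntegral.integral_congr (g := fun _ => (0 : ℝ)) ?_).trans (by simp)
      intro s hs
      apply hψ
      intro hs'
      rcases mem_uIcc.1 hs with ⟨h5, -⟩ | ⟨h5, -⟩
      · linarith [(h3 hβ).2, hs'.2]
      · exact h (h5.trans hs'.2)
  have hsub : tsupport φ ⊆ Icc α β := by
    apply closure_minimal _ isClosed_Icc
    intro t ht
    by_contra hc
    exact ht (hz t hc)
  refine ⟨φ, ?_, ?_, ?_, hd⟩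
  · rw [contDiff_infty_iff_deriv, hd]
    exact ⟨fun t => (hasDerivAt_primitive cψ t).differentiableAt, h1⟩
  · exact HasCompactSupport.of_support_subset_isCompact isCompact_Icc
      ((subset_tsupport _).trans hsub)
  · exact hsub.trans (fun t ht => ⟨(h3 hα).1.trans_le ht.1, ht.2.trans_lt (h3 hβ).2⟩)

/-- The lemma of du Bois-Reymond. -/
theorem HasWeakDeriv.exists_primitive {T : ℝ} (hT : 0 < T) {u v : L2 T} (h : HasWeakDeriv T u v) :
    ∃ c : ℝ, u =ᵐ[mu T] fun t => c + ∫ s in 0..t, v s := by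
  have cI := continuous_primitive hT v 0
  set I : L2 T := (memLp_of_continuousOn cI).toLp with hI
  have hIae : I =ᵐ[mu T] fun t => 0 + ∫ s in 0..t, v s := MemLp.coeFn_toLp _
  have hIw : HasWeakDeriv T I v := hasWeakDeriv_of_primitive hT hIae
  -- Subtracting a primitive of `v` leaves a function with weak derivative zero, which has to be
  -- shown constant.
  set w : L2 T := u - I with hw
  have hww : HasWeakDeriv T w 0 := by
    have := h.add (hIw.smul (-1))
    rwa [neg_one_smul, neg_one_smul, ← sub_eq_add_neg, ← sub_eq_add_neg, sub_self] at this
  obtain ⟨φ₀, s1, s2, s3, s4⟩ : ∃ φ : ℝ → ℝ, ContDiff ℝ ∞ φ ∧ HasCompactSupport φ ∧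
      tsupport φ ⊆ Ioo 0 T ∧ ∫ t in 0..T, φ t = 1 := by
    let b : ContDiffBump (T / 2 : ℝ) := ⟨T / 8, T / 4, by positivity, by linarith⟩
    have hsupp : tsupport (b.normed volume) ⊆ Ioo 0 T := by
      rw [b.tsupport_normed_eq]
      intro t ht
      rw [Metric.mem_closedBall, Real.dist_eq, abs_le] at ht
      change -(T / 4) ≤ t - T / 2 ∧ t - T / 2 ≤ T / 4 at ht
      constructor <;> linarith [ht.1, ht.2]
    refine ⟨b.normed volume, b.contDiff_normed, b.hasCompactSupport_normed, hsupp, ?_⟩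
    rw [intervalIntegral.integral_eq_integral_of_support_subset, b.integral_normed]
    exact ((subset_tsupport _).trans hsupp).trans Ioo_subset_Ioc_self
  have hint : ∀ {φ : ℝ → ℝ}, ∫ t in 0..T, φ t = ∫ t, φ t ∂(mu T) :=
    intervalIntegral.integral_of_le hT.le
  -- The only possible constant, since `φ₀` has integral `1`.
  set m : ℝ := ∫ t, w t * φ₀ t ∂(mu T) with hm
  have hz : ∀ᵐ t, t ∈ Ioo 0 T → w t - m = 0 := by
    have hwi : Integrable (fun t => w t - m) (mu T) :=
      (L2.integrable w).sub (integrable_const m)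
    apply isOpen_Ioo.ae_eq_zero_of_integral_contDiff_smul_eq_zero (f := fun t => w t - m)
      (μ := volume) (IntegrableOn.locallyIntegrableOn
        (IntegrableOn.mono_set (t := Ioc 0 T) hwi Ioo_subset_Ioc_self))
    intro ψ p1 p2 p3
    set k : ℝ := ∫ t in 0..T, ψ t with hk
    have iψ := p1.continuous.integrable_of_hasCompactSupport p2 (μ := mu T)
    have i₀ := s1.continuous.integrable_of_hasCompactSupport s2 (μ := mu T)
    -- `ψ - kφ₀` has mean zero, hence is the derivative of a test function; testing against it
    -- yields `∫ wψ = m ∫ ψ`.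
    obtain ⟨φ, f1, f2, f3, f4⟩ := exists_test_primitive (T := T) (ψ := fun t => ψ t - k * φ₀ t)
      (p1.sub (contDiff_const.mul s1)) (p2.sub (s2.mul_left (f := fun _ => k)))
      ((tsupport_sub _ _).trans (union_subset p3
        ((tsupport_mul_subset_right (f := fun _ => k)).trans s3))) (by
        rw [hint, integral_sub iψ (i₀.const_mul k), integral_const_mul, ← hint, ← hint, s4, hk]
        ring)
    have e := hww φ f1 f2 f3
    have e0 : ∫ t, (0 : L2 T) t * φ t ∂(mu T) = 0 := by
      rw [integral_congr_ae (g := fun _ => (0 : ℝ)), integral_zero]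
      filter_upwards [Lp.coeFn_zero ℝ 2 (mu T)] with t ht
      rw [ht]
      simp
    rw [e0, f4, neg_zero] at e
    have jψ := integrable_mul_test w p1.continuous p2
    have j₀ := integrable_mul_test w s1.continuous s2
    have e2 : ∫ t, w t * (ψ t - k * φ₀ t) ∂(mu T)
        = ∫ t, w t * ψ t ∂(mu T) - k * m := by
      rw [hm, ← integral_const_mul, ← integral_sub jψ (j₀.const_mul k)]
      congr 1 with t
      ring
    have e3 : ∫ t, ψ t • (w t - m) = ∫ t, w t * ψ t - m * ψ t ∂(mu T) := by
      rw [← setIntegral_eq_integral_of_forall_compl_eq_zero (s := Ioc 0 T)]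
      · congr 1 with t
        simp only [smul_eq_mul]; ring
      · intro t ht
        have : ψ t = 0 := by
          by_contra hc
          exact ht (Ioo_subset_Ioc_self (p3 (subset_tsupport _ hc)))
        rw [this, zero_smul]
    rw [e3, integral_sub jψ (iψ.const_mul m), integral_const_mul, ← hint (φ := ψ), ← hk]
    linarith
  refine ⟨m, ?_⟩
  have hz' : ∀ᵐ t ∂(mu T), w t - m = 0 := by
    change ∀ᵐ t ∂(volume.restrict (Ioc 0 T)), w t - m = 0
    rw [← restrict_Ioo_eq_restrict_Ioc, ae_restrict_iff' measurableSet_Ioo]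
    exact hz
  filter_upwards [hz', hIae, Lp.coeFn_sub u I] with t h1 h2 h3
  rw [hw, h3, Pi.sub_apply, h2] at h1
  linarith

theorem eqOn_Icc_of_ae_eq {T : ℝ} (hT : 0 < T) {f g : ℝ → ℝ} (h : f =ᵐ[mu T] g)
    (hf : ContinuousOn f (Icc 0 T)) (hg : ContinuousOn g (Icc 0 T)) : EqOn f g (Icc 0 T) := by
  refine Measure.eqOn_Icc_of_ae_eq volume hT.ne ?_ hf hg
  rwa [← restrict_Ioc_eq_restrict_Icc]

/-! ### Periodic derivatives, sup bounds and completeness of H² -/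

/-- `v` is the derivative of the `T`-periodic function `u`. -/
def IsPeriodicDeriv (T : ℝ) (u v : L2 T) : Prop := HasWeakDeriv T u v ∧ HasPeriodicRep T u

/-- The continuous representative must be `c + ∫₀ᵗ v`, and its values at `0` and `T` agree exactly
when `v` has mean zero. -/
theorem isPeriodicDeriv_iff {T : ℝ} (hT : 0 < T) (u v : L2 T) : IsPeriodicDeriv T u v ↔
    (∃ c : ℝ, u =ᵐ[mu T] fun t => c + ∫ s in 0..t, v s) ∧ ∫ s in 0..T, v s = 0 := by
  constructor
  · rintro ⟨h1, h, h2, h3, h4⟩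
    obtain ⟨c, hc⟩ := h1.exists_primitive hT
    have e := eqOn_Icc_of_ae_eq hT (h3.symm.trans hc) h2 (continuous_primitive hT v c)
    refine ⟨⟨c, hc⟩, ?_⟩
    have e0 := e ⟨le_rfl, hT.le⟩
    have eT := e ⟨hT.le, le_rfl⟩
    simp only [intervalIntegral.integral_same] at e0 eT
    linarith
  · rintro ⟨⟨c, hc⟩, h0⟩
    exact ⟨hasWeakDeriv_of_primitive hT hc, _, continuous_primitive hT v c, hc, by simp [h0]⟩

theorem L2.inner_eq {T : ℝ} (u v : L2 T) : inner ℝ u v = ∫ t, u t * v t ∂(mu T) := by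
  rw [MeasureTheory.L2.inner_def]
  congr 1 with t
  simp [mul_comm]

theorem L2.integrable_mul {T : ℝ} (u v : L2 T) : Integrable (fun t => u t * v t) (mu T) :=
  MemLp.integrable_mul (Lp.memLp u) (Lp.memLp v)

/-- Periodicity cancels the boundary terms in the integration by parts. -/
theorem IsPeriodicDeriv.inner_add {T : ℝ} (hT : 0 < T) {u v w z : L2 T}
    (h : IsPeriodicDeriv T u v) (h' : IsPeriodicDeriv T w z) :
    inner ℝ v w + inner ℝ u z = 0 := by
  obtain ⟨⟨c, hc⟩, h0⟩ := (isPeriodicDeriv_iff hT u v).1 h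
  obtain ⟨⟨d, hd⟩, k0⟩ := (isPeriodicDeriv_iff hT w z).1 h'
  have k := integral_primitive_mul (L2.intervalIntegrable hT v) (L2.intervalIntegrable hT z) c d
  rw [h0, k0, add_zero, add_zero, sub_self, intervalIntegral.integral_of_le hT.le] at k
  rw [L2.inner_eq, L2.inner_eq, ← integral_add (L2.integrable_mul _ _) (L2.integrable_mul _ _), ← k]
  apply integral_congr_ae
  filter_upwards [hc, hd] with t h1 h2
  rw [h1, h2]

/-- Cauchy–Schwarz against the constant `1`. -/
theorem integral_abs_le {T : ℝ} (hT : 0 < T) (v : L2 T) :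
    ∫ t, |v t| ∂(mu T) ≤ √T * ‖v‖ := by
  have h := eLpNorm_le_eLpNorm_mul_rpow_measure_univ (μ := mu T) (p := 1) (q := 2) (by norm_num)
    (Lp.aestronglyMeasurable v)
  have e : (mu T) univ = ENNReal.ofReal T := by simp [mu]
  have h1 : (eLpNorm v 1 (mu T)).toReal = ∫ t, |v t| ∂(mu T) := by
    rw [eLpNorm_one_eq_lintegral_enorm, ← integral_norm_eq_lintegral_enorm
      (Lp.aestronglyMeasurable v)]
    rfl
  rw [← h1, Lp.norm_def]
  refine (ENNReal.toReal_mono ?_ h).trans ?_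
  · refine ENNReal.mul_ne_top (Lp.eLpNorm_ne_top v) ?_
    rw [e]
    exact ENNReal.rpow_ne_top_of_nonneg (by norm_num) ENNReal.ofReal_ne_top
  · rw [ENNReal.toReal_mul, e, ← ENNReal.toReal_rpow, ENNReal.toReal_ofReal hT.le, mul_comm,
      Real.sqrt_eq_rpow]
    norm_num

theorem abs_primitive_le {T : ℝ} (hT : 0 < T) (v : L2 T) {s t : ℝ} (hs : s ∈ Icc 0 T)
    (ht : t ∈ Icc 0 T) : |∫ x in s..t, v x| ≤ √T * ‖v‖ := by
  refine le_trans ?_ (integral_abs_le hT v)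
  refine (intervalIntegral.norm_integral_le_integral_norm_uIoc (f := v)).trans ?_
  refine setIntegral_mono_set (L2.integrable v).norm (by filter_upwards with t using norm_nonneg _)
    (LE.le.eventuallyLE ?_)
  rw [uIoc]
  exact Ioc_subset_Ioc (le_min hs.1 ht.1) (max_le hs.2 ht.2)

/-- The sup norm of a function is bounded by its norm in `H¹`. -/
theorem abs_le_of_primitive {T : ℝ} (hT : 0 < T) {u v : L2 T} {c : ℝ}
    (h : u =ᵐ[mu T] fun t => c + ∫ s in 0..t, v s) {t : ℝ} (ht : t ∈ Icc 0 T) :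
    |c + ∫ s in 0..t, v s| ≤ √T / T * ‖u‖ + √T * ‖v‖ := by
  set A : ℝ → ℝ := fun t => c + ∫ s in 0..t, v s with hA
  have hi := L2.intervalIntegrable hT v
  -- A bound valid for every `s`; averaging it over `s` replaces the pointwise value `|A s|` by the
  -- mean of `|u|`.
  have hsub : ∀ s ∈ Icc 0 T, |A t| ≤ |A s| + √T * ‖v‖ := by
    intro s hs
    have hi0 : ∀ x ∈ Icc 0 T, IntervalIntegrable v volume 0 x := fun x hx =>
      hi.mono_set (by rw [uIcc_of_le hx.1, uIcc_of_le hT.le]; exact Icc_subset_Icc_right hx.2)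
    have e : A t = A s + ∫ x in s..t, v x := by
      have := intervalIntegral.integral_interval_sub_left (hi0 t ht) (hi0 s hs)
      simp only [hA]
      linarith
    rw [e]
    exact (abs_add_le _ _).trans (by gcongr; exact abs_primitive_le hT v hs ht)
  have hu : Integrable (fun s => |u s| + √T * ‖v‖) (mu T) :=
    (L2.integrable u).norm.add (integrable_const _)
  have hm : ∫ s, |A t| ∂(mu T) ≤ ∫ s, (|u s| + √T * ‖v‖) ∂(mu T) := by
    refine integral_mono_ae (integrable_const _) hu ?_
    filter_upwards [h, ae_restrict_mem measurableSet_Ioc] with s hs hs'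
    rw [hs]
    exact hsub s (Ioc_subset_Icc_self hs')
  rw [integral_add (f := fun s => |u s|) (L2.integrable u).norm (integrable_const _)] at hm
  have hvol : (mu T).real univ = T := by simp [mu, Measure.real, hT.le]
  simp only [integral_const, hvol, smul_eq_mul] at hm
  have := integral_abs_le hT u
  have hT' : T * |A t| ≤ T * (√T / T * ‖u‖ + √T * ‖v‖) := by
    rw [mul_add, ← mul_assoc, mul_div_cancel₀ _ hT.ne']
    linarith
  exact le_of_mul_le_mul_left hT' hT

/-- The operator `v ↦ ∫₀ v` in `L²`. -/
def primitive {T : ℝ} (hT : 0 < T) : L2 T →L[ℝ] L2 T :=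
  LinearMap.mkContinuous
    { toFun := fun v => (memLp_of_continuousOn (continuous_primitive hT v 0)).toLp
      map_add' := by
        intro v w
        rw [← MemLp.toLp_add, MemLp.toLp_eq_toLp_iff]
        filter_upwards [ae_restrict_mem measurableSet_Ioc] with t ht
        have hv := (L2.intervalIntegrable hT v).mono_set (c := 0) (d := t)
          (by rw [uIcc_of_le ht.1.le, uIcc_of_le hT.le]; exact Icc_subset_Icc_right ht.2)
        have hw := (L2.intervalIntegrable hT w).mono_set (c := 0) (d := t)
          (by rw [uIcc_of_le ht.1.le, uIcc_of_le hT.le]; exact Icc_subset_Icc_right ht.2)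
        simp only [zero_add, Pi.add_apply]
        rw [← intervalIntegral.integral_add hv hw]
        apply intervalIntegral.integral_congr_ae
        filter_upwards [ae_mu_iff.1 (Lp.coeFn_add v w)] with s hs hs'
        rw [uIoc_of_le ht.1.le] at hs'
        exact hs ⟨hs'.1, hs'.2.trans ht.2⟩
      map_smul' := by
        intro r v
        simp only [RingHom.id_apply]
        rw [← MemLp.toLp_const_smul, MemLp.toLp_eq_toLp_iff]
        filter_upwards [ae_restrict_mem measurableSet_Ioc] with t ht
        simp only [zero_add, Pi.smul_apply, smul_eq_mul]
        rw [← intervalIntegral.integral_const_mul]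
        apply intervalIntegral.integral_congr_ae
        filter_upwards [ae_mu_iff.1 (Lp.coeFn_smul r v)] with s hs hs'
        rw [uIoc_of_le ht.1.le] at hs'
        exact hs ⟨hs'.1, hs'.2.trans ht.2⟩ }
    (((mu T) univ).toReal ^ ((2 : ℝ≥0∞).toReal)⁻¹ * √T) (by
      intro v
      rw [mul_assoc]
      refine Lp.norm_le_of_ae_bound (by positivity) ?_
      refine (memLp_of_continuousOn (continuous_primitive hT v 0)).coeFn_toLp.mp ?_
      filter_upwards [ae_restrict_mem measurableSet_Ioc] with t ht h
      change ((memLp_of_continuousOn (continuous_primitive hT v 0)).toLp : L2 T) t = _ at h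
      change ‖((memLp_of_continuousOn (continuous_primitive hT v 0)).toLp : L2 T) t‖ ≤ _
      rw [h, zero_add]
      exact abs_primitive_le hT v ⟨le_rfl, hT.le⟩ (Ioc_subset_Icc_self ht))

theorem primitive_ae {T : ℝ} (hT : 0 < T) (v : L2 T) :
    primitive hT v =ᵐ[mu T] fun t => ∫ s in 0..t, v s := by
  have := (memLp_of_continuousOn (continuous_primitive hT v 0)).coeFn_toLp
  filter_upwards [this] with t ht
  exact ht.trans (zero_add _)

/-- The constant function `1` in `L²`. -/
def oneL2 (T : ℝ) : L2 T := (memLp_const (1 : ℝ)).toLp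

theorem inner_oneL2 {T : ℝ} (hT : 0 < T) (v : L2 T) :
    inner ℝ (oneL2 T) v = ∫ s in 0..T, v s := by
  rw [L2.inner_eq, intervalIntegral.integral_of_le hT.le]
  apply integral_congr_ae
  filter_upwards [(memLp_const (μ := mu T) (p := 2) (1 : ℝ)).coeFn_toLp] with t ht
  rw [oneL2, ht, one_mul]

/-- The constant of integration becomes membership in a line, so that only continuous operators and
a finite-dimensional subspace occur and the relation is visibly closed. -/
theorem isPeriodicDeriv_iff_mem_span {T : ℝ} (hT : 0 < T) (u v : L2 T) :
    IsPeriodicDeriv T u v ↔ u - primitive hT v ∈ Submodule.span ℝ {oneL2 T} ∧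
      inner ℝ (oneL2 T) v = 0 := by
  rw [isPeriodicDeriv_iff hT, inner_oneL2 hT, Submodule.mem_span_singleton]
  refine and_congr_left fun _ => exists_congr fun c => ?_
  rw [Lp.ext_iff]
  have h1 := (memLp_const (μ := mu T) (p := 2) (1 : ℝ)).coeFn_toLp
  constructor
  · intro h
    filter_upwards [h, h1, Lp.coeFn_smul c (oneL2 T), Lp.coeFn_sub u (primitive hT v),
      primitive_ae hT v] with t a1 a2 a3 a4 a5
    rw [a3, a4, Pi.smul_apply, Pi.sub_apply, a1, a5, oneL2, a2]
    simp
  · intro h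
    filter_upwards [h, h1, Lp.coeFn_smul c (oneL2 T), Lp.coeFn_sub u (primitive hT v),
      primitive_ae hT v] with t a1 a2 a3 a4 a5
    rw [a3, a4, Pi.smul_apply, Pi.sub_apply, a5, oneL2, a2] at a1
    simp at a1
    linarith

theorem isClosed_isPeriodicDeriv {T : ℝ} (hT : 0 < T) :
    IsClosed {p : L2 T × L2 T | IsPeriodicDeriv T p.1 p.2} := by
  simp_rw [isPeriodicDeriv_iff_mem_span hT]
  refine IsClosed.inter ?_ ?_
  · exact (Submodule.closed_of_finiteDimensional (Submodule.span ℝ {oneL2 T})).preimage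
      (continuous_fst.sub ((primitive hT).continuous.comp continuous_snd))
  · exact isClosed_eq (by fun_prop) continuous_const

theorem isClosed_H2 {T : ℝ} (hT : 0 < T) :
    IsClosed (H2 T : Set (PiLp 2 (fun _ : Fin 3 => L2 T))) := by
  have e : (H2 T : Set (PiLp 2 (fun _ : Fin 3 => L2 T))) =
      {f | IsPeriodicDeriv T (f 0) (f 1)} ∩ {f | IsPeriodicDeriv T (f 1) (f 2)} := by
    ext f
    change (_ ∧ _ ∧ _ ∧ _) ↔ (_ ∧ _) ∧ (_ ∧ _)
    tauto
  rw [e]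
  have c : ∀ i, Continuous fun f : PiLp 2 (fun _ : Fin 3 => L2 T) => f i := fun i =>
    (PiLp.proj 2 (fun _ : Fin 3 => L2 T) i : _ →L[ℝ] _).continuous
  exact ((isClosed_isPeriodicDeriv hT).preimage ((c 0).prodMk (c 1))).inter
    ((isClosed_isPeriodicDeriv hT).preimage ((c 1).prodMk (c 2)))

theorem completeSpace_H2 {T : ℝ} (hT : 0 < T) : CompleteSpace (H2 T) :=
  (isClosed_H2 hT).completeSpace_coe

/-! ### Calculus in H² and continuous representatives -/

/-- `u ↦ u^{(j)}` as a continuous linear map from `H²` to `L²`. -/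
def derivL {T : ℝ} (j : Fin 3) : H2 T →L[ℝ] L2 T :=
  (PiLp.proj 2 (fun _ : Fin 3 => L2 T) j : PiLp 2 (fun _ : Fin 3 => L2 T) →L[ℝ] L2 T).comp
    (H2 T).subtypeL

theorem D_smul {T : ℝ} (j : Fin 3) (c : ℝ) (u : H2 T) : D j (c • u) = c • D j u := rfl

theorem H2.inner_eq {T : ℝ} (u v : H2 T) :
    inner ℝ u v = inner ℝ (D 0 u) (D 0 v) + inner ℝ (D 1 u) (D 1 v)
      + inner ℝ (D 2 u) (D 2 v) := by
  rw [Submodule.coe_inner, PiLp.inner_apply, Fin.sum_univ_three]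
  rfl

theorem norm_D_le {T : ℝ} (j : Fin 3) (u : H2 T) : ‖D j u‖ ≤ ‖u‖ :=
  PiLp.norm_apply_le u.1 j

theorem isPeriodicDeriv_D01 {T : ℝ} (u : H2 T) : IsPeriodicDeriv T (D 0 u) (D 1 u) :=
  ⟨u.2.1, u.2.2.2.1⟩

theorem isPeriodicDeriv_D12 {T : ℝ} (u : H2 T) : IsPeriodicDeriv T (D 1 u) (D 2 u) :=
  ⟨u.2.2.1, u.2.2.2.2⟩

theorem inner_D1_D1 {T : ℝ} (hT : 0 < T) (u v : H2 T) :
    inner ℝ (D 1 u) (D 1 v) = -inner ℝ (D 2 u) (D 0 v) := by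
  have := (isPeriodicDeriv_D12 u).inner_add hT (isPeriodicDeriv_D01 v)
  linarith

theorem inner_D0_D2 {T : ℝ} (hT : 0 < T) (u v : H2 T) :
    inner ℝ (D 0 u) (D 2 v) = inner ℝ (D 2 u) (D 0 v) := by
  have := inner_D1_D1 hT v u
  rw [real_inner_comm, inner_D1_D1 hT u v, real_inner_comm (D 0 u) (D 2 v)] at this
  linarith

/-- The continuous representative of `u'`. -/
def dval {T : ℝ} (u : H2 T) : ℝ → ℝ := Classical.choose u.2.2.2.2

theorem dval_continuousOn {T : ℝ} (u : H2 T) : ContinuousOn (dval u) (Icc 0 T) :=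
  (Classical.choose_spec u.2.2.2.2).1

theorem dval_ae_eq {T : ℝ} (u : H2 T) : D 1 u =ᵐ[mu T] dval u :=
  (Classical.choose_spec u.2.2.2.2).2.1

theorem val_zero_eq {T : ℝ} (u : H2 T) : val u 0 = val u T :=
  (Classical.choose_spec u.2.2.2.1).2.2

theorem val_eqOn {T : ℝ} (hT : 0 < T) {u : H2 T} {f : ℝ → ℝ} (hf : ContinuousOn f (Icc 0 T))
    (h : D 0 u =ᵐ[mu T] f) : EqOn (val u) f (Icc 0 T) :=
  eqOn_Icc_of_ae_eq hT ((val_ae_eq u).symm.trans h) (val_continuousOn u) hf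

theorem dval_eqOn {T : ℝ} (hT : 0 < T) {u : H2 T} {f : ℝ → ℝ} (hf : ContinuousOn f (Icc 0 T))
    (h : D 1 u =ᵐ[mu T] f) : EqOn (dval u) f (Icc 0 T) :=
  eqOn_Icc_of_ae_eq hT ((dval_ae_eq u).symm.trans h) (dval_continuousOn u) hf

theorem val_add {T : ℝ} (hT : 0 < T) (u v : H2 T) :
    EqOn (val (u + v)) (val u + val v) (Icc 0 T) :=
  val_eqOn hT ((val_continuousOn u).add (val_continuousOn v))
    ((Lp.coeFn_add _ _).trans ((val_ae_eq u).add (val_ae_eq v)))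

theorem val_smul {T : ℝ} (hT : 0 < T) (c : ℝ) (u : H2 T) :
    EqOn (val (c • u)) (c • val u) (Icc 0 T) :=
  val_eqOn hT ((val_continuousOn u).const_smul c)
    ((Lp.coeFn_smul _ _).trans ((val_ae_eq u).const_smul c))

theorem dval_add {T : ℝ} (hT : 0 < T) (u v : H2 T) :
    EqOn (dval (u + v)) (dval u + dval v) (Icc 0 T) :=
  dval_eqOn hT ((dval_continuousOn u).add (dval_continuousOn v))
    ((Lp.coeFn_add _ _).trans ((dval_ae_eq u).add (dval_ae_eq v)))

/-- On the open interval `val u` is a primitive of the continuous function `dval u`, so the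
fundamental theorem of calculus gives a classical derivative. -/
theorem hasDerivAt_val {T : ℝ} (hT : 0 < T) (u : H2 T) {t : ℝ} (ht : t ∈ Ioo 0 T) :
    HasDerivAt (val u) (dval u t) t := by
  obtain ⟨⟨c, hc⟩, -⟩ := (isPeriodicDeriv_iff hT _ _).1 (isPeriodicDeriv_D01 u)
  have e := val_eqOn hT (continuous_primitive hT _ c) hc
  have hi := L2.intervalIntegrable hT (D 1 u)
  have cd := dval_continuousOn u
  have e2 : ∀ x ∈ Ioo 0 T, val u x = c + ∫ s in 0..x, dval u s := by
    intro x hx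
    rw [e (Ioo_subset_Icc_self hx)]
    refine congrArg (c + ·) ?_
    apply intervalIntegral.integral_congr_ae
    filter_upwards [ae_mu_iff.1 (dval_ae_eq u)] with s hs hs'
    rw [uIoc_of_le hx.1.le] at hs'
    exact hs ⟨hs'.1, hs'.2.trans hx.2.le⟩
  have hnhds : Ioo 0 T ∈ nhds t := isOpen_Ioo.mem_nhds ht
  have hd : HasDerivAt (fun x => c + ∫ s in 0..x, dval u s) (dval u t) t := by
    refine HasDerivAt.const_add c (intervalIntegral.integral_hasDerivAt_right ?_ ?_ ?_)
    · refine ContinuousOn.intervalIntegrable (cd.mono ?_)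
      rw [uIcc_of_le ht.1.le]
      exact Icc_subset_Icc_right ht.2.le
    · exact (cd.mono Ioo_subset_Icc_self).stronglyMeasurableAtFilter isOpen_Ioo t ht
    · exact (cd.mono Ioo_subset_Icc_self).continuousAt hnhds
  exact hd.congr_of_eventuallyEq (Filter.eventually_of_mem hnhds e2)

theorem abs_val_le {T : ℝ} (hT : 0 < T) (u : H2 T) {t : ℝ} (ht : t ∈ Icc 0 T) :
    |val u t| ≤ (√T / T + √T) * ‖u‖ := by
  obtain ⟨⟨c, hc⟩, -⟩ := (isPeriodicDeriv_iff hT _ _).1 (isPeriodicDeriv_D01 u)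
  rw [val_eqOn hT (continuous_primitive hT _ c) hc ht, add_mul]
  refine (abs_le_of_primitive hT hc ht).trans ?_
  gcongr <;> exact norm_D_le _ _

theorem abs_dval_le {T : ℝ} (hT : 0 < T) (u : H2 T) {t : ℝ} (ht : t ∈ Icc 0 T) :
    |dval u t| ≤ (√T / T + √T) * ‖u‖ := by
  obtain ⟨⟨c, hc⟩, -⟩ := (isPeriodicDeriv_iff hT _ _).1 (isPeriodicDeriv_D12 u)
  rw [dval_eqOn hT (continuous_primitive hT _ c) hc ht, add_mul]
  refine (abs_le_of_primitive hT hc ht).trans ?_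
  gcongr <;> exact norm_D_le _ _

/-! ### The trigonometric system -/

/-- The frequencies: `inl k` for `cos(2πkt/T)`, `inr k` for `sin(2π(k+1)t/T)`. -/
abbrev Freq : Type := ℕ ⊕ ℕ

/-- The wave number of a frequency. -/
def waveNumber : Freq → ℕ := Sum.elim id Nat.succ

/-- The trigonometric functions, as elements of `H²`. -/
def trig (T : ℝ) : Freq → H2 T := Sum.elim (cosFun T) (fun k => sinFun T (k + 1))

theorem D0_cosFun_ae (T : ℝ) (k : ℕ) : D 0 (cosFun T k) =ᵐ[mu T]
    fun t => √(2 / T) * Real.cos (2 * Real.pi * k / T * t) :=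
  (memLp_of_continuous T (by fun_prop)).coeFn_toLp

theorem D1_cosFun_ae (T : ℝ) (k : ℕ) : D 1 (cosFun T k) =ᵐ[mu T]
    fun t => -(√(2 / T) * (2 * Real.pi * k / T)) * Real.sin (2 * Real.pi * k / T * t) :=
  (memLp_of_continuous T (by fun_prop)).coeFn_toLp

theorem D2_cosFun_ae (T : ℝ) (k : ℕ) : D 2 (cosFun T k) =ᵐ[mu T]
    fun t => -(√(2 / T) * (2 * Real.pi * k / T)) * (2 * Real.pi * k / T) *
      Real.cos (2 * Real.pi * k / T * t) :=
  (memLp_of_continuous T (by fun_prop)).coeFn_toLp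

theorem D0_sinFun_ae (T : ℝ) (k : ℕ) : D 0 (sinFun T k) =ᵐ[mu T]
    fun t => √(2 / T) * Real.sin (2 * Real.pi * k / T * t) :=
  (memLp_of_continuous T (by fun_prop)).coeFn_toLp

theorem D1_sinFun_ae (T : ℝ) (k : ℕ) : D 1 (sinFun T k) =ᵐ[mu T]
    fun t => √(2 / T) * (2 * Real.pi * k / T) * Real.cos (2 * Real.pi * k / T * t) :=
  (memLp_of_continuous T (by fun_prop)).coeFn_toLp

theorem D2_sinFun_ae (T : ℝ) (k : ℕ) : D 2 (sinFun T k) =ᵐ[mu T]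
    fun t => -(√(2 / T) * (2 * Real.pi * k / T) * (2 * Real.pi * k / T)) *
      Real.sin (2 * Real.pi * k / T * t) :=
  (memLp_of_continuous T (by fun_prop)).coeFn_toLp

theorem D2_cosFun (T : ℝ) (k : ℕ) : D 2 (cosFun T k) = (-sigma T k) • D 0 (cosFun T k) := by
  rw [Lp.ext_iff]
  filter_upwards [D2_cosFun_ae T k, D0_cosFun_ae T k,
    Lp.coeFn_smul (-sigma T k) (D 0 (cosFun T k))] with t h2 h0 h
  rw [h, h2, Pi.smul_apply, h0, sigma, smul_eq_mul]
  ring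

theorem D2_sinFun (T : ℝ) (k : ℕ) : D 2 (sinFun T k) = (-sigma T k) • D 0 (sinFun T k) := by
  rw [Lp.ext_iff]
  filter_upwards [D2_sinFun_ae T k, D0_sinFun_ae T k,
    Lp.coeFn_smul (-sigma T k) (D 0 (sinFun T k))] with t h2 h0 h
  rw [h, h2, Pi.smul_apply, h0, sigma, smul_eq_mul]
  ring

theorem D2_trig (T : ℝ) (i : Freq) :
    D 2 (trig T i) = (-sigma T (waveNumber i)) • D 0 (trig T i) := by
  rcases i with k | k
  · exact D2_cosFun T k
  · exact D2_sinFun T (k + 1)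

/-- Two periodic integrations by parts move `u''` onto an eigenfunction; this diagonalizes the
second derivative without differentiating any series. -/
theorem inner_trig_D2 {T : ℝ} (hT : 0 < T) (i : Freq) (u : H2 T) :
    inner ℝ (D 0 (trig T i)) (D 2 u) = -sigma T (waveNumber i) * inner ℝ (D 0 (trig T i)) (D 0 u) := by
  rw [inner_D0_D2 hT, D2_trig, real_inner_smul_left]

/-! ### Reflection and parity -/

theorem measurePreserving_reflect (T : ℝ) :
    MeasurePreserving (fun t : ℝ => T - t) (mu T) (mu T) := by
  have h := (Measure.measurePreserving_sub_left (volume : Measure ℝ) T).restrict_preimage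
    (measurableSet_Ioc (a := (0 : ℝ)) (b := T))
  have h2 : (fun t : ℝ => T - t) ⁻¹' Ioc 0 T = Ico 0 T := by
    ext t
    simp only [mem_preimage, mem_Ioc, mem_Ico]
    constructor <;> rintro ⟨h, h'⟩ <;> constructor <;> linarith
  rw [h2, ← restrict_Ioo_eq_restrict_Ico, restrict_Ioo_eq_restrict_Ioc] at h
  exact h

/-- The reflection `u(t) ↦ u(T - t)` of `L²`. -/
def reflect (T : ℝ) : L2 T →ₗᵢ[ℝ] L2 T :=
  Lp.compMeasurePreservingₗᵢ ℝ (fun t : ℝ => T - t) (measurePreserving_reflect T)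

theorem reflect_ae {T : ℝ} (u : L2 T) : reflect T u =ᵐ[mu T] fun t => u (T - t) :=
  Lp.coeFn_compMeasurePreserving u (measurePreserving_reflect T)

theorem mem_L2sym_iff {T c : ℝ} {u : L2 T} : u ∈ L2sym T c ↔ reflect T u = c • u := by
  change (∀ᵐ t ∂(mu T), u (T - t) = c * u t) ↔ _
  rw [Lp.ext_iff]
  constructor
  · intro h
    filter_upwards [h, reflect_ae u, Lp.coeFn_smul c u] with t h1 h2 h3
    rw [h2, h1, h3, Pi.smul_apply, smul_eq_mul]
  · intro h
    filter_upwards [h, reflect_ae u, Lp.coeFn_smul c u] with t h1 h2 h3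
    rw [← h2, h1, h3, Pi.smul_apply, smul_eq_mul]

/-- The parity of a trigonometric function. -/
def parity : Freq → ℝ := Sum.elim (fun _ => 1) (fun _ => -1)

theorem trig_mem_L2sym {T : ℝ} (hT : 0 < T) (i : Freq) :
    D 0 (trig T i) ∈ L2sym T (parity i) := by
  have hr := (quasiMeasurePreserving_reflect T)
  change ∀ᵐ t ∂(mu T), _
  rcases i with k | k
  · change ∀ᵐ t ∂(mu T), D 0 (cosFun T k) (T - t) = 1 * D 0 (cosFun T k) t
    filter_upwards [D0_cosFun_ae T k, hr.ae (D0_cosFun_ae T k)] with t h1 h2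
    rw [h1, h2, mul_sub, div_mul_cancel₀ _ hT.ne', mul_comm (2 * Real.pi),
      Real.cos_nat_mul_two_pi_sub, one_mul]
  · change ∀ᵐ t ∂(mu T), D 0 (sinFun T (k + 1)) (T - t) = -1 * D 0 (sinFun T (k + 1)) t
    filter_upwards [D0_sinFun_ae T (k + 1), hr.ae (D0_sinFun_ae T (k + 1))] with t h1 h2
    rw [h1, h2, mul_sub, div_mul_cancel₀ _ hT.ne', mul_comm (2 * Real.pi),
      Real.sin_nat_mul_two_pi_sub]
    ring

theorem parity_mul_self (i : Freq) : parity i * parity i = 1 := by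
  rcases i with k | k <;> norm_num [parity]

/-- Reflection is an isometry acting on each trigonometric function by its parity, which is its own
inverse. -/
theorem inner_reflect_trig {T : ℝ} (hT : 0 < T) (i : Freq) (f : L2 T) :
    inner ℝ (D 0 (trig T i)) (reflect T f) = parity i * inner ℝ (D 0 (trig T i)) f := by
  have h := mem_L2sym_iff.1 (trig_mem_L2sym hT i)
  rw [← (reflect T).inner_map_map (D 0 (trig T i)) f, h, real_inner_smul_left, ← mul_assoc,
    parity_mul_self, one_mul]

theorem inner_cosFun {T : ℝ} (k : ℕ) (f : L2 T) : inner ℝ (D 0 (cosFun T k)) f =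
    √(2 / T) * ∫ t, Real.cos (2 * Real.pi * k / T * t) * f t ∂(mu T) := by
  rw [L2.inner_eq, ← integral_const_mul]
  apply integral_congr_ae
  filter_upwards [D0_cosFun_ae T k] with t h
  rw [h, mul_assoc]

theorem inner_sinFun {T : ℝ} (k : ℕ) (f : L2 T) : inner ℝ (D 0 (sinFun T k)) f =
    √(2 / T) * ∫ t, Real.sin (2 * Real.pi * k / T * t) * f t ∂(mu T) := by
  rw [L2.inner_eq, ← integral_const_mul]
  apply integral_congr_ae
  filter_upwards [D0_sinFun_ae T k] with t h
  rw [h, mul_assoc]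

/-- The trigonometric system is total in `L²`. -/
theorem eq_zero_of_inner_trig {T : ℝ} (hT : 0 < T) {f : L2 T}
    (h : ∀ i, inner ℝ (D 0 (trig T i)) f = 0) : f = 0 := by
  have hs : √(2 / T) ≠ 0 := by positivity
  have hc : ∀ n : ℤ, ∫ t, Real.cos (2 * Real.pi * n / T * t) * f t ∂(mu T) = 0 := by
    have key : ∀ k : ℕ, ∫ t, Real.cos (2 * Real.pi * k / T * t) * f t ∂(mu T) = 0 := by
      intro k
      have := h (Sum.inl k)
      change inner ℝ (D 0 (cosFun T k)) f = 0 at this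
      rw [inner_cosFun] at this
      exact (mul_eq_zero.1 this).resolve_left hs
    intro n
    obtain ⟨k, rfl | rfl⟩ := n.eq_nat_or_neg
    · exact_mod_cast key k
    · rw [← key k]
      congr 1 with t
      push_cast
      rw [← Real.cos_neg]
      congr 2
      ring
  have hsin : ∀ n : ℤ, ∫ t, Real.sin (2 * Real.pi * n / T * t) * f t ∂(mu T) = 0 := by
    have key : ∀ k : ℕ, ∫ t, Real.sin (2 * Real.pi * k / T * t) * f t ∂(mu T) = 0 := by
      intro k
      rcases k with _ | k
      · simp
      have := h (Sum.inr k)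
      change inner ℝ (D 0 (sinFun T (k + 1))) f = 0 at this
      rw [inner_sinFun] at this
      exact (mul_eq_zero.1 this).resolve_left hs
    intro n
    obtain ⟨k, rfl | rfl⟩ := n.eq_nat_or_neg
    · exact_mod_cast key k
    · rw [← neg_zero, ← key k, ← integral_neg]
      congr 1 with t
      push_cast
      rw [← neg_mul, ← Real.sin_neg]
      congr 2
      ring
  -- Complexify: every complex Fourier coefficient is a combination of a cosine and a sine integral,
  -- both zero, and Parseval's identity finishes the argument.
  set g : ℝ → ℂ := fun t => (f t : ℂ) with hg
  have hgL : MemLp g 2 (volume.restrict (Ioc 0 T)) := (Lp.memLp f).ofReal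
  have hcoef : ∀ n, fourierCoeffOn hT g n = 0 := by
    intro n
    rw [fourierCoeffOn_eq_integral, intervalIntegral.integral_of_le hT.le]
    have hi : ∀ {φ : ℝ → ℝ}, Continuous φ → Integrable (fun t => φ t * f t) (mu T) := by
      intro φ hφ
      exact MemLp.integrable_mul (memLp_of_continuous T hφ) (Lp.memLp f)
    have i1 : Integrable (fun t => ((Real.cos (2 * Real.pi * n / T * t) * f t : ℝ) : ℂ)) (mu T) :=
      (hi (φ := fun t => Real.cos (2 * Real.pi * n / T * t)) (by fun_prop)).ofReal
    have i2 : Integrable (fun t => ((Real.sin (2 * Real.pi * n / T * t) * f t : ℝ) : ℂ)) (mu T) :=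
      (hi (φ := fun t => Real.sin (2 * Real.pi * n / T * t)) (by fun_prop)).ofReal
    have e : ∫ t, fourier (-n) (t : AddCircle (T - 0)) • g t ∂(mu T)
        = ∫ t, (((Real.cos (2 * Real.pi * n / T * t) * f t : ℝ) : ℂ)
          - Complex.I * ((Real.sin (2 * Real.pi * n / T * t) * f t : ℝ) : ℂ)) ∂(mu T) := by
      congr 1 with t
      rw [fourier_coe_apply, smul_eq_mul, hg]
      have : 2 * Real.pi * Complex.I * ((-n : ℤ) : ℂ) * t / ((T - 0 : ℝ) : ℂ)
          = ((-(2 * Real.pi * n / T * t) : ℝ) : ℂ) * Complex.I := by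
        push_cast
        rw [sub_zero]
        ring
      rw [this, Complex.exp_mul_I, ← Complex.ofReal_cos, ← Complex.ofReal_sin, Real.cos_neg,
        Real.sin_neg]
      push_cast
      ring
    rw [e, integral_sub i1 (i2.const_mul _), integral_const_mul, integral_complex_ofReal,
      integral_complex_ofReal, hc, hsin]
    simp
  have hsum := hasSum_sq_fourierCoeffOn hT hgL
  simp only [hcoef, norm_zero, ne_eq, OfNat.ofNat_ne_zero, not_false_eq_true, zero_pow] at hsum
  have h0 := hsum.unique hasSum_zero
  rw [sub_zero, smul_eq_zero, or_iff_right (inv_ne_zero hT.ne'),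
    intervalIntegral.integral_of_le hT.le] at h0
  rw [← inner_self_eq_zero (𝕜 := ℝ), L2.inner_eq, ← h0]
  congr 1 with t
  simp [hg, sq]

theorem eq_of_inner_trig {T : ℝ} (hT : 0 < T) {f g : L2 T}
    (h : ∀ i, inner ℝ (D 0 (trig T i)) f = inner ℝ (D 0 (trig T i)) g) : f = g := by
  rw [← sub_eq_zero]
  exact eq_zero_of_inner_trig hT fun i => by rw [inner_sub_right, h, sub_self]

/-- Elements are triples, but the first entry determines the others: if `u = 0` then `‖u'‖² = -⟨u'',
u⟩ = 0`, and the Fourier coefficients of `u''` are multiples of those of `u`. -/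
theorem H2.ext {T : ℝ} (hT : 0 < T) {u v : H2 T} (h : D 0 u = D 0 v) : u = v := by
  have key : ∀ w : H2 T, D 0 w = 0 → w = 0 := by
    intro w hw
    have h1 : D 1 w = 0 := by
      have := inner_D1_D1 hT w w
      rwa [hw, inner_zero_right, neg_zero, inner_self_eq_zero] at this
    have h2 : D 2 w = 0 := eq_zero_of_inner_trig hT fun i => by
      rw [inner_trig_D2 hT, hw, inner_zero_right, mul_zero]
    rw [← inner_self_eq_zero (𝕜 := ℝ), H2.inner_eq, hw, h1, h2]
    simp
  rw [← sub_eq_zero]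
  apply key
  change D 0 u - D 0 v = 0
  rw [h, sub_self]

/-- Reflection multiplies coefficients by the parity, so by totality the symmetry says that
coefficients of any other parity vanish. -/
theorem mem_L2sym_iff_inner {T : ℝ} (hT : 0 < T) {c : ℝ} {f : L2 T} :
    f ∈ L2sym T c ↔ ∀ i, parity i ≠ c → inner ℝ (D 0 (trig T i)) f = 0 := by
  rw [mem_L2sym_iff]
  constructor
  · intro h i hi
    have h1 := inner_reflect_trig hT i f
    rw [h, real_inner_smul_right, ← sub_eq_zero, ← sub_mul] at h1
    exact (mul_eq_zero.1 h1).resolve_left (sub_ne_zero.2 hi.symm)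
  · intro h
    apply eq_of_inner_trig hT
    intro i
    rw [inner_reflect_trig hT, real_inner_smul_right]
    by_cases hi : parity i = c
    · rw [hi]
    · rw [h i hi, mul_zero, mul_zero]

theorem sigma_nonneg (T : ℝ) (k : ℕ) : 0 ≤ sigma T k := sq_nonneg _

theorem sigma_injective {T : ℝ} (hT : 0 < T) : Function.Injective (sigma T) := by
  intro j k h
  have hp := Real.pi_pos
  have h1 := (sq_eq_sq₀ (by positivity) (by positivity)).1 h
  field_simp at h1
  exact_mod_cast h1

theorem freq_ext {i j : Freq} (h : waveNumber i = waveNumber j) (h' : parity i = parity j) :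
    i = j := by
  rcases i with i | i <;> rcases j with j | j
  · exact congrArg _ h
  · norm_num [parity] at h'
  · norm_num [parity] at h'
  · exact congrArg _ (Nat.succ_injective h)

/-- Different wave numbers belong to different eigenvalues of the symmetric operator `u ↦ u''`;
equal wave numbers force opposite parities. -/
theorem inner_trig_trig {T : ℝ} (hT : 0 < T) {i j : Freq} (hij : i ≠ j) :
    inner ℝ (D 0 (trig T i)) (D 0 (trig T j)) = 0 := by
  by_cases hw : waveNumber i = waveNumber j
  · have hp : parity i ≠ parity j := fun h => hij (freq_ext hw h)
    exact (mem_L2sym_iff_inner hT).1 (trig_mem_L2sym hT j) i hp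
  · have h := inner_trig_D2 hT i (trig T j)
    rw [D2_trig, real_inner_smul_right, ← sub_eq_zero, ← sub_mul] at h
    refine (mul_eq_zero.1 h).resolve_left fun h0 => hw (sigma_injective hT ?_)
    linarith

theorem val_cosFun {T : ℝ} (hT : 0 < T) (k : ℕ) : EqOn (val (cosFun T k))
    (fun t => √(2 / T) * Real.cos (2 * Real.pi * k / T * t)) (Icc 0 T) :=
  val_eqOn hT (by fun_prop) (D0_cosFun_ae T k)

theorem val_sinFun {T : ℝ} (hT : 0 < T) (k : ℕ) : EqOn (val (sinFun T k))
    (fun t => √(2 / T) * Real.sin (2 * Real.pi * k / T * t)) (Icc 0 T) :=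
  val_eqOn hT (by fun_prop) (D0_sinFun_ae T k)

theorem dval_cosFun {T : ℝ} (hT : 0 < T) (k : ℕ) : EqOn (dval (cosFun T k))
    (fun t => -(√(2 / T) * (2 * Real.pi * k / T)) * Real.sin (2 * Real.pi * k / T * t))
    (Icc 0 T) :=
  dval_eqOn hT (by fun_prop) (D1_cosFun_ae T k)

theorem dval_sinFun {T : ℝ} (hT : 0 < T) (k : ℕ) : EqOn (dval (sinFun T k))
    (fun t => √(2 / T) * (2 * Real.pi * k / T) * Real.cos (2 * Real.pi * k / T * t))
    (Icc 0 T) :=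
  dval_eqOn hT (by fun_prop) (D1_sinFun_ae T k)

theorem D0_trig_ne_zero {T : ℝ} (hT : 0 < T) (i : Freq) : D 0 (trig T i) ≠ 0 := by
  intro h
  have hs : √(2 / T) ≠ 0 := by positivity
  have hv : ∀ t ∈ Icc 0 T, val (trig T i) t = 0 :=
    val_eqOn (f := fun _ => 0) hT continuousOn_const (by rw [h]; exact Lp.coeFn_zero ℝ 2 (mu T))
  rcases i with k | k
  · have h0 : (0 : ℝ) ∈ Icc 0 T := ⟨le_rfl, hT.le⟩
    have := (val_cosFun hT k h0).symm.trans (hv 0 h0)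
    simp at this
    exact hs (by simp [this])
  -- A quarter of the period of the sine, where its phase is `π/2`.
  · have h0 : T / (4 * (k + 1 : ℕ)) ∈ Icc 0 T := by
      refine ⟨by positivity, div_le_self hT.le ?_⟩
      push_cast
      linarith [(Nat.cast_nonneg k : (0 : ℝ) ≤ k)]
    have := (val_sinFun hT (k + 1) h0).symm.trans (hv _ h0)
    have e : 2 * Real.pi * ((k + 1 : ℕ) : ℝ) / T * (T / (4 * ((k + 1 : ℕ) : ℝ))) = Real.pi / 2 := by
      have : ((k + 1 : ℕ) : ℝ) ≠ 0 := by positivity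
      field_simp
      norm_num
    simp only [e, Real.sin_pi_div_two, mul_one] at this
    exact hs this

/-! ### Fourier multipliers -/

/-- The trigonometric functions, normalized in `L²`. -/
def trigN (T : ℝ) (i : Freq) : H2 T := ‖D 0 (trig T i)‖⁻¹ • trig T i

theorem orthonormal_trigN {T : ℝ} (hT : 0 < T) : Orthonormal ℝ fun i => D 0 (trigN T i) := by
  constructor
  · intro i
    simp only [trigN]
    rw [D_smul, norm_smul, norm_inv, norm_norm,
      inv_mul_cancel₀ (norm_ne_zero_iff.2 (D0_trig_ne_zero hT i))]
  · intro i j hij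
    simp only [trigN]
    rw [D_smul, D_smul, real_inner_smul_left, real_inner_smul_right, inner_trig_trig hT hij]
    simp

theorem D2_trigN (T : ℝ) (i : Freq) :
    D 2 (trigN T i) = (-sigma T (waveNumber i)) • D 0 (trigN T i) := by
  simp only [trigN]
  rw [D_smul, D_smul, D2_trig, smul_comm]

/-- The system stays orthogonal in `H²`, with squared norm `1 + σ + σ² ≤ (1 + σ)²`; this is the
weight occurring in the multiplier bound. -/
theorem H2_inner_trigN {T : ℝ} (hT : 0 < T) (i j : Freq) : inner ℝ (trigN T i) (trigN T j) =
    (1 + sigma T (waveNumber i) + sigma T (waveNumber i) * sigma T (waveNumber j)) *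
      inner ℝ (D 0 (trigN T i)) (D 0 (trigN T j)) := by
  rw [H2.inner_eq, inner_D1_D1 hT, D2_trigN, D2_trigN, real_inner_smul_left, real_inner_smul_left,
    real_inner_smul_right]
  ring

/-- Fourier multipliers of order `-2` map `L²` to `H²`. -/
theorem exists_multiplier {T : ℝ} (hT : 0 < T) (f : L2 T) (m : Freq → ℝ) {C : ℝ}
    (hm : ∀ i, |m i| * (1 + sigma T (waveNumber i)) ≤ C) :
    ∃ u : H2 T, ∀ i, inner ℝ (D 0 (trig T i)) (D 0 u) = m i * inner ℝ (D 0 (trig T i)) f := by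
  have := completeSpace_H2 hT
  have ho := orthonormal_trigN hT
  set b : Freq → H2 T := trigN T with hb
  set x : Freq → ℝ := fun i => m i * inner ℝ (D 0 (b i)) f with hx
  -- The decay of `m` compensates the growth of the `H²` norms, leaving terms that Bessel's
  -- inequality for `f` sums.
  have hn : ∀ i, ‖x i • b i‖ ^ 2 ≤ C ^ 2 * ‖inner ℝ (D 0 (b i)) f‖ ^ 2 := by
    intro i
    have h0 := sigma_nonneg T (waveNumber i)
    have h1 : ‖b i‖ ^ 2 ≤ (1 + sigma T (waveNumber i)) ^ 2 := by
      rw [← real_inner_self_eq_norm_sq, H2_inner_trigN hT, real_inner_self_eq_norm_sq, ho.1 i]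
      nlinarith
    have h2 : (|m i| * (1 + sigma T (waveNumber i))) ^ 2 ≤ C ^ 2 :=
      pow_le_pow_left₀ (by positivity) (hm i) 2
    rw [norm_smul, hx, norm_mul, mul_pow, mul_pow, Real.norm_eq_abs (m i)]
    calc |m i| ^ 2 * ‖inner ℝ (D 0 (b i)) f‖ ^ 2 * ‖b i‖ ^ 2
        ≤ |m i| ^ 2 * ‖inner ℝ (D 0 (b i)) f‖ ^ 2 * (1 + sigma T (waveNumber i)) ^ 2 := by gcongr
      _ = (|m i| * (1 + sigma T (waveNumber i))) ^ 2 * ‖inner ℝ (D 0 (b i)) f‖ ^ 2 := by ring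
      _ ≤ _ := by gcongr
  have hsum : Summable fun i => x i • b i := by
    have hb0 : ∀ i, ‖b i‖ ≠ 0 := fun i => by
      rw [norm_ne_zero_iff]
      intro h
      have : ‖D 0 (b i)‖ = 1 := ho.1 i
      rw [h] at this
      exact zero_ne_one ((norm_zero (E := L2 T)).symm.trans this)
    -- After renormalization in `H²`, convergence of the series is equivalent to summability of the
    -- squared norms of its terms.
    have hob : Orthonormal ℝ fun i => ‖b i‖⁻¹ • b i := by
      refine ⟨fun i => by rw [norm_smul, norm_inv, norm_norm, inv_mul_cancel₀ (hb0 i)],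
        fun i j hij => ?_⟩
      have h : inner ℝ (b i) (b j) = 0 := by rw [H2_inner_trigN hT, ho.2 hij, mul_zero]
      change inner ℝ (‖b i‖⁻¹ • b i) (‖b j‖⁻¹ • b j) = 0
      rw [real_inner_smul_left (b i), real_inner_smul_right (b i), h]
      simp
    have := hob.orthogonalFamily.summable_iff_norm_sq_summable (fun i => x i * ‖b i‖)
    simp only [LinearIsometry.toSpanSingleton_apply, smul_smul, mul_assoc, norm_mul, norm_norm] at this
    simp only [mul_inv_cancel₀ (hb0 _), mul_one, ← norm_smul] at this
    refine this.2 (Summable.of_nonneg_of_le (fun i => sq_nonneg _) hn ?_)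
    exact (ho.inner_products_summable f).mul_left _
  refine ⟨∑' i, x i • b i, fun i => ?_⟩
  have hts := (hsum.hasSum.mapL (derivL 0)).mapL (innerSL ℝ (D 0 (b i)))
  have key : inner ℝ (D 0 (b i)) (D 0 (∑' i, x i • b i)) = x i := by
    refine hts.unique ?_
    have e : ∀ j, j ≠ i → (innerSL ℝ (D 0 (b i))) (derivL 0 (x j • b j)) = 0 := by
      intro j hj
      change inner ℝ (D 0 (b i)) (D 0 (x j • b j)) = 0
      rw [D_smul, real_inner_smul_right, ho.2 hj.symm, mul_zero]
    have h1 := hasSum_single i e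
    have h2 : (innerSL ℝ (D 0 (b i))) (derivL 0 (x i • b i)) = x i := ?_
    · rwa [h2] at h1
    change inner ℝ (D 0 (b i)) (D 0 (x i • b i)) = x i
    rw [D_smul, real_inner_smul_right, real_inner_self_eq_norm_sq, ho.1 i]
    ring
  have key2 := key
  simp only [hx, hb] at key2 ⊢
  generalize (∑' i, _ : H2 T) = u at key2 ⊢
  simp only [trigN, D_smul, real_inner_smul_left] at key2
  have hne : ‖D 0 (trig T i)‖⁻¹ ≠ 0 := inv_ne_zero (norm_ne_zero_iff.2 (D0_trig_ne_zero hT i))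
  rw [mul_left_comm] at key2
  exact mul_left_cancel₀ hne key2

/-! ### The cubic term and the linearization -/

/-- The embedding of `H²` into the continuous functions. -/
def toCont {T : ℝ} (hT : 0 < T) : H2 T →L[ℝ] C(Icc (0 : ℝ) T, ℝ) :=
  LinearMap.mkContinuous
    { toFun := fun u => ⟨(Icc 0 T).domRestrict (val u), (val_continuousOn u).domRestrict⟩
      map_add' := fun u v => ContinuousMap.ext fun t => val_add hT u v t.2
      map_smul' := fun c u => ContinuousMap.ext fun t => val_smul hT c u t.2 }
    (√T / T + √T) (fun u => by
      rw [ContinuousMap.norm_le _ (by positivity)]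
      intro t
      exact abs_val_le hT u t.2)

theorem memLp_weight_mul {T : ℝ} (hT : 0 < T) (a : Linf T) (h : C(Icc (0 : ℝ) T, ℝ)) :
    MemLp (fun t => a t * IccExtend hT.le h t) 2 (mu T) :=
  (memLp_of_continuous T (h.continuous.Icc_extend')).mul (Lp.memLp a)

theorem ae_abs_le_norm {T : ℝ} (a : Linf T) : ∀ᵐ t ∂(mu T), ‖a t‖ ≤ ‖a‖ := by
  filter_upwards [ae_le_eLpNormEssSup (f := a) (μ := mu T)] with t ht
  rw [Lp.norm_def, eLpNorm_exponent_top]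
  have h := Lp.eLpNorm_ne_top a
  rw [eLpNorm_exponent_top] at h
  simpa using ENNReal.toReal_mono h ht

/-- Multiplication of continuous functions by the weight, as a map into `L²`. -/
def weightMul {T : ℝ} (hT : 0 < T) (a : Linf T) : C(Icc (0 : ℝ) T, ℝ) →L[ℝ] L2 T :=
  LinearMap.mkContinuous
    { toFun := fun h => (memLp_weight_mul hT a h).toLp
      map_add' := fun h k => by
        rw [← MemLp.toLp_add, MemLp.toLp_eq_toLp_iff]
        filter_upwards with t
        simp only [IccExtend, Function.comp_apply, ContinuousMap.add_apply, Pi.add_apply]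
        ring
      map_smul' := fun c h => by
        rw [RingHom.id_apply, ← MemLp.toLp_const_smul, MemLp.toLp_eq_toLp_iff]
        filter_upwards with t
        simp only [IccExtend, Function.comp_apply, ContinuousMap.smul_apply, Pi.smul_apply,
          smul_eq_mul]
        ring }
    (((mu T) univ).toReal ^ ((2 : ℝ≥0∞).toReal)⁻¹ * ‖a‖) (by
      intro h
      rw [mul_assoc]
      refine Lp.norm_le_of_ae_bound (by positivity) ?_
      refine (memLp_weight_mul hT a h).coeFn_toLp.mp ?_
      filter_upwards [ae_abs_le_norm a] with t ht e
      change ((memLp_weight_mul hT a h).toLp : L2 T) t = _ at e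
      change ‖((memLp_weight_mul hT a h).toLp : L2 T) t‖ ≤ _
      rw [e, norm_mul]
      exact mul_le_mul ht (h.norm_coe_le_norm _) (norm_nonneg _) (norm_nonneg _))

/-- The cubic term `a u³`. -/
def cubic {T : ℝ} (a : Linf T) (u : H2 T) : L2 T := (memLp_cubic a u).toLp

/-- The nonlinearity factors as a bounded linear map into `C([0,T])`, the cube in that Banach
algebra, and a bounded linear map into `L²`. Analyticity, homogeneity and the cubic bound all follow
from this. -/
theorem cubic_eq {T : ℝ} (hT : 0 < T) (a : Linf T) (u : H2 T) :
    cubic a u = weightMul hT a (toCont hT u ^ 3) := by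
  change (memLp_cubic a u).toLp = (memLp_weight_mul hT a (toCont hT u ^ 3)).toLp
  rw [MemLp.toLp_eq_toLp_iff]
  filter_upwards [ae_restrict_mem measurableSet_Ioc] with t ht
  rw [IccExtend_of_mem hT.le _ (Ioc_subset_Icc_self ht)]
  rfl

theorem F_eq {T : ℝ} (a : Linf T) (lam : ℝ) (u : H2 T) :
    F a (lam, u) = derivL 2 u + lam • derivL 0 u + cubic a u := rfl

theorem contDiff_cubic {T : ℝ} (hT : 0 < T) (a : Linf T) : ContDiff ℝ ω (cubic a) := by
  rw [funext (cubic_eq hT a)]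
  exact (weightMul hT a).contDiff.comp ((toCont hT).contDiff.pow 3)

theorem cubic_smul {T : ℝ} (hT : 0 < T) (a : Linf T) (s : ℝ) (u : H2 T) :
    cubic a (s • u) = s ^ 3 • cubic a u := by
  rw [cubic_eq hT, cubic_eq hT, map_smul, smul_pow, map_smul]

theorem exists_norm_cubic_le {T : ℝ} (hT : 0 < T) (a : Linf T) :
    ∃ C, 0 ≤ C ∧ ∀ u, ‖cubic a u‖ ≤ C * ‖u‖ ^ 3 := by
  refine ⟨‖weightMul hT a‖ * ‖toCont hT‖ ^ 3, by positivity, fun u => ?_⟩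
  rw [cubic_eq hT, mul_assoc, ← mul_pow]
  refine ((weightMul hT a).le_opNorm _).trans ?_
  gcongr
  refine (norm_pow_le' _ (by norm_num)).trans ?_
  gcongr
  exact (toCont hT).le_opNorm u

/-- The cubic term is `o(‖u‖)` at the origin and does not contribute. -/
theorem linearization_eq {T : ℝ} (hT : 0 < T) (a : Linf T) (lam : ℝ) :
    linearization a lam = derivL 2 + lam • derivL 0 := by
  have h1 : HasFDerivAt (cubic a) (0 : H2 T →L[ℝ] L2 T) 0 := by
    obtain ⟨C, hC, h⟩ := exists_norm_cubic_le hT a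
    have h0 : cubic a 0 = 0 := by
      have := h 0
      rw [norm_zero] at this
      simpa using this
    refine HasFDerivAt.of_isLittleO ?_
    have : (fun u : H2 T => cubic a u) =O[nhds 0] fun u => ‖u‖ ^ 3 :=
      Asymptotics.IsBigO.of_bound C (Filter.Eventually.of_forall fun u => by
        rw [norm_pow, norm_norm]; exact h u)
    simp only [h0, sub_zero, zero_apply]
    exact this.trans_isLittleO (Asymptotics.isLittleO_norm_pow_id (by norm_num))
  have h2 : HasFDerivAt (fun u => F a (lam, u)) (derivL 2 + lam • derivL 0 + 0) 0 := by
    simp only [F_eq]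
    exact ((derivL 2).hasFDerivAt.add ((derivL 0).hasFDerivAt.const_smul lam)).add h1
  rw [linearization, h2.fderiv, add_zero]

theorem linearization_apply {T : ℝ} (hT : 0 < T) (a : Linf T) (lam : ℝ) (u : H2 T) :
    linearization a lam u = D 2 u + lam • D 0 u := by
  rw [linearization_eq hT]
  rfl

theorem inner_trig_linearization {T : ℝ} (hT : 0 < T) (a : Linf T) (lam : ℝ) (u : H2 T)
    (i : Freq) : inner ℝ (D 0 (trig T i)) (linearization a lam u)
      = (lam - sigma T (waveNumber i)) * inner ℝ (D 0 (trig T i)) (D 0 u) := by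
  rw [linearization_apply hT, inner_add_right, inner_trig_D2 hT, real_inner_smul_right]
  ring

/-- Cubing preserves both parities because `c³ = c` for `c = ±1`, and the weight is even. -/
theorem cubic_mem_L2sym {T c : ℝ} (hc : c ^ 3 = c) {a : Linf T}
    (ha : ∀ᵐ t ∂(mu T), a (T - t) = a t) {u : H2 T} (hu : D 0 u ∈ L2sym T c) :
    cubic a u ∈ L2sym T c := by
  have hq := quasiMeasurePreserving_reflect T
  have e : cubic a u =ᵐ[mu T] fun t => a t * (D 0 u t) ^ 3 := by
    filter_upwards [(memLp_cubic a u).coeFn_toLp, val_ae_eq u] with t h1 h2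
    rw [cubic, h1, h2]
  change ∀ᵐ t ∂(mu T), _
  change ∀ᵐ t ∂(mu T), D 0 u (T - t) = c * D 0 u t at hu
  filter_upwards [e, hq.ae e, ha, hu] with t h1 h2 h3 h4
  rw [h1, h2, h3, h4, mul_pow, hc]
  ring

/-! ### Spectral subspaces and the generalized spectrum -/

/-- `V` is the closed span of the trigonometric functions with frequencies in `P`. -/
def IsSpectral {T : ℝ} (V : Submodule ℝ (L2 T)) (P : Freq → Prop) : Prop :=
  ∀ f, f ∈ V ↔ ∀ i, ¬ P i → inner ℝ (D 0 (trig T i)) f = 0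

theorem isSpectral_top {T : ℝ} : IsSpectral (⊤ : Submodule ℝ (L2 T)) fun _ => True := by
  intro f
  simp

theorem isSpectral_ev {T : ℝ} (hT : 0 < T) : IsSpectral (L2ev T) fun i => parity i = 1 :=
  fun _ => mem_L2sym_iff_inner hT

theorem isSpectral_odd {T : ℝ} (hT : 0 < T) : IsSpectral (L2odd T) fun i => parity i = -1 :=
  fun _ => mem_L2sym_iff_inner hT

theorem H2in_top {T : ℝ} : H2in (⊤ : Submodule ℝ (L2 T)) = ⊤ := by
  ext u
  simp [H2in]

theorem mem_H2in {T : ℝ} {V : Submodule ℝ (L2 T)} {u : H2 T} : u ∈ H2in V ↔ D 0 u ∈ V := Iff.rfl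

theorem exists_equiv_of_bijective {E E' : Type*} [NormedAddCommGroup E] [NormedSpace ℝ E]
    [CompleteSpace E] [NormedAddCommGroup E'] [NormedSpace ℝ E'] [CompleteSpace E']
    (f : E →L[ℝ] E') (hinj : Function.Injective f) (hsurj : Function.Surjective f) :
    ∃ e : E ≃L[ℝ] E', ∀ u, e u = f u :=
  ⟨ContinuousLinearEquiv.ofBijective f (LinearMap.ker_eq_bot.2 hinj)
    (LinearMap.range_eq_top.2 hsurj), fun u =>
      congrFun (ContinuousLinearEquiv.coeFn_ofBijective _ _ _) u⟩

section Spectral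

variable {T : ℝ} {V : Submodule ℝ (L2 T)} {P : Freq → Prop}

theorem IsSpectral.isClosed (hV : IsSpectral V P) : IsClosed (V : Set (L2 T)) := by
  have : (V : Set (L2 T)) = ⋂ i, ⋂ (_ : ¬ P i), {f | inner ℝ (D 0 (trig T i)) f = 0} := by
    ext f
    simp only [SetLike.mem_coe, mem_iInter, mem_ofPred_eq]
    exact hV f
  rw [this]
  exact isClosed_iInter fun i => isClosed_iInter fun _ =>
    isClosed_eq (continuous_const.inner continuous_id) continuous_const

theorem IsSpectral.completeSpace (hV : IsSpectral V P) : CompleteSpace V :=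
  hV.isClosed.completeSpace_coe

theorem IsSpectral.completeSpace_H2in (hT : 0 < T) (hV : IsSpectral V P) :
    CompleteSpace (H2in V) := by
  have := completeSpace_H2 hT
  have h : IsClosed (H2in V : Set (H2 T)) := hV.isClosed.preimage (derivL 0).continuous
  exact h.completeSpace_coe

theorem IsSpectral.linearization_mem (hT : 0 < T) (hV : IsSpectral V P) (a : Linf T) (lam : ℝ)
    {u : H2 T} (hu : u ∈ H2in V) : linearization a lam u ∈ V := by
  rw [hV]
  intro i hi
  rw [inner_trig_linearization hT, (hV _).1 hu i hi, mul_zero]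

/-- The linearization, as an operator from `H²in V` to `V`. -/
def IsSpectral.restrictLin (hT : 0 < T) (hV : IsSpectral V P) (a : Linf T) (lam : ℝ) :
    H2in V →L[ℝ] V :=
  ((linearization a lam).comp (H2in V).subtypeL).codRestrict V
    fun u => hV.linearization_mem hT a lam u.2

/-- The eigenvalues tend to infinity, so the inverses decay like `1/σ`. Since `0⁻¹ = 0`, the bound
also holds for `λ` in the spectrum, where it serves the inverse on the complement of the kernel. -/
theorem exists_resolvent_bound (hT : 0 < T) (lam : ℝ) : ∃ C, ∀ i : Freq,
    |(lam - sigma T (waveNumber i))⁻¹| * (1 + sigma T (waveNumber i)) ≤ C := by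
  have hlim : Filter.Tendsto (sigma T) Filter.atTop Filter.atTop := by
    have : Filter.Tendsto (fun k : ℕ => 2 * Real.pi * (k : ℝ) / T) Filter.atTop Filter.atTop := by
      refine Filter.Tendsto.atTop_div_const hT ?_
      exact (tendsto_natCast_atTop_atTop (R := ℝ)).const_mul_atTop (by positivity)
    exact (Filter.tendsto_pow_atTop (by norm_num)).comp this
  -- Once `σ_k ≥ 2|λ| + 1`, one has `|λ - σ_k| ≥ (1 + σ_k)/2`, hence the bound `2`; the finitely
  -- many other terms are bounded by their sum.
  obtain ⟨N, hN⟩ := Filter.eventually_atTop.1 (hlim.eventually_ge_atTop (2 * |lam| + 1))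
  set g : ℕ → ℝ := fun k => |(lam - sigma T k)⁻¹| * (1 + sigma T k) with hg
  have hg0 : ∀ k, 0 ≤ g k := fun k => mul_nonneg (abs_nonneg _) (by linarith [sigma_nonneg T k])
  refine ⟨2 + ∑ k ∈ Finset.range N, g k, fun i => ?_⟩
  change g (waveNumber i) ≤ _
  generalize waveNumber i = k
  have hs0 : 0 ≤ ∑ k ∈ Finset.range N, g k := Finset.sum_nonneg fun k _ => hg0 k
  by_cases hk : k < N
  · have := Finset.single_le_sum (f := g) (fun k _ => hg0 k) (Finset.mem_range.2 hk)
    linarith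
  · have h1 := hN k (not_lt.1 hk)
    have h2 : 0 < 1 + sigma T k := by linarith [sigma_nonneg T k]
    have h3 : (1 + sigma T k) / 2 ≤ |lam - sigma T k| := by
      rw [abs_sub_comm]
      refine le_trans ?_ (le_abs_self _)
      linarith [le_abs_self lam]
    have h4 : 0 < |lam - sigma T k| := by linarith
    have : g k ≤ 2 := by
      rw [hg]
      simp only [abs_inv]
      rw [inv_mul_le_iff₀ h4]
      linarith
    linarith

/-- Away from the eigenvalues of `V` the diagonal operator is inverted by a multiplier, and the open
mapping theorem makes the bijection an isomorphism. At an eigenvalue the trigonometric function is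
in the kernel. -/
theorem genSpectrum_eq (hT : 0 < T) (hV : IsSpectral V P) (a : Linf T) :
    genSpectrum a (H2in V) V = {lam | ∃ i, P i ∧ lam = sigma T (waveNumber i)} := by
  have := hV.completeSpace
  have := hV.completeSpace_H2in hT
  ext lam
  simp only [genSpectrum, mem_ofPred_eq]
  constructor
  · contrapose!
    intro hlam
    have hinj : Function.Injective (hV.restrictLin hT a lam) := by
      rw [injective_iff_map_eq_zero]
      intro u hu
      have h1 : linearization a lam u = 0 := congrArg Subtype.val hu
      apply Subtype.ext
      refine H2.ext hT ?_
      change D 0 (u : H2 T) = 0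
      refine eq_zero_of_inner_trig hT fun i => ?_
      by_cases hi : P i
      · have h2 := inner_trig_linearization hT a lam u i
        rw [h1, inner_zero_right] at h2
        exact (mul_eq_zero.1 h2.symm).resolve_left (sub_ne_zero.2 (hlam i hi))
      · exact (hV _).1 u.2 i hi
    have hsurj : Function.Surjective (hV.restrictLin hT a lam) := by
      intro f
      obtain ⟨C, hC⟩ := exists_resolvent_bound hT lam
      obtain ⟨u, hu⟩ := exists_multiplier hT (f : L2 T) _ hC
      have huV : u ∈ H2in V := by
        rw [mem_H2in, hV]
        intro i hi
        rw [hu, (hV _).1 f.2 i hi, mul_zero]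
      refine ⟨⟨u, huV⟩, Subtype.ext ?_⟩
      change linearization a lam u = f
      refine eq_of_inner_trig hT fun i => ?_
      rw [inner_trig_linearization hT, hu]
      by_cases hi : P i
      · rw [mul_inv_cancel_left₀ (sub_ne_zero.2 (hlam i hi))]
      · rw [(hV _).1 f.2 i hi, mul_zero, mul_zero]
    have key := @exists_equiv_of_bijective (H2in V) V inferInstance inferInstance _ _ _ _
    obtain ⟨e, he⟩ := key (hV.restrictLin hT a lam) hinj hsurj
    exact ⟨e, fun u => congrArg Subtype.val (he u)⟩
  · rintro ⟨i, hi, rfl⟩ ⟨e, he⟩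
    have hmem : trig T i ∈ H2in V := by
      rw [mem_H2in, hV]
      intro j hj
      exact inner_trig_trig hT (fun h => hj (h ▸ hi))
    have h0 := he ⟨trig T i, hmem⟩
    rw [linearization_apply hT, D2_trig, neg_smul, neg_add_cancel, ZeroMemClass.coe_eq_zero,
      EmbeddingLike.map_eq_zero_iff] at h0
    refine D0_trig_ne_zero hT i ?_
    rw [show trig T i = 0 from congrArg Subtype.val h0]
    rfl

/-- The factor is positive, so being `H²`-orthogonal or `L²`-orthogonal to a trigonometric function
is the same. -/
theorem H2_inner_trig (hT : 0 < T) (i : Freq) (u : H2 T) : inner ℝ (trig T i) u =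
    (1 + sigma T (waveNumber i) + sigma T (waveNumber i) ^ 2) *
      inner ℝ (D 0 (trig T i)) (D 0 u) := by
  rw [H2.inner_eq, inner_D1_D1 hT, D2_trig, real_inner_smul_left, real_inner_smul_left,
    inner_trig_D2 hT]
  ring

/-- The linearization at a simple eigenvalue is injective and surjective up to the eigenfunction. -/
theorem IsSpectral.lin_bijective (hT : 0 < T) (hV : IsSpectral V P) (a : Linf T) {i₀ : Freq}
    {r : ℝ} (hr : r ≠ 0) (hsimple : ∀ i, P i → waveNumber i = waveNumber i₀ → i = i₀) :
    (∀ (m : ℝ) (u : H2 T), u ∈ H2in V → inner ℝ (r • trig T i₀) u = 0 →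
      linearization a (sigma T (waveNumber i₀)) u + m • D 0 (r • trig T i₀) = 0 → m = 0 ∧ u = 0) ∧
    (∀ f ∈ V, ∃ (m : ℝ) (u : H2 T), u ∈ H2in V ∧ inner ℝ (r • trig T i₀) u = 0 ∧
      linearization a (sigma T (waveNumber i₀)) u + m • D 0 (r • trig T i₀) = f) := by
  have h0 := sigma_nonneg T (waveNumber i₀)
  have hn : inner ℝ (D 0 (trig T i₀)) (D 0 (trig T i₀)) ≠ 0 := by
    rw [ne_eq, inner_self_eq_zero]
    exact D0_trig_ne_zero hT i₀
  have horth : ∀ u : H2 T, inner ℝ (r • trig T i₀) u = 0 ↔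
      inner ℝ (D 0 (trig T i₀)) (D 0 u) = 0 := by
    intro u
    rw [real_inner_smul_left (trig T i₀) u r, H2_inner_trig hT, mul_eq_zero, or_iff_right hr,
      mul_eq_zero, or_iff_right]
    positivity
  have hc : ∀ (m : ℝ) (u : H2 T) (i : Freq), inner ℝ (D 0 (trig T i))
      (linearization a (sigma T (waveNumber i₀)) u + m • D 0 (r • trig T i₀)) =
      (sigma T (waveNumber i₀) - sigma T (waveNumber i)) * inner ℝ (D 0 (trig T i)) (D 0 u)
        + m * (r * inner ℝ (D 0 (trig T i)) (D 0 (trig T i₀))) := by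
    intro m u i
    rw [inner_add_right, inner_trig_linearization hT, real_inner_smul_right, D_smul,
      real_inner_smul_right]
  have hne : ∀ i, P i → i ≠ i₀ → sigma T (waveNumber i₀) - sigma T (waveNumber i) ≠ 0 :=
    fun i hi h => sub_ne_zero.2 fun e => h (hsimple i hi (sigma_injective hT e.symm))
  constructor
  · intro m u hu hperp h
    have hm : m = 0 := by
      have h1 := hc m u i₀
      rw [h, inner_zero_right, sub_self, zero_mul, zero_add] at h1
      exact (mul_eq_zero.1 h1.symm).resolve_right (mul_ne_zero hr hn)
    refine ⟨hm, H2.ext hT ?_⟩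
    change D 0 u = 0
    refine eq_zero_of_inner_trig hT fun i => ?_
    by_cases hi : P i
    · by_cases hii : i = i₀
      · rw [hii]
        exact (horth u).1 hperp
      · have h1 := hc m u i
        rw [h, inner_zero_right, hm, zero_mul, add_zero] at h1
        exact (mul_eq_zero.1 h1.symm).resolve_left (hne i hi hii)
    · exact (hV _).1 hu i hi
  · intro f hf
    obtain ⟨C, hC⟩ := exists_resolvent_bound hT (sigma T (waveNumber i₀))
    -- The multiplier `(σ - σ_i)⁻¹` is `0` at `i₀` by the convention `0⁻¹ = 0`, so `u` is
    -- automatically orthogonal to the kernel; `m` then accounts for the coefficient of `f` at `i₀`.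
    obtain ⟨u, hu⟩ := exists_multiplier hT f _ hC
    refine ⟨inner ℝ (D 0 (trig T i₀)) f / (r * inner ℝ (D 0 (trig T i₀)) (D 0 (trig T i₀))), u,
      ?_, ?_, ?_⟩
    · rw [mem_H2in, hV]
      intro i hi
      rw [hu, (hV _).1 hf i hi, mul_zero]
    · rw [horth, hu, sub_self, inv_zero, zero_mul]
    · refine eq_of_inner_trig hT fun i => ?_
      rw [hc, hu]
      by_cases hii : i = i₀
      · rw [hii, sub_self, zero_mul, zero_add, div_mul_cancel₀ _ (mul_ne_zero hr hn)]
      · rw [inner_trig_trig hT hii, mul_zero, mul_zero, add_zero]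
        by_cases hi : P i
        · rw [mul_inv_cancel_left₀ (hne i hi hii)]
        · rw [(hV _).1 hf i hi, mul_zero, mul_zero]

end Spectral

/-! ### The Crandall–Rabinowitz theorem -/

/-- The solutions in `Z` near `(σ,0)` form a smooth curve `s ↦ (Λ(s), s(φ + Γ(s)))`, `|s| < ε`,
with `Λ` and `Γ` even, along which the norm of the solution is strictly increasing in `|s|`. -/
structure IsLocalBranch {E : Type*} [NormedAddCommGroup E] [InnerProductSpace ℝ E]
    (Z : Set (ℝ × E)) (sig : ℝ) (φ : E) (ε r : ℝ) (Lam : ℝ → ℝ) (Gam : ℝ → E) : Prop where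
  eps_pos : 0 < ε
  r_pos : 0 < r
  smooth_Lam : ContDiffOn ℝ ∞ Lam (Ioo (-ε) ε)
  smooth_Gam : ContDiffOn ℝ ∞ Gam (Ioo (-ε) ε)
  Lam_zero : Lam 0 = sig
  Gam_zero : Gam 0 = 0
  orth : ∀ s ∈ Ioo (-ε) ε, inner ℝ φ (Gam s) = 0
  mem : ∀ s ∈ Ioo (-ε) ε, (Lam s, s • (φ + Gam s)) ∈ Z
  even_Lam : ∀ s ∈ Ioo (-ε) ε, Lam (-s) = Lam s
  even_Gam : ∀ s ∈ Ioo (-ε) ε, Gam (-s) = Gam s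
  Lam_le : ∀ s ∈ Ioo (-ε) ε, |Lam s - sig| ≤ ‖s • (φ + Gam s)‖
  strictMono : ∀ t s, 0 ≤ t → t < s → s < ε → ‖t • (φ + Gam t)‖ < ‖s • (φ + Gam s)‖
  unique : ∀ lam u, (lam, u) ∈ Z → |lam - sig| < r → ‖u‖ < r → u ≠ 0 →
    ∃ s ∈ Ioo (-ε) ε, lam = Lam s ∧ u = s • (φ + Gam s)

section CrandallRabinowitz

variable {E Y : Type*} [NormedAddCommGroup E] [InnerProductSpace ℝ E]
  [NormedAddCommGroup Y] [InnerProductSpace ℝ Y]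

/-- The equation for the direction of the solution in the Crandall–Rabinowitz theorem. -/
def crEq (L I : E →L[ℝ] Y) (N : E → Y) (φ : E) (X : Submodule ℝ E) (p : ℝ × (ℝ × X)) : Y :=
  L p.2.2 + p.2.1 • I (φ + p.2.2) + p.1 ^ 2 • N (φ + p.2.2)

/-- The linear part of `crEq`. -/
def crLin (L I : E →L[ℝ] Y) (φ : E) (X : Submodule ℝ E) : ℝ × X →L[ℝ] Y :=
  L.comp (X.subtypeL.comp (ContinuousLinearMap.snd ℝ ℝ X)) +
    (ContinuousLinearMap.fst ℝ ℝ X).smulRight (I φ)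

theorem contDiff_crEq (L I : E →L[ℝ] Y) {N : E → Y} (hN : ContDiff ℝ ω N) (φ : E)
    (X : Submodule ℝ E) : ContDiff ℝ ω (crEq L I N φ X) := by
  have h2 : ContDiff ℝ ω fun p : ℝ × (ℝ × X) => (p.2.2 : E) :=
    X.subtypeL.contDiff.comp (contDiff_snd.comp contDiff_snd)
  have h3 : ContDiff ℝ ω fun p : ℝ × (ℝ × X) => φ + (p.2.2 : E) := contDiff_const.add h2
  exact ((L.contDiff.comp h2).add ((contDiff_fst.comp contDiff_snd).smul (I.contDiff.comp h3))).add
    ((contDiff_fst.pow 2).smul (hN.comp h3))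

/-- At `s = 0` the nonlinearity disappears, and the product `m • I x` is of second order. -/
theorem hasFDerivAt_crEq (L I : E →L[ℝ] Y) (N : E → Y) (φ : E) (X : Submodule ℝ E) :
    HasFDerivAt (fun q : ℝ × X => crEq L I N φ X (0, q)) (crLin L I φ X) 0 := by
  have h2 : HasFDerivAt (fun q : ℝ × X => (q.2 : E))
      (X.subtypeL.comp (ContinuousLinearMap.snd ℝ ℝ X)) 0 :=
    (X.subtypeL.comp (ContinuousLinearMap.snd ℝ ℝ X)).hasFDerivAt
  have h1 : HasFDerivAt (fun q : ℝ × X => q.1) (ContinuousLinearMap.fst ℝ ℝ X) 0 :=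
    (ContinuousLinearMap.fst ℝ ℝ X).hasFDerivAt
  have h := (L.hasFDerivAt.comp (0 : ℝ × X) h2).add
    (h1.smul (I.hasFDerivAt.comp (0 : ℝ × X) (h2.const_add φ)))
  have e : (fun q : ℝ × X => crEq L I N φ X (0, q)) =
      fun q => L (q.2 : E) + q.1 • I (φ + q.2) := by
    ext q
    simp [crEq]
  rw [e]
  refine h.congr_fderiv ?_
  ext q <;> simp [crLin]

/-- The equation takes its values in `V`, so composing with the orthogonal projection onto `V` loses
nothing and turns the linear part into an isomorphism, as the implicit function theorem requires.
Its inverse supplies the constant `K` for the a priori estimates. -/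
theorem exists_implicit_crEq (L I : E →L[ℝ] Y) {N : E → Y} (hN : ContDiff ℝ ω N) (φ : E)
    (X : Submodule ℝ E) (V : Submodule ℝ Y) [CompleteSpace X] [CompleteSpace V]
    (hV : ∀ p, crEq L I N φ X p ∈ V) (hLφ : ∀ q, crLin L I φ X q ∈ V)
    (hinj : ∀ q, crLin L I φ X q = 0 → q = 0) (hsurj : ∀ y ∈ V, ∃ q, crLin L I φ X q = y) :
    (∃ K > 0, ∀ q : ℝ × X, ‖q‖ ≤ K * ‖crLin L I φ X q‖) ∧
    ∃ ψ : ℝ → ℝ × X, ContDiffAt ℝ ω ψ 0 ∧ ψ 0 = 0 ∧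
      ∀ᶠ p in 𝓝 (0 : ℝ × (ℝ × X)), crEq L I N φ X p = 0 ↔ ψ p.1 = p.2 := by
  set P : Y →L[ℝ] V := V.orthogonalProjectionOnto with hP
  have hPV : ∀ y ∈ V, (P y : Y) = y := fun y hy =>
    congrArg Subtype.val (V.orthogonalProjectionOnto_mem_subspace_eq_self ⟨y, hy⟩)
  have hPz : ∀ y ∈ V, P y = 0 ↔ y = 0 := fun y hy => by
    rw [← Submodule.coe_eq_zero, hPV y hy]
  set A : ℝ × X →L[ℝ] V := P.comp (crLin L I φ X) with hA
  obtain ⟨e, he⟩ := exists_equiv_of_bijective A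
    ((injective_iff_map_eq_zero _).2 fun q hq => hinj q ((hPz _ (hLφ q)).1 hq))
    (fun y => by
      obtain ⟨q, hq⟩ := hsurj y y.2
      refine ⟨q, Subtype.ext ?_⟩
      change (P (crLin L I φ X q) : Y) = y
      rw [hq, hPV _ y.2])
  have heA : (e : ℝ × X →L[ℝ] V) = A := ContinuousLinearMap.ext he
  refine ⟨⟨‖(e.symm : V →L[ℝ] ℝ × X)‖ + 1, by positivity, fun q => ?_⟩, ?_⟩
  · have h1 := (e.symm : V →L[ℝ] ℝ × X).le_opNorm (e q)
    have h2 : ‖e q‖ = ‖crLin L I φ X q‖ := by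
      rw [he]
      exact congrArg norm (hPV _ (hLφ q))
    rw [h2] at h1
    simp only [ContinuousLinearEquiv.coe_coe, ContinuousLinearEquiv.symm_apply_apply] at h1
    refine h1.trans ?_
    gcongr
    linarith
  · set G : ℝ × (ℝ × X) → V := fun p => P (crEq L I N φ X p) with hG
    have cdG : ContDiff ℝ ω G := P.contDiff.comp (contDiff_crEq L I hN φ X)
    have h0 : crEq L I N φ X 0 = 0 := by
      simp [crEq]
    have hG0 : G 0 = 0 := by simp only [hG, h0, map_zero]
    have hd : fderiv ℝ G 0 ∘L .inr ℝ ℝ (ℝ × X) = A := by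
      have h1 : HasFDerivAt G (fderiv ℝ G 0) ((ContinuousLinearMap.inr ℝ ℝ (ℝ × X)) 0) := by
        rw [map_zero]
        exact (cdG.differentiable (by simp) 0).hasFDerivAt
      have h2 := h1.comp (0 : ℝ × X) (ContinuousLinearMap.inr ℝ ℝ (ℝ × X)).hasFDerivAt
      have h3 : HasFDerivAt (fun q : ℝ × X => P (crEq L I N φ X (0, q))) A 0 :=
        P.hasFDerivAt.comp (0 : ℝ × X) (hasFDerivAt_crEq L I N φ X)
      exact h2.unique h3
    have if₂ : (fderiv ℝ G 0 ∘L .inr ℝ ℝ (ℝ × X)).IsInvertible := ⟨e, heA.trans hd.symm⟩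
    have cd0 : ContDiffAt ℝ ω G 0 := cdG.contDiffAt
    refine ⟨cd0.implicitFunction (by simp) if₂, cd0.contDiffAt_implicitFunction (by simp) if₂,
      cd0.implicitFunction_apply_self (by simp) if₂, ?_⟩
    filter_upwards [cd0.eventually_apply_eq_iff_implicitFunction (by simp) if₂] with p hp
    rw [← hp, hG0]
    exact (hPz _ (hV p)).symm

/-- Here `p = ‖φ‖`, while `x` and `y` are the norms of the transversal parts at `s` and `t`, and `k`
is a Lipschitz constant. For small parameters the growth of `s²p²` outweighs any decrease of the
transversal part. -/
theorem mul_add_sq_lt {x y p k ε t s : ℝ} (hp : 0 < p) (x0 : 0 ≤ x) (y0 : 0 ≤ y) (hx : x ≤ 1)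
    (hy : y ≤ 1) (hk : 0 ≤ k) (hε : ε * (2 * (k + 1)) ≤ p ^ 2) (h : y - x ≤ k * (s - t))
    (ht : 0 ≤ t) (hts : t < s) (hs : s < ε) : t ^ 2 * (p ^ 2 + y ^ 2) < s ^ 2 * (p ^ 2 + x ^ 2) := by
  have hst : 0 < s - t := by linarith
  have b1 : y ^ 2 - x ^ 2 ≤ 2 * (k * (s - t)) := by
    have h5 : 0 ≤ k * (s - t) := mul_nonneg hk hst.le
    have : y ^ 2 - x ^ 2 = (y - x) * (y + x) := by ring
    rw [this]
    calc (y - x) * (y + x) ≤ (k * (s - t)) * (y + x) := by gcongr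
      _ ≤ (k * (s - t)) * 2 := by gcongr; linarith
      _ = _ := by ring
  have b3 : t * (2 * k) ≤ p ^ 2 := by
    refine le_trans ?_ hε
    gcongr
    · linarith
    · linarith
    · linarith
  have b4 : t ^ 2 * (2 * (k * (s - t))) ≤ t * p ^ 2 * (s - t) := by
    calc t ^ 2 * (2 * (k * (s - t))) = t * (t * (2 * k)) * (s - t) := by ring
      _ ≤ t * p ^ 2 * (s - t) := by gcongr
  have b2 : t ^ 2 * (y ^ 2 - x ^ 2) ≤ t ^ 2 * (2 * (k * (s - t))) := by gcongr
  have b5 : 0 < s * p ^ 2 * (s - t) := by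
    have : 0 < s := by linarith
    positivity
  have b6 : 0 ≤ (s - t) * (s + t) * x ^ 2 := by
    have : 0 ≤ s + t := by linarith
    positivity
  have e : s ^ 2 * (p ^ 2 + x ^ 2) - t ^ 2 * (p ^ 2 + y ^ 2)
      = s * p ^ 2 * (s - t) + t * p ^ 2 * (s - t) + (s - t) * (s + t) * x ^ 2
        - t ^ 2 * (y ^ 2 - x ^ 2) := by ring
  linarith

variable [CompleteSpace E] [CompleteSpace Y]

set_option maxHeartbeats 1000000 in
/-- The Crandall–Rabinowitz theorem for `L u + (λ - σ) I u + N u = 0`, `N` cubic, on a closed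
subspace `U`, with values in a closed subspace `V`. -/
theorem exists_isLocalBranch (L I : E →L[ℝ] Y) {N : E → Y} (hN : ContDiff ℝ ω N)
    (hN3 : ∀ (s : ℝ) u, N (s • u) = s ^ 3 • N u) {C : ℝ} (hC : 0 ≤ C)
    (hNC : ∀ u, ‖N u‖ ≤ C * ‖u‖ ^ 3) {U : Submodule ℝ E} {V : Submodule ℝ Y}
    (hU : IsClosed (U : Set E)) (hV : IsClosed (V : Set Y)) (hLV : ∀ u ∈ U, L u ∈ V)
    (hIV : ∀ u ∈ U, I u ∈ V) (hNV : ∀ u ∈ U, N u ∈ V) {φ : E} (hφU : φ ∈ U) (hφ : φ ≠ 0)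
    (hLφ : L φ = 0)
    (hinj : ∀ (m : ℝ), ∀ u ∈ U, inner ℝ φ u = 0 → L u + m • I φ = 0 → m = 0 ∧ u = 0)
    (hsurj : ∀ y ∈ V, ∃ (m : ℝ) (u : E), u ∈ U ∧ inner ℝ φ u = 0 ∧ L u + m • I φ = y)
    (sig : ℝ) :
    ∃ ε r Lam Gam, IsLocalBranch {p : ℝ × E | p.2 ∈ U ∧ L p.2 + (p.1 - sig) • I p.2 + N p.2 = 0}
      sig φ ε r Lam Gam := by
  -- The complement of `φ` in `U`, where the transversal part of the solution lives.
  set X : Submodule ℝ E := U ⊓ (Submodule.span ℝ {φ})ᗮ with hX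
  have hXU : ∀ x : X, (x : E) ∈ U := fun x => x.2.1
  have hXφ : ∀ x : X, inner ℝ φ (x : E) = 0 := fun x =>
    Submodule.mem_orthogonal_singleton_iff_inner_right.1 x.2.2
  have hXm : ∀ u ∈ U, inner ℝ φ u = 0 → u ∈ X := fun u hu h =>
    ⟨hu, Submodule.mem_orthogonal_singleton_iff_inner_right.2 h⟩
  have hXc : IsClosed (X : Set E) := hU.inter (Submodule.isClosed_orthogonal _)
  have : CompleteSpace X := hXc.completeSpace_coe
  have : CompleteSpace V := hV.completeSpace_coe
  have hφ0 : 0 < ‖φ‖ := norm_pos_iff.2 hφ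
  have hmemV : ∀ p, crEq L I N φ X p ∈ V := fun p =>
    V.add_mem (V.add_mem (hLV _ (hXU _)) (V.smul_mem _ (hIV _ (U.add_mem hφU (hXU _)))))
      (V.smul_mem _ (hNV _ (U.add_mem hφU (hXU _))))
  obtain ⟨⟨K, hK, hbound⟩, ψ, cψ, ψ0, hψ⟩ := exists_implicit_crEq L I hN φ X V hmemV
    (fun q => V.add_mem (hLV _ (hXU _)) (V.smul_mem _ (hIV _ hφU)))
    (fun q hq => by
      obtain ⟨h1, h2⟩ := hinj q.1 q.2 (hXU _) (hXφ _) hq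
      exact Prod.ext h1 (Subtype.ext h2))
    (fun y hy => by
      obtain ⟨m, u, h1, h2, h3⟩ := hsurj y hy
      exact ⟨(m, ⟨u, hXm u h1 h2⟩), h3⟩)
  -- Since `L φ = 0` and `N` is homogeneous of degree three, a factor `s` splits off and only `s²`
  -- remains in front of `N`.
  have hred : ∀ (s m : ℝ) (x : X), L (s • (φ + (x : E))) + m • I (s • (φ + (x : E)))
      + N (s • (φ + (x : E))) = s • crEq L I N φ X (s, (m, x)) := by
    intro s m x
    rw [hN3, map_smul, map_smul, map_add, hLφ, crEq, zero_add]
    module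
  have hbd : ∀ (m : ℝ) (x : X), |m| ≤ K * ‖L x + m • I φ‖ ∧ ‖(x : E)‖ ≤ K * ‖L x + m • I φ‖ :=
    fun m x => ⟨(norm_fst_le (m, x)).trans (hbound (m, x)),
      (norm_snd_le (m, x)).trans (hbound (m, x))⟩
  have hpyth : ∀ (s : ℝ) (x : X), ‖s • (φ + (x : E))‖ ^ 2 = s ^ 2 * (‖φ‖ ^ 2 + ‖(x : E)‖ ^ 2) := by
    intro s x
    have := norm_add_sq_real φ (x : E)
    rw [hXφ, mul_zero, add_zero] at this
    rw [norm_smul, mul_pow, Real.norm_eq_abs, sq_abs, this]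
  have hlow : ∀ (s : ℝ) (x : X), |s| * ‖φ‖ ≤ ‖s • (φ + (x : E))‖ := by
    intro s x
    refine abs_le_of_sq_le_sq' ?_ (norm_nonneg _) |>.2
    rw [hpyth, mul_pow, sq_abs]
    nlinarith [sq_nonneg s, sq_nonneg ‖(x : E)‖]
  obtain ⟨δ, hδ0, hδ⟩ : ∃ δ > 0, ∀ (s m : ℝ) (x : X), |s| < δ → |m| < δ → ‖(x : E)‖ < δ →
      (crEq L I N φ X (s, (m, x)) = 0 ↔ ψ s = (m, x)) := by
    obtain ⟨δ, hδ0, hδ⟩ := Metric.eventually_nhds_iff.1 hψ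
    refine ⟨δ, hδ0, fun s m x h1 h2 h3 => hδ (y := (s, (m, x))) ?_⟩
    rw [dist_zero_right]
    exact max_lt h1 (max_lt h2 h3)
  -- In this order: local uniqueness, `‖φ + x‖ ≤ 2‖φ‖`, `‖x‖ ≤ 1` for the monotonicity, and
  -- absorption of `m • I x`.
  set δ₁ : ℝ := min δ (min ‖φ‖ (min 1 (1 / (2 * K * (‖I‖ + 1))))) with hδ₁
  have hδ₁0 : 0 < δ₁ := by positivity
  obtain ⟨K', t, ht, hlip⟩ := (cψ.of_le (by simp : (1 : WithTop ℕ∞) ≤ ω)).exists_lipschitzOnWith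
  obtain ⟨ε₀, hε₀, hev⟩ : ∃ ε₀ > 0, ∀ s, |s| < ε₀ → ‖ψ s‖ < δ₁ ∧ ContDiffAt ℝ ω ψ s ∧ s ∈ t := by
    have h1 : ∀ᶠ s in 𝓝 (0 : ℝ), ‖ψ s‖ < δ₁ := by
      have := cψ.continuousAt.norm
      rw [ContinuousAt, ψ0, norm_zero] at this
      exact this.eventually_lt_const hδ₁0
    obtain ⟨ε₀, h0, h⟩ := Metric.eventually_nhds_iff.1
      (h1.and ((cψ.eventually (by simp)).and (Filter.eventually_of_mem ht fun _ h => h)))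
    exact ⟨ε₀, h0, fun s hs => h (by rwa [dist_zero_right])⟩
  -- `K·C·(2‖φ‖)³`, doubled because half of `|m|` is absorbed on the left.
  set C₂ : ℝ := 16 * K * C * ‖φ‖ ^ 3 with hC₂
  have hC₂0 : 0 ≤ C₂ := by positivity
  -- The third bound makes `C₂ s² ≤ |s|‖φ‖`, which yields `|Λ(s) - σ| ≤ ‖u(s)‖`; the last is the
  -- smallness required for monotonicity.
  set ε : ℝ := min ε₀ (min δ (min (‖φ‖ / (C₂ + 1)) (‖φ‖ ^ 2 / (2 * (K' + 1))))) with hε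
  have hε0 : 0 < ε := by positivity
  have hεε : ε ≤ ε₀ := min_le_left _ _
  have hεδ : ε ≤ δ := (min_le_right _ _).trans (min_le_left _ _)
  have hεC : ε * (C₂ + 1) ≤ ‖φ‖ := by
    rw [← le_div_iff₀ (by positivity)]
    exact (min_le_right _ _).trans ((min_le_right _ _).trans (min_le_left _ _))
  have hεK : ε * (2 * (K' + 1)) ≤ ‖φ‖ ^ 2 := by
    rw [← le_div_iff₀ (by positivity)]
    exact (min_le_right _ _).trans ((min_le_right _ _).trans (min_le_right _ _))
  have hsol : ∀ s, |s| < ε → crEq L I N φ X (s, ψ s) = 0 ∧ ‖(ψ s).1‖ < δ₁ ∧ ‖((ψ s).2 : E)‖ < δ₁ := by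
    intro s hs
    have h1 := (hev s (hs.trans_le hεε)).1
    have h2 := (norm_fst_le (ψ s)).trans_lt h1
    have h3 := (norm_snd_le (ψ s)).trans_lt h1
    exact ⟨(hδ s (ψ s).1 (ψ s).2 (hs.trans_le hεδ) (h2.trans_le (min_le_left _ _))
      (h3.trans_le (min_le_left _ _))).2 rfl, h2, h3⟩
  have hsmall : ∀ s, |s| < ε → |(ψ s).1| ≤ C₂ * s ^ 2 := by
    intro s hs
    obtain ⟨h1, h2, h3⟩ := hsol s hs
    set m := (ψ s).1
    set x := (ψ s).2
    have e : L (x : E) + m • I φ = -(m • I (x : E) + s ^ 2 • N (φ + x)) := by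
      have : L (x : E) + m • I (φ + x) + s ^ 2 • N (φ + x) = 0 := h1
      rw [map_add, smul_add] at this
      rw [eq_neg_iff_add_eq_zero, ← this]
      abel
    have hm := (hbd m x).1
    rw [e, norm_neg] at hm
    have hx1 : ‖(x : E)‖ ≤ ‖φ‖ := (h3.trans_le ((min_le_right _ _).trans (min_le_left _ _))).le
    have hx2 : ‖(x : E)‖ * (2 * K * (‖I‖ + 1)) ≤ 1 := by
      rw [← le_div_iff₀ (by positivity)]
      exact (h3.trans_le ((min_le_right _ _).trans ((min_le_right _ _).trans (min_le_right _ _)))).le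
    have n1 : ‖m • I (x : E)‖ ≤ |m| * (‖I‖ * ‖(x : E)‖) := by
      rw [norm_smul, Real.norm_eq_abs]
      gcongr
      exact I.le_opNorm _
    have n2 : ‖s ^ 2 • N (φ + x)‖ ≤ s ^ 2 * (C * (8 * ‖φ‖ ^ 3)) := by
      rw [norm_smul, Real.norm_eq_abs, abs_of_nonneg (sq_nonneg s)]
      gcongr
      refine (hNC _).trans ?_
      gcongr
      calc ‖φ + (x : E)‖ ^ 3 ≤ (‖φ‖ + ‖φ‖) ^ 3 := by
            gcongr
            exact (norm_add_le _ _).trans (by gcongr)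
        _ = 8 * ‖φ‖ ^ 3 := by ring
    have n3 : |m| ≤ K * (|m| * (‖I‖ * ‖(x : E)‖) + s ^ 2 * (C * (8 * ‖φ‖ ^ 3))) := by
      refine hm.trans ?_
      gcongr
      exact (norm_add_le _ _).trans (add_le_add n1 n2)
    have n4 : K * (‖I‖ * ‖(x : E)‖) ≤ 1 / 2 := by
      have : 0 ≤ ‖(x : E)‖ * K := by positivity
      nlinarith
    have n5 : |m| * (K * (‖I‖ * ‖(x : E)‖)) ≤ |m| * (1 / 2) := by gcongr
    rw [hC₂]
    linarith
  have hdist : ∀ s, |s| < ε → |(ψ s).1| ≤ ‖s • (φ + ((ψ s).2 : E))‖ := by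
    intro s hs
    refine (hsmall s hs).trans (le_trans ?_ (hlow s _))
    rw [← sq_abs, sq, ← mul_assoc, mul_comm]
    gcongr
    nlinarith [abs_nonneg s]
  -- The equation depends on `s` through `s²` only, so `(-s, ψ s)` is also a solution and local
  -- uniqueness applies.
  have hevenψ : ∀ s, |s| < ε → ψ (-s) = ψ s := by
    intro s hs
    obtain ⟨h1, h2, h3⟩ := hsol s hs
    refine (hδ (-s) (ψ s).1 (ψ s).2 (by rw [abs_neg]; exact hs.trans_le hεδ)
      (h2.trans_le (min_le_left _ _)) (h3.trans_le (min_le_left _ _))).1 ?_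
    rw [← h1]
    simp [crEq]
  have hmono : ∀ t' s, 0 ≤ t' → t' < s → s < ε →
      ‖t' • (φ + ((ψ t').2 : E))‖ < ‖s • (φ + ((ψ s).2 : E))‖ := by
    intro t' s ht0 hts hs
    have hs0 : 0 < s := ht0.trans_lt hts
    have as : |s| < ε := by rwa [abs_of_pos hs0]
    have at' : |t'| < ε := by rw [abs_of_nonneg ht0]; exact hts.trans hs
    refine lt_of_pow_lt_pow_left₀ 2 (norm_nonneg _) ?_
    rw [hpyth, hpyth]
    have hle1 : δ₁ ≤ 1 := (min_le_right _ _).trans ((min_le_right _ _).trans (min_le_left _ _))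
    have a1 : ‖((ψ s).2 : E)‖ ≤ 1 := (hsol s as).2.2.le.trans hle1
    have a2 : ‖((ψ t').2 : E)‖ ≤ 1 := (hsol t' at').2.2.le.trans hle1
    have a3 : ‖((ψ t').2 : E)‖ - ‖((ψ s).2 : E)‖ ≤ K' * (s - t') := by
      have h1 := hlip.dist_le_mul t' (hev t' (at'.trans_le hεε)).2.2 s (hev s (as.trans_le hεε)).2.2
      have h2 : ‖(ψ t').2 - (ψ s).2‖ ≤ dist (ψ t') (ψ s) := by
        rw [dist_eq_norm]
        exact norm_snd_le (ψ t' - ψ s)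
      have h3 : dist t' s = s - t' := by
        rw [Real.dist_eq, abs_of_neg (by linarith)]
        ring
      rw [h3] at h1
      exact (norm_sub_norm_le _ _).trans (h2.trans h1)
    exact mul_add_sq_lt hφ0 (norm_nonneg _) (norm_nonneg _) a1 a2 K'.2 hεK a3 ht0 hts hs
  -- The bounds serve, in order: `‖w‖ ≤ ‖u‖/2`, absorption of `m • I w`, smallness of the cubic
  -- term, `|s| < ε`, `|m| < δ`, and `‖w‖/|s| < δ`.
  set r : ℝ := min (min 1 (1 / (2 * K * (‖I‖ + 1)))) (min (1 / (4 * K * (C + 1)))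
    (min (ε * ‖φ‖) (min δ (δ / (2 * ‖φ‖))))) with hr
  have hr0 : 0 < r := by positivity
  have hr1 : r ≤ 1 := (min_le_left _ _).trans (min_le_left _ _)
  have hr2 : r * (2 * K * (‖I‖ + 1)) ≤ 1 := by
    rw [← le_div_iff₀ (by positivity)]
    exact (min_le_left _ _).trans (min_le_right _ _)
  have hr3 : r * (4 * K * (C + 1)) ≤ 1 := by
    rw [← le_div_iff₀ (by positivity)]
    exact (min_le_right _ _).trans (min_le_left _ _)
  have hr4 : r ≤ ε * ‖φ‖ :=
    (min_le_right _ _).trans ((min_le_right _ _).trans (min_le_left _ _))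
  have hr5 : r ≤ δ := (min_le_right _ _).trans ((min_le_right _ _).trans
    ((min_le_right _ _).trans (min_le_left _ _)))
  have hr6 : r * (2 * ‖φ‖) ≤ δ := by
    rw [← le_div_iff₀ (by positivity)]
    exact (min_le_right _ _).trans ((min_le_right _ _).trans
      ((min_le_right _ _).trans (min_le_right _ _)))
  have habs : ∀ s, s ∈ Ioo (-ε) ε ↔ |s| < ε := fun s => by rw [mem_Ioo, abs_lt]
  refine ⟨ε, r, fun s => sig + (ψ s).1, fun s => ((ψ s).2 : E), hε0, hr0, ?_, ?_, ?_, ?_, ?_, ?_,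
    ?_, ?_, ?_, hmono, ?_⟩
  · intro s hs
    have h := (hev s (((habs s).1 hs).trans_le hεε)).2.1
    exact ((contDiffAt_const.add (contDiffAt_fst.comp s h)).of_le (by simp)).contDiffWithinAt
  · intro s hs
    have h := (hev s (((habs s).1 hs).trans_le hεε)).2.1
    exact ((X.subtypeL.contDiff.contDiffAt.comp s
      (contDiffAt_snd.comp s h)).of_le (by simp)).contDiffWithinAt
  · simp [ψ0]
  · simp [ψ0]
  · exact fun s _ => hXφ _
  · intro s hs
    refine ⟨U.smul_mem _ (U.add_mem hφU (hXU _)), ?_⟩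
    have := hred s (ψ s).1 (ψ s).2
    rw [(hsol s ((habs s).1 hs)).1, smul_zero] at this
    simpa using this
  · intro s hs
    simp only [hevenψ s ((habs s).1 hs)]
  · intro s hs
    simp only [hevenψ s ((habs s).1 hs)]
  · intro s hs
    simpa using hdist s ((habs s).1 hs)
  · rintro lam u ⟨huU, hu⟩ hlam hur hu0
    change L u + (lam - sig) • I u + N u = 0 at hu
    change u ∈ U at huU
    set m := lam - sig with hm
    -- The coefficient of the orthogonal projection of `u` onto `φ`; `w` is the remainder.
    set s : ℝ := inner ℝ φ u / ‖φ‖ ^ 2 with hs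
    set w : E := u - s • φ with hw
    have hwφ : inner ℝ φ w = 0 := by
      rw [hw, inner_sub_right, real_inner_smul_right, real_inner_self_eq_norm_sq, hs,
        div_mul_cancel₀ _ (by positivity), sub_self]
    have hwX : w ∈ X := hXm w (U.sub_mem huU (U.smul_mem _ hφU)) hwφ
    have huw : u = s • φ + w := by rw [hw]; abel
    have hsu : |s| * ‖φ‖ ≤ ‖u‖ := by
      refine abs_le_of_sq_le_sq' ?_ (norm_nonneg _) |>.2
      have := norm_add_sq_real (s • φ) w
      rw [real_inner_smul_left, hwφ, mul_zero, mul_zero, add_zero, ← huw, norm_smul,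
        Real.norm_eq_abs] at this
      nlinarith [sq_nonneg ‖w‖]
    have e : L w + (m * s) • I φ = -(m • I w + N u) := by
      have h1 : L u = L w := by rw [huw, map_add, map_smul, hLφ, smul_zero, zero_add]
      have h2 : m • I u = (m * s) • I φ + m • I w := by
        rw [huw, map_add, map_smul, smul_add, smul_smul]
      rw [h1, h2] at hu
      rw [eq_neg_iff_add_eq_zero, ← hu]
      abel
    have hww := (hbd (m * s) ⟨w, hwX⟩).2
    change ‖w‖ ≤ K * ‖L w + (m * s) • I φ‖ at hww
    rw [e, norm_neg] at hww
    have n1 : ‖m • I w + N u‖ ≤ |m| * (‖I‖ * ‖w‖) + C * ‖u‖ ^ 3 := by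
      refine (norm_add_le _ _).trans (add_le_add ?_ (hNC u))
      rw [norm_smul, Real.norm_eq_abs]
      gcongr
      exact I.le_opNorm _
    have n2 : ‖w‖ ≤ K * (|m| * (‖I‖ * ‖w‖) + C * ‖u‖ ^ 3) := hww.trans (by gcongr)
    have n3 : K * (|m| * (‖I‖ * ‖w‖)) ≤ ‖w‖ / 2 := by
      have h1 : |m| * (2 * K * (‖I‖ + 1)) ≤ 1 := le_trans (by gcongr) hr2
      have h2 : 0 ≤ ‖w‖ := norm_nonneg _
      have h3 : K * (|m| * ‖I‖) ≤ 1 / 2 := by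
        have : 0 ≤ |m| * K := by positivity
        nlinarith
      nlinarith
    -- The transversal part is of third order in `u`, so `s ≠ 0` and `s⁻¹ • w` is small enough for
    -- the uniqueness in the implicit function theorem.
    have n4 : ‖w‖ ≤ 2 * K * C * ‖u‖ ^ 3 := by linarith
    have n5 : ‖w‖ ≤ r / 2 * ‖u‖ := by
      refine n4.trans ?_
      have h1 : ‖u‖ ^ 3 ≤ r ^ 2 * ‖u‖ := by
        rw [pow_succ]
        gcongr
      have h2 : 2 * K * C * r ≤ 1 / 2 := by
        have : 0 ≤ r * K := by positivity
        nlinarith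
      calc 2 * K * C * ‖u‖ ^ 3 ≤ 2 * K * C * (r ^ 2 * ‖u‖) := by gcongr
        _ = 2 * K * C * r * (r * ‖u‖) := by ring
        _ ≤ 1 / 2 * (r * ‖u‖) := by gcongr
        _ = _ := by ring
    have n6 : ‖u‖ ≤ 2 * (|s| * ‖φ‖) := by
      have h1 : ‖u‖ ≤ |s| * ‖φ‖ + ‖w‖ := by
        conv_lhs => rw [huw]
        refine (norm_add_le _ _).trans ?_
        rw [norm_smul, Real.norm_eq_abs]
      nlinarith [norm_nonneg u]
    have hu0' : 0 < ‖u‖ := norm_pos_iff.2 hu0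
    have hs0 : 0 < |s| := by
      by_contra h
      have : |s| * ‖φ‖ ≤ 0 := mul_nonpos_of_nonpos_of_nonneg (not_lt.1 h) hφ0.le
      linarith
    have hsne : s ≠ 0 := abs_pos.1 hs0
    have hsε : |s| < ε := by
      refine lt_of_mul_lt_mul_right ?_ hφ0.le
      linarith
    set x : X := ⟨s⁻¹ • w, X.smul_mem _ hwX⟩ with hx
    have hxδ : ‖(x : E)‖ < δ := by
      change ‖s⁻¹ • w‖ < δ
      rw [norm_smul, norm_inv, Real.norm_eq_abs, inv_mul_lt_iff₀ hs0]
      have : r / 2 * ‖u‖ ≤ r / 2 * (2 * (|s| * ‖φ‖)) := by gcongr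
      have h7 : |s| * (r * (2 * ‖φ‖)) ≤ |s| * δ := by gcongr
      have h8 : 0 < |s| * δ := by positivity
      linarith
    have hus : u = s • (φ + (x : E)) := by
      change u = s • (φ + s⁻¹ • w)
      rw [smul_add, smul_inv_smul₀ hsne, ← huw]
    have hG : crEq L I N φ X (s, (m, x)) = 0 := by
      have := hred s m x
      rw [← hus, hu] at this
      exact (smul_eq_zero.1 this.symm).resolve_left hsne
    have hψs := (hδ s m x (hsε.trans_le hεδ) (hlam.trans_le hr5) hxδ).1 hG
    refine ⟨s, (habs s).2 hsε, ?_, ?_⟩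
    · simp only [hψs]
      rw [hm]
      ring
    · simp only [hψs]
      exact hus

end CrandallRabinowitz

/-! ### From local branches to branch pairs -/

section Abstract

variable {E : Type*} [NormedAddCommGroup E] [InnerProductSpace ℝ E] {Z : Set (ℝ × E)} {sig : ℝ}
  {φ : E} {ε r : ℝ} {Lam : ℝ → ℝ} {Gam : ℝ → E}

/-- Pairing with `φ` recovers the parameter; injectivity of the curve and non-triviality for `s ≠ 0`
rest on this. -/
theorem IsLocalBranch.inner_eq (h : IsLocalBranch Z sig φ ε r Lam Gam) {s : ℝ}
    (hs : s ∈ Ioo (-ε) ε) : inner ℝ φ (s • (φ + Gam s)) = s * ‖φ‖ ^ 2 := by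
  rw [real_inner_smul_right, inner_add_right, h.orth s hs, add_zero, real_inner_self_eq_norm_sq]

theorem IsLocalBranch.injOn (h : IsLocalBranch Z sig φ ε r Lam Gam) (hφ : φ ≠ 0) {s t : ℝ}
    (hs : s ∈ Ioo (-ε) ε) (ht : t ∈ Ioo (-ε) ε) (e : s • (φ + Gam s) = t • (φ + Gam t)) :
    s = t := by
  have h1 := h.inner_eq hs
  rw [e, h.inner_eq ht] at h1
  exact (mul_right_cancel₀ (by simpa using hφ) h1).symm

theorem IsLocalBranch.ne_zero (h : IsLocalBranch Z sig φ ε r Lam Gam) (hφ : φ ≠ 0) {s : ℝ}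
    (hs : s ∈ Ioo (-ε) ε) (hs0 : s ≠ 0) : s • (φ + Gam s) ≠ 0 := by
  intro h0
  have h1 := h.inner_eq hs
  rw [h0, inner_zero_right] at h1
  have : ‖φ‖ ≠ 0 := norm_ne_zero_iff.2 hφ
  exact mul_ne_zero hs0 (pow_ne_zero 2 this) h1.symm

theorem IsLocalBranch.neg_eq (h : IsLocalBranch Z sig φ ε r Lam Gam) {s : ℝ}
    (hs : s ∈ Ioo (-ε) ε) : (-s) • (φ + Gam (-s)) = -(s • (φ + Gam s)) := by
  rw [h.even_Gam s hs, neg_smul]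

theorem IsLocalBranch.zero_mem_Ioo (h : IsLocalBranch Z sig φ ε r Lam Gam) :
    (0 : ℝ) ∈ Ioo (-ε) ε := ⟨neg_lt_zero.2 h.eps_pos, h.eps_pos⟩

theorem IsLocalBranch.continuousOn (h : IsLocalBranch Z sig φ ε r Lam Gam) :
    ContinuousOn (fun s => (Lam s, s • (φ + Gam s))) (Ioo (-ε) ε) :=
  h.smooth_Lam.continuousOn.prodMk
    (continuousOn_id.smul (continuousOn_const.add h.smooth_Gam.continuousOn))

theorem IsLocalBranch.eventually_norm_lt (h : IsLocalBranch Z sig φ ε r Lam Gam) {δ : ℝ}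
    (hδ : 0 < δ) : ∃ η > 0, ∀ s, |s| < η → s ∈ Ioo (-ε) ε ∧ ‖Gam s‖ < δ ∧ |Lam s - sig| < δ ∧
      ‖s • (φ + Gam s)‖ < δ := by
  have hn : Ioo (-ε) ε ∈ 𝓝 (0 : ℝ) := isOpen_Ioo.mem_nhds h.zero_mem_Ioo
  have c1 : ContinuousAt (fun s => ‖Gam s‖) 0 := (h.smooth_Gam.continuousOn.continuousAt hn).norm
  have c2 : ContinuousAt (fun s => |Lam s - sig|) 0 :=
    ((h.smooth_Lam.continuousOn.continuousAt hn).sub continuousAt_const).abs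
  have c3 : ContinuousAt (fun s => ‖s • (φ + Gam s)‖) 0 :=
    (continuousAt_id.smul (continuousAt_const.add
      (h.smooth_Gam.continuousOn.continuousAt hn))).norm
  have e1 : ∀ᶠ s in 𝓝 (0 : ℝ), ‖Gam s‖ < δ := by
    refine Filter.Tendsto.eventually_lt_const ?_ c1
    simpa [h.Gam_zero] using hδ
  have e2 : ∀ᶠ s in 𝓝 (0 : ℝ), |Lam s - sig| < δ := by
    refine Filter.Tendsto.eventually_lt_const ?_ c2
    simpa [h.Lam_zero] using hδ
  have e3 : ∀ᶠ s in 𝓝 (0 : ℝ), ‖s • (φ + Gam s)‖ < δ := by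
    refine Filter.Tendsto.eventually_lt_const ?_ c3
    simpa using hδ
  obtain ⟨η, hη, h'⟩ := Metric.eventually_nhds_iff.1
    ((Filter.eventually_of_mem hn fun _ h => h).and (e1.and (e2.and e3)))
  exact ⟨η, hη, fun s hs => h' (by rwa [dist_zero_right])⟩

/-- Because `|Λ(s) - σ| ≤ ‖u(s)‖`, lying in the ball only concerns `‖u(s)‖`, which is even and
strictly increasing in `|s|`; the intermediate value theorem supplies the parameter at which it
equals `ρ`. -/
theorem IsLocalBranch.exists_radius (h : IsLocalBranch Z sig φ ε r Lam Gam) {η : ℝ}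
    (hη : 0 < η) : ∃ ρ₁ > 0, ∀ ρ, 0 < ρ → ρ < ρ₁ → ∃ ε' > 0, ε' < ε ∧ ε' < η ∧
      ∀ s ∈ Ioo (-ε) ε, (Lam s, s • (φ + Gam s)) ∈ Metric.ball (sig, (0 : E)) ρ ↔ |s| < ε' := by
  have hε := h.eps_pos
  set g : ℝ → ℝ := fun s => ‖s • (φ + Gam s)‖ with hg
  set m : ℝ := min ε η / 2 with hm
  have hm0 : 0 < m := by positivity
  have hmε : m < ε := by linarith [min_le_left ε η]
  have hmη : m < η := by linarith [min_le_right ε η]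
  have g0 : g 0 = 0 := by simp [hg]
  refine ⟨g m, by rw [← g0]; exact h.strictMono 0 m le_rfl hm0 hmε, fun ρ hρ hρm => ?_⟩
  have hcont : ContinuousOn g (Icc 0 m) := by
    refine ContinuousOn.norm (continuousOn_snd.comp h.continuousOn (t := univ)
      (mapsTo_univ _ _) |>.mono ?_)
    exact fun s hs => ⟨by linarith [hs.1], hs.2.trans_lt hmε⟩
  obtain ⟨ε', ⟨h1, h2⟩, h3⟩ := intermediate_value_Icc hm0.le hcont
    (show ρ ∈ Icc (g 0) (g m) from ⟨by rw [g0]; exact hρ.le, hρm.le⟩)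
  have hε'0 : 0 < ε' := by
    rcases h1.eq_or_lt with e | e
    · rw [← e, g0] at h3
      linarith
    · exact e
  refine ⟨ε', hε'0, h2.trans_lt hmε, h2.trans_lt hmη, fun s hs => ?_⟩
  have e1 : (Lam s, s • (φ + Gam s)) ∈ Metric.ball (sig, (0 : E)) ρ ↔ g s < ρ := by
    rw [Metric.mem_ball, Prod.dist_eq, dist_zero_right, Real.dist_eq, max_lt_iff]
    exact and_iff_right_of_imp fun h' => (h.Lam_le s hs).trans_lt h'
  have e2 : g s = g |s| := by
    rcases abs_choice s with e | e
    · rw [e]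
    · rw [e]
      simp only [hg]
      rw [h.neg_eq hs, norm_neg]
  have hsε : |s| < ε := abs_lt.2 hs
  rw [e1, e2, ← h3]
  constructor
  · intro h'
    by_contra hc
    rcases (not_lt.1 hc).eq_or_lt with e | e
    · rw [e] at h'
      exact lt_irrefl _ h'
    · exact lt_asymm h' (h.strictMono _ _ hε'0.le e hsε)
  · exact fun h' => h.strictMono _ _ (abs_nonneg s) h' (h2.trans_lt hmε)

/-- Two local branches in the same direction, with nested sets of solutions, agree. -/
theorem IsLocalBranch.eventually_eq (h : IsLocalBranch Z sig φ ε r Lam Gam) (hφ : φ ≠ 0)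
    {Z' : Set (ℝ × E)} {ε' r' : ℝ} {Lam' : ℝ → ℝ} {Gam' : ℝ → E}
    (h' : IsLocalBranch Z' sig φ ε' r' Lam' Gam') (hZ : Z' ⊆ Z) :
    ∃ η > 0, ∀ s, |s| < η → s ∈ Ioo (-ε') ε' ∧ s • (φ + Gam s) = s • (φ + Gam' s) := by
  obtain ⟨η, hη, hs⟩ := h'.eventually_norm_lt (δ := r) h.r_pos
  obtain ⟨η₂, hη₂, hs₂⟩ := h.eventually_norm_lt (δ := r) h.r_pos
  refine ⟨min η η₂, by positivity, fun s hsη => ?_⟩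
  obtain ⟨h1, -, h2, h3⟩ := hs s (hsη.trans_le (min_le_left _ _))
  have k1 := (hs₂ s (hsη.trans_le (min_le_right _ _))).1
  refine ⟨h1, ?_⟩
  by_cases hs0 : s = 0
  · simp [hs0]
  -- Uniqueness in the larger solution set places the point on the other curve, and pairing with `φ`
  -- identifies the two parameters.
  obtain ⟨t, ht, -, e⟩ := h.unique _ _ (hZ (h'.mem s h1)) h2 h3 (h'.ne_zero hφ h1 hs0)
  have hst : s = t := by
    have i1 := h'.inner_eq h1
    rw [e, h.inner_eq ht] at i1
    exact (mul_right_cancel₀ (by simpa using hφ) i1).symm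
  rw [e, ← hst]

end Abstract

variable {T : ℝ} {V : Submodule ℝ (L2 T)} {P : Freq → Prop}

/-- Apply the abstract theorem with `L` the linearization at `σ` and `I` the inclusion of `H²` into
`L²`; then `λ - σ` is the bifurcation parameter. -/
theorem exists_localBranch (hT : 0 < T) (hV : IsSpectral V P) (a : Linf T)
    (hcub : ∀ u ∈ H2in V, cubic a u ∈ V) {i₀ : Freq} (hi₀ : P i₀) {c : ℝ} (hc : c ≠ 0)
    (hsimple : ∀ i, P i → waveNumber i = waveNumber i₀ → i = i₀) :
    ∃ ε r Lam Gam, IsLocalBranch {p : ℝ × H2 T | p.2 ∈ H2in V ∧ F a p = 0}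
      (sigma T (waveNumber i₀)) (c • trig T i₀) ε r Lam Gam := by
  have := completeSpace_H2 hT
  obtain ⟨C, hC, hNC⟩ := exists_norm_cubic_le hT a
  obtain ⟨hinj, hsurj⟩ := hV.lin_bijective hT a hc hsimple
  set sig := sigma T (waveNumber i₀) with hsig
  have hmem : c • trig T i₀ ∈ H2in V := by
    refine Submodule.smul_mem _ _ ?_
    rw [mem_H2in, hV]
    exact fun j hj => inner_trig_trig hT fun h => hj (h ▸ hi₀)
  have hne : c • trig T i₀ ≠ 0 := smul_ne_zero hc fun h => D0_trig_ne_zero hT i₀ (by rw [h]; rfl)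
  have h := exists_isLocalBranch (linearization a sig) (derivL 0) (contDiff_cubic hT a)
    (cubic_smul hT a) hC hNC (hV.isClosed.preimage (derivL 0).continuous) hV.isClosed
    (fun u hu => hV.linearization_mem hT a sig hu) (fun u hu => hu) hcub hmem hne
    (by rw [map_smul, linearization_apply hT, D2_trig, neg_smul, neg_add_cancel, smul_zero])
    (fun m u hu h1 h2 => hinj m u hu h1 h2) hsurj sig
  have e : {p : ℝ × H2 T | p.2 ∈ H2in V ∧ F a p = 0} = {p : ℝ × H2 T | p.2 ∈ H2in V ∧
      linearization a sig p.2 + (p.1 - sig) • derivL 0 p.2 + cubic a p.2 = 0} := by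
    ext p
    have : F a p = linearization a sig p.2 + (p.1 - sig) • derivL 0 p.2 + cubic a p.2 := by
      rw [show p = (p.1, p.2) from rfl, F_eq, linearization_eq hT]
      simp only [add_apply, smul_apply]
      module
    rw [mem_ofPred_eq, mem_ofPred_eq, this]
  rw [e]
  exact h

/-- The resolvent bound gives `|λ - σ_k|⁻¹ ≤ C`, so the spectrum is discrete. -/
theorem exists_sigma_gap (hT : 0 < T) (lam : ℝ) :
    ∃ γ > 0, ∀ k, sigma T k ≠ lam → γ ≤ |sigma T k - lam| := by
  obtain ⟨C, hC⟩ := exists_resolvent_bound hT lam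
  refine ⟨(|C| + 1)⁻¹, by positivity, fun k hk => ?_⟩
  have h := hC (Sum.inl k)
  change |(lam - sigma T k)⁻¹| * (1 + sigma T k) ≤ C at h
  have h0 := sigma_nonneg T k
  have h1 : 0 < |sigma T k - lam| := abs_pos.2 (sub_ne_zero.2 hk)
  rw [abs_inv, abs_sub_comm] at h
  rw [inv_le_comm₀ (by positivity) h1]
  have : 0 < |sigma T k - lam|⁻¹ := inv_pos.2 h1
  nlinarith [le_abs_self C]

theorem IsLocalBranch.isBranchPair (hT : 0 < T) (hV : IsSpectral V P) {a : Linf T} {i₀ : Freq}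
    (hi₀ : P i₀) {φ : H2 T} (hφ : φ ≠ 0) (hφV : φ ∈ H2in V) {ε r : ℝ} {Lam : ℝ → ℝ}
    {Gam : ℝ → H2 T} (h : IsLocalBranch {p : ℝ × H2 T | p.2 ∈ H2in V ∧ F a p = 0}
      (sigma T (waveNumber i₀)) φ ε r Lam Gam) {η : ℝ} (hη : 0 < η) :
    ∃ ρ₁ > 0, ∀ ρ, 0 < ρ → ρ < ρ₁ → ∃ ε' > 0, ε' < η ∧
      IsBranchPair a (H2in V) V (sigma T (waveNumber i₀)) φ ρ (arc φ Lam Gam (Ioo 0 ε'))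
        (arc φ Lam Gam (Ioo (-ε') 0)) := by
  set sig := sigma T (waveNumber i₀) with hsig
  obtain ⟨ρ₁, hρ₁, hball⟩ := h.exists_radius hη
  obtain ⟨γ, hγ, hgap⟩ := exists_sigma_gap hT sig
  -- `γ` keeps the other points `(σ_j,0)` out of the ball, as they belong to the solution set too;
  -- `r` is the radius of uniqueness.
  refine ⟨min ρ₁ (min γ r), lt_min hρ₁ (lt_min hγ h.r_pos), fun ρ hρ hρlt => ?_⟩
  obtain ⟨ε', hε', hε'ε, hε'η, hiff⟩ := hball ρ hρ (hρlt.trans_le (min_le_left _ _))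
  have hργ : ρ < γ := hρlt.trans_le ((min_le_right _ _).trans (min_le_left _ _))
  have hρr : ρ < r := hρlt.trans_le ((min_le_right _ _).trans (min_le_right _ _))
  refine ⟨ε', hε', hε'η, ?_⟩
  set S := nontrivialSolutions a (H2in V) V with hS
  set c : ℝ → ℝ × H2 T := fun s => (Lam s, s • (φ + Gam s)) with hc
  have hsub : Ioo (-ε') ε' ⊆ Ioo (-ε) ε := Ioo_subset_Ioo (by linarith) hε'ε.le
  have hsub1 : Ioo 0 ε' ⊆ Ioo (-ε') ε' := Ioo_subset_Ioo_left (by linarith)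
  have hsub2 : Ioo (-ε') 0 ⊆ Ioo (-ε') ε' := Ioo_subset_Ioo_right hε'.le
  have hspec : (sig, (0 : H2 T)) ∈ S := Or.inr ⟨rfl, by
    rw [genSpectrum_eq hT hV]
    exact ⟨i₀, hi₀, rfl⟩⟩
  have hc0 : c 0 = (sig, 0) := by simp [hc, h.Lam_zero]
  have hcS : ∀ s ∈ Ioo (-ε') ε', c s ∈ S := by
    intro s hs
    by_cases hs0 : s = 0
    · rw [hs0, hc0]
      exact hspec
    · obtain ⟨h1, h2⟩ := h.mem s (hsub hs)
      exact Or.inl ⟨h1, h2, h.ne_zero hφ (hsub hs) hs0⟩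
  have hcB : ∀ s ∈ Ioo (-ε') ε', c s ∈ Metric.ball (sig, (0 : H2 T)) ρ := fun s hs =>
    (hiff s (hsub hs)).2 (abs_lt.2 hs)
  have hunion : c '' Ioo (-ε') ε' = arc φ Lam Gam (Ioo 0 ε') ∪ arc φ Lam Gam (Ioo (-ε') 0)
      ∪ {(sig, 0)} := by
    have e : Ioo (-ε') ε' = Ioo 0 ε' ∪ Ioo (-ε') 0 ∪ {0} := by
      ext s
      simp only [mem_union, mem_Ioo, mem_singleton_iff]
      constructor
      · rintro ⟨h1, h2⟩
        rcases lt_trichotomy s 0 with h3 | h3 | h3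
        · exact Or.inl (Or.inr ⟨h1, h3⟩)
        · exact Or.inr h3
        · exact Or.inl (Or.inl ⟨h3, h2⟩)
      · rintro ((⟨h1, h2⟩ | ⟨h1, h2⟩) | h1) <;> constructor <;> linarith
    rw [e, image_union, image_union, image_singleton, hc0]
    rfl
  have hne : (sig, 0) ∉ arc φ Lam Gam (Ioo 0 ε') ∪ arc φ Lam Gam (Ioo (-ε') 0) := by
    rintro (⟨s, hs, e⟩ | ⟨s, hs, e⟩)
    · exact h.ne_zero hφ (hsub (hsub1 hs)) hs.1.ne' (congrArg Prod.snd e)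
    · exact h.ne_zero hφ (hsub (hsub2 hs)) hs.2.ne (congrArg Prod.snd e)
  have hSB : S ∩ Metric.ball (sig, 0) ρ = arc φ Lam Gam (Ioo 0 ε') ∪ arc φ Lam Gam (Ioo (-ε') 0)
      ∪ {(sig, 0)} := by
    rw [← hunion]
    apply subset_antisymm
    · rintro ⟨lam, u⟩ ⟨hp, hb⟩
      have hb' := hb
      rw [Metric.mem_ball, Prod.dist_eq, dist_zero_right, Real.dist_eq, max_lt_iff] at hb'
      rcases hp with ⟨h1, h2, h3⟩ | ⟨h1, h2⟩
      · obtain ⟨s, hs, e1, e2⟩ := h.unique lam u ⟨h1, h2⟩ (hb'.1.trans hρr) (hb'.2.trans hρr) h3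
        refine ⟨s, ?_, Prod.ext e1.symm e2.symm⟩
        rw [e1, e2] at hb
        exact abs_lt.1 ((hiff s hs).1 hb)
      · rw [genSpectrum_eq hT hV] at h2
        obtain ⟨i, -, hi⟩ := h2
        change lam = _ at hi
        change u = 0 at h1
        refine ⟨0, ⟨by linarith, hε'⟩, ?_⟩
        rw [hc0, h1]
        by_cases hne : sigma T (waveNumber i) = sig
        · rw [hi, hne]
        · have h4 := hgap _ hne
          rw [← hi] at h4
          exact absurd hb'.1 (not_lt.2 (hργ.le.trans h4))
    · rintro _ ⟨s, hs, rfl⟩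
      exact ⟨hcS s hs, hcB s hs⟩
  refine ⟨⟨ε', hε', Lam, Gam, ⟨h.smooth_Lam.mono hsub, h.smooth_Gam.mono hsub, h.Lam_zero,
    h.Gam_zero, ?_, fun s hs => (h.mem s (hsub hs)).2⟩, rfl, rfl⟩, ?_, hne, hSB, ?_, ?_⟩
  · intro s hs
    refine ⟨?_, by rw [real_inner_comm]; exact h.orth s (hsub hs)⟩
    by_cases hs0 : s = 0
    · rw [hs0, h.Gam_zero]
      exact Submodule.zero_mem _
    · have h1 := (h.mem s (hsub hs)).1
      have h2 : φ + Gam s ∈ H2in V := ((H2in V).smul_mem_iff hs0).1 h1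
      exact ((H2in V).add_mem_iff_right hφV).1 h2
  · rw [Set.disjoint_left]
    rintro _ ⟨s, hs, rfl⟩ ⟨t, ht, e⟩
    have := h.injOn hφ (hsub (hsub2 ht)) (hsub (hsub1 hs)) (congrArg Prod.snd e)
    linarith [hs.1, ht.2]
  -- The arc through `(σ,0)` is connected, hence inside the component; conversely, within the ball
  -- the component contains nothing but this arc.
  · have hconn : c '' Ioo (-ε') ε' ⊆ component a (H2in V) V sig := by
      refine IsPreconnected.subset_connectedComponentIn ?_ ⟨0, ⟨by linarith, hε'⟩, hc0⟩ ?_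
      · exact isPreconnected_Ioo.image _ (h.continuousOn.mono hsub)
      · rintro _ ⟨s, hs, rfl⟩
        exact hcS s hs
    apply subset_antisymm
    · rintro p ⟨h1, h2, h3⟩
      have : p ∈ S ∩ Metric.ball (sig, 0) ρ := ⟨connectedComponentIn_subset _ _ h2, h1⟩
      rw [hSB] at this
      exact this.resolve_right h3
    · intro p hp
      have h1 : p ∈ S ∩ Metric.ball (sig, 0) ρ := by
        rw [hSB]
        exact Or.inl hp
      refine ⟨h1.2, hconn ?_, fun e => hne (e ▸ hp)⟩
      rw [hunion]
      exact Or.inl hp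
  · ext p
    constructor
    · rintro ⟨_, ⟨s, hs, rfl⟩, rfl⟩
      refine ⟨-s, ⟨by linarith [hs.2], by linarith [hs.1]⟩, ?_⟩
      exact Prod.ext (h.even_Lam s (hsub (hsub1 hs))) (h.neg_eq (hsub (hsub1 hs)))
    · rintro ⟨s, hs, rfl⟩
      refine ⟨(Lam (-s), (-s) • (φ + Gam (-s))), ⟨-s, ⟨by linarith [hs.2],
        by linarith [hs.1]⟩, rfl⟩, ?_⟩
      refine Prod.ext (h.even_Lam s (hsub (hsub2 hs))) ?_
      change -((-s) • (φ + Gam (-s))) = s • (φ + Gam s)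
      rw [h.neg_eq (hsub (hsub2 hs)), neg_neg]

/-! ### Counting zeros of functions close to a sine or cosine -/

section Zeros

theorem encard_inter_Ico_of_existsUnique {Z : Set ℝ} {τ : ℕ → ℝ} {n : ℕ}
    (hτ : ∀ j < n, τ j ≤ τ (j + 1)) (h : ∀ j < n, ∃! t, t ∈ Z ∩ Ico (τ j) (τ (j + 1))) :
    τ 0 ≤ τ n ∧ (Z ∩ Ico (τ 0) (τ n)).encard = n := by
  induction n with
  | zero => simp
  | succ n ih =>
    obtain ⟨h1, h2⟩ := ih (fun j hj => hτ j (by omega)) (fun j hj => h j (by omega))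
    have h3 := hτ n (by omega)
    obtain ⟨t, ht, hu⟩ := h n (by omega)
    have e : Z ∩ Ico (τ n) (τ (n + 1)) = {t} :=
      subset_antisymm (fun x hx => hu x hx) (singleton_subset_iff.2 ht)
    refine ⟨h1.trans h3, ?_⟩
    rw [← Ico_union_Ico_eq_Ico h1 h3, inter_union_distrib_left, encard_union_eq, h2, e,
      encard_singleton, Nat.cast_succ]
    rw [Set.disjoint_left]
    exact fun x hx hx' => not_lt.2 hx'.2.1 hx.2.2

variable {T A w c : ℝ} {v v' : ℝ → ℝ}

/-- A function `C¹`-close to a cosine has at most one zero on an interval on which the phase stays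
in a half period. -/
theorem no_two_zeros_of_close (hv : ContinuousOn v (Icc 0 T))
    (hd : ∀ t ∈ Ioo 0 T, HasDerivAt v (v' t) t) (hA : 0 < A) (hw : 0 < w)
    (h0 : ∀ t ∈ Icc 0 T, |v t - A * Real.cos (w * t + c)| < A / 2)
    (h1 : ∀ t ∈ Ioo 0 T, |v' t + A * w * Real.sin (w * t + c)| < A * w / 2) (m : ℤ) {x y : ℝ}
    (hx : 0 ≤ x) (hy : y ≤ T) (hxy : x < y) (hmx : m * Real.pi ≤ w * x + c)
    (hmy : w * y + c ≤ (m + 1) * Real.pi) (vx : v x = 0) (vy : v y = 0) : False := by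
  -- Rolle's theorem gives a critical point between two zeros. There both `|cos|` and `|sin|` of the
  -- phase would be below `1/2`, contradicting `sin² + cos² = 1`.
  obtain ⟨z, ⟨hz1, hz2⟩, hz⟩ := exists_hasDerivAt_eq_zero hxy
    (hv.mono (Icc_subset_Icc hx hy)) (vx.trans vy.symm)
    (fun t ht => hd t ⟨hx.trans_lt ht.1, ht.2.trans_le hy⟩)
  have zT : z ∈ Ioo 0 T := ⟨hx.trans_lt hz1, hz2.trans_le hy⟩
  have small : ∀ t ∈ Icc 0 T, v t = 0 → |Real.cos (w * t + c - m * Real.pi)| < 1 / 2 := by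
    intro t ht h
    have := h0 t ht
    rw [h, zero_sub, abs_neg, abs_mul, abs_of_pos hA] at this
    rw [Real.cos_sub_int_mul_pi, abs_mul, abs_zpow, abs_neg, abs_one, one_zpow, one_mul]
    nlinarith
  have sx := abs_lt.1 (small x ⟨hx, by linarith⟩ vx)
  have sy := abs_lt.1 (small y ⟨by linarith, hy⟩ vy)
  have xz : w * x ≤ w * z := by gcongr
  have zy : w * z ≤ w * y := by gcongr
  -- After the shift by `mπ` the phase lies in `[0,π]`, where cosine decreases, so smallness of the
  -- cosine at `x` and `y` passes to `z`.
  have c1 : Real.cos (w * z + c - m * Real.pi) ≤ Real.cos (w * x + c - m * Real.pi) :=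
    Real.cos_le_cos_of_nonneg_of_le_pi (by linarith) (by linarith) (by linarith)
  have c2 : Real.cos (w * y + c - m * Real.pi) ≤ Real.cos (w * z + c - m * Real.pi) :=
    Real.cos_le_cos_of_nonneg_of_le_pi (by linarith) (by linarith) (by linarith)
  have cz : |Real.cos (w * z + c - m * Real.pi)| < 1 / 2 := abs_lt.2 ⟨by linarith, by linarith⟩
  rw [Real.cos_sub_int_mul_pi, abs_mul, abs_zpow, abs_neg, abs_one, one_zpow, one_mul] at cz
  have sz := h1 z zT
  rw [hz, zero_add, abs_mul, abs_of_pos (mul_pos hA hw)] at sz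
  have sz' : |Real.sin (w * z + c)| < 1 / 2 := by nlinarith [mul_pos hA hw]
  have := Real.sin_sq_add_cos_sq (w * z + c)
  nlinarith [sq_abs (Real.sin (w * z + c)), sq_abs (Real.cos (w * z + c)),
    abs_nonneg (Real.sin (w * z + c)), abs_nonneg (Real.cos (w * z + c))]

/-- At the ends of a half period the cosine is `±1` with opposite signs, and closeness preserves
these signs. -/
theorem existsUnique_zero_of_close (hv : ContinuousOn v (Icc 0 T))
    (hd : ∀ t ∈ Ioo 0 T, HasDerivAt v (v' t) t) (hA : 0 < A) (hw : 0 < w)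
    (h0 : ∀ t ∈ Icc 0 T, |v t - A * Real.cos (w * t + c)| < A / 2)
    (h1 : ∀ t ∈ Ioo 0 T, |v' t + A * w * Real.sin (w * t + c)| < A * w / 2) (m : ℤ) {p q : ℝ}
    (hp : 0 ≤ p) (hq : q ≤ T) (hmp : w * p + c = m * Real.pi)
    (hmq : w * q + c = (m + 1) * Real.pi) : ∃! t, t ∈ {t | v t = 0} ∩ Ico p q := by
  have hpq : p < q := by nlinarith [Real.pi_pos]
  have vp := h0 p ⟨hp, hpq.le.trans hq⟩
  have vq := h0 q ⟨hp.trans hpq.le, hq⟩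
  rw [hmp] at vp
  rw [hmq, add_mul, one_mul, Real.cos_add_pi] at vq
  have hv' := hv.mono (Icc_subset_Icc hp hq)
  have ex : ∃ t ∈ Ioo p q, v t = 0 := by
    rw [Real.cos_int_mul_pi] at vp vq
    rcases Int.even_or_odd m with hm | hm
    · rw [hm.neg_one_zpow, abs_lt] at vp vq
      exact intermediate_value_Ioo' hpq.le hv' (show (0 : ℝ) ∈ Ioo (v q) (v p) from
        ⟨by linarith, by linarith⟩)
    · rw [hm.neg_one_zpow, abs_lt] at vp vq
      exact intermediate_value_Ioo hpq.le hv' (show (0 : ℝ) ∈ Ioo (v p) (v q) from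
        ⟨by linarith, by linarith⟩)
  obtain ⟨t, ht, vt⟩ := ex
  refine ⟨t, ⟨vt, ht.1.le, ht.2⟩, ?_⟩
  rintro s ⟨vs, hs1, hs2⟩
  have hws : w * p ≤ w * s := by gcongr
  have hws' : w * s ≤ w * q := by gcongr
  have hwt : w * p ≤ w * t := mul_le_mul_of_nonneg_left ht.1.le hw.le
  have hwt' : w * t ≤ w * q := mul_le_mul_of_nonneg_left ht.2.le hw.le
  have key := fun (x y : ℝ) => no_two_zeros_of_close (x := x) (y := y) hv hd hA hw h0 h1 m
  rcases lt_trichotomy s t with h | h | h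
  · exact (key s t (hp.trans hs1) (ht.2.le.trans hq) h (by linarith) (by linarith) vs vt).elim
  · exact h
  · exact (key t s (hp.trans ht.1.le) (hs2.le.trans hq) h (by linarith) (by linarith) vt vs).elim

/-- The extrema `jπ/w` of the cosine divide `[0,T)` into `2k` cells with one zero each. -/
theorem encard_zeros_of_close_cos (hT : 0 < T) {k : ℕ} (hk : 1 ≤ k)
    (hv : ContinuousOn v (Icc 0 T)) (hd : ∀ t ∈ Ioo 0 T, HasDerivAt v (v' t) t) (hA : 0 < A)
    (hw : w = 2 * Real.pi * k / T)
    (h0 : ∀ t ∈ Icc 0 T, |v t - A * Real.cos (w * t)| < A / 2)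
    (h1 : ∀ t ∈ Ioo 0 T, |v' t + A * w * Real.sin (w * t)| < A * w / 2) :
    {t ∈ Ico 0 T | v t = 0}.encard = (2 * k : ℕ) := by
  have hk0 : (0 : ℝ) < k := by exact_mod_cast hk
  have hw0 : 0 < w := by rw [hw]; positivity
  set τ : ℕ → ℝ := fun j => j * (Real.pi / w) with hτ
  have hτ0 : ∀ j, 0 ≤ τ j := fun j => by positivity
  have hτT : τ (2 * k) = T := by
    simp only [hτ, hw]
    push_cast
    field_simp
  have hmono : Monotone τ := fun i j hij => by
    simp only [hτ]
    gcongr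
  have hph : ∀ j, w * τ j = j * Real.pi := fun j => by
    simp only [hτ]
    field_simp
  have := (encard_inter_Ico_of_existsUnique (Z := {t | v t = 0}) (τ := τ) (n := 2 * k)
    (fun j _ => hmono (Nat.le_succ j)) fun j hj => existsUnique_zero_of_close (c := 0) hv hd hA hw0
      (by simpa using h0) (by simpa using h1) j (hτ0 j) (hτT ▸ hmono hj)
      (by rw [hph]; push_cast; ring) (by rw [hph]; push_cast; ring)).2
  rw [hτT, show τ 0 = 0 by simp [hτ]] at this
  rw [← this]
  congr 1
  ext t
  exact and_comm

/-- Here the endpoints are zeros of the model function, and closeness alone would not fix the count.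
The hypotheses at `0` and `T` pin these zeros down. -/
theorem encard_zeros_of_close_sin (hT : 0 < T) {k : ℕ} (hk : 1 ≤ k)
    (hv : ContinuousOn v (Icc 0 T)) (hd : ∀ t ∈ Ioo 0 T, HasDerivAt v (v' t) t) (hA : 0 < A)
    (hw : w = 2 * Real.pi * k / T) (hv0 : v 0 = 0) (hvT : v T = 0)
    (h0 : ∀ t ∈ Icc 0 T, |v t - A * Real.sin (w * t)| < A / 2)
    (h1 : ∀ t ∈ Ioo 0 T, |v' t - A * w * Real.cos (w * t)| < A * w / 2) :
    {t ∈ Ico 0 T | v t = 0}.encard = (2 * k : ℕ) := by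
  have hk0 : (0 : ℝ) < k := by exact_mod_cast hk
  have hw0 : 0 < w := by rw [hw]; positivity
  have hpi := Real.pi_pos
  have h0' : ∀ t ∈ Icc 0 T, |v t - A * Real.cos (w * t + -(Real.pi / 2))| < A / 2 := fun t ht => by
    rw [← sub_eq_add_neg, Real.cos_sub_pi_div_two]
    exact h0 t ht
  have h1' : ∀ t ∈ Ioo 0 T, |v' t + A * w * Real.sin (w * t + -(Real.pi / 2))| < A * w / 2 :=
    fun t ht => by
      rw [← sub_eq_add_neg, Real.sin_sub_pi_div_two, mul_neg, ← sub_eq_add_neg]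
      exact h1 t ht
  have key := fun (m : ℤ) (x y : ℝ) => no_two_zeros_of_close (x := x) (y := y) hv hd hA hw0 h0' h1' m
  -- The cells are cut at `0` and at the extrema `(j - 1/2)π/w`. The first contains only the zero at
  -- `0`, the next `2k - 1` have one zero each, and in the leftover piece up to `T` the only zero is
  -- the excluded endpoint.
  set τ : ℕ → ℝ := fun j => if j = 0 then 0 else (j - 1 / 2) * (Real.pi / w) with hτ
  have hτs : ∀ j : ℕ, τ (j + 1) = (j + 1 / 2) * (Real.pi / w) := fun j => by
    simp only [hτ, Nat.succ_ne_zero, if_false]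
    push_cast
    ring
  have hτ0 : τ 0 = 0 := by simp [hτ]
  have hph : ∀ j : ℕ, w * τ (j + 1) + -(Real.pi / 2) = j * Real.pi := fun j => by
    rw [hτs]
    field_simp
    ring
  have hwT : w * T = 2 * k * Real.pi := by
    rw [hw]
    field_simp
  have hmono : Monotone τ := by
    refine monotone_nat_of_le_succ fun j => ?_
    rcases j with _ | j
    · rw [hτ0, hτs]
      positivity
    · rw [hτs, hτs]
      push_cast
      gcongr
      linarith
  have hlast : τ (2 * k) < T := by
    obtain ⟨n, hn⟩ : ∃ n, 2 * k = n + 1 := ⟨2 * k - 1, by omega⟩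
    have h2 := hph n
    have h3 : (2 * k : ℝ) = n + 1 := by exact_mod_cast hn
    rw [hn]
    rw [h3] at hwT
    nlinarith
  have hnn : ∀ j, 0 ≤ τ j := fun j => hτ0 ▸ hmono (Nat.zero_le j)
  have hcount := (encard_inter_Ico_of_existsUnique (Z := {t | v t = 0}) (τ := τ) (n := 2 * k)
    (fun j _ => hmono (Nat.le_succ j)) (by
      intro j hj
      rcases j with _ | j
      · have hpos : τ 0 < τ (0 + 1) := by
          rw [hτ0, hτs]
          positivity
        refine ⟨0, ⟨hv0, by rw [hτ0], by rwa [hτ0] at hpos⟩, ?_⟩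
        rintro s ⟨vs, hs1, hs2⟩
        rw [hτ0] at hs1
        rcases hs1.eq_or_lt with e | hs0
        · exact e.symm
        have h2 : τ (0 + 1) ≤ T := (hmono hj).trans hlast.le
        have h3 := hph 0
        have h4 : w * s ≤ w * τ (0 + 1) := mul_le_mul_of_nonneg_left hs2.le hw0.le
        push_cast at h3
        exact (key (-1) 0 s le_rfl (hs2.le.trans h2) hs0 (by push_cast; linarith)
          (by push_cast; linarith) hv0 vs).elim
      · exact existsUnique_zero_of_close hv hd hA hw0 h0' h1' j (hnn _)
          ((hmono hj).trans hlast.le) (by rw [hph]; push_cast; ring)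
          (by rw [hph]; push_cast; ring))).2
  rw [hτ0] at hcount
  rw [← hcount]
  congr 1
  ext t
  simp only [mem_inter_iff, mem_ofPred_eq]
  constructor
  · rintro ⟨⟨ht0, htT⟩, vt⟩
    refine ⟨vt, ht0, ?_⟩
    by_contra hc
    obtain ⟨n, hn⟩ : ∃ n, 2 * k = n + 1 := ⟨2 * k - 1, by omega⟩
    rw [hn] at hc
    have h2 := hph n
    have h3 : (2 * k : ℝ) = n + 1 := by exact_mod_cast hn
    have h4 : w * τ (n + 1) ≤ w * t := mul_le_mul_of_nonneg_left (not_lt.1 hc) hw0.le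
    rw [h3] at hwT
    exact key n t T ht0 le_rfl htT (by push_cast; linarith) (by push_cast; linarith) vt hvT
  · rintro ⟨vt, ht0, ht⟩
    exact ⟨⟨ht0, ht.trans hlast⟩, vt⟩

end Zeros

/-! ### Sign and zeros of small perturbations in H² -/

variable {T : ℝ}

theorem val_smul_add (hT : 0 < T) (s : ℝ) (φ w : H2 T) {t : ℝ} (ht : t ∈ Icc 0 T) :
    val (s • (φ + w)) t = s * (val φ t + val w t) := by
  rw [val_smul hT s _ ht, Pi.smul_apply, val_add hT φ w ht, Pi.add_apply, smul_eq_mul]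

theorem hasExactlyZeros_smul (hT : 0 < T) {s : ℝ} (hs : s ≠ 0) {u : H2 T} {n : ℕ}
    (h : HasExactlyZeros u n) : HasExactlyZeros (s • u) n := by
  have e : {t ∈ Ico 0 T | val (s • u) t = 0} = {t ∈ Ico 0 T | val u t = 0} := by
    ext t
    refine and_congr_right fun ht => ?_
    rw [val_smul hT s u (Ico_subset_Icc_self ht), Pi.smul_apply, smul_eq_mul,
      mul_eq_zero, or_iff_right hs]
  rw [HasExactlyZeros, e]
  exact h

theorem exists_norm_lt_abs_val_lt (hT : 0 < T) {ε : ℝ} (hε : 0 < ε) :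
    ∃ δ > 0, ∀ w : H2 T, ‖w‖ < δ → ∀ t ∈ Icc 0 T, |val w t| < ε ∧ |dval w t| < ε := by
  have hM : 0 < √T / T + √T := by positivity
  refine ⟨ε / (√T / T + √T), by positivity, fun w hw t ht => ?_⟩
  rw [lt_div_iff₀' hM] at hw
  exact ⟨(abs_val_le hT w ht).trans_lt hw, (abs_dval_le hT w ht).trans_lt hw⟩

theorem exists_hasExactlyZeros_cosFun (hT : 0 < T) {k : ℕ} (hk : 1 ≤ k) :
    ∃ δ > 0, ∀ w : H2 T, ‖w‖ < δ → HasExactlyZeros (cosFun T k + w) (2 * k) := by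
  have hk0 : (0 : ℝ) < k := by exact_mod_cast hk
  have hw0 : 0 < 2 * Real.pi * k / T := by positivity
  have hA : 0 < √(2 / T) := by positivity
  obtain ⟨δ, hδ, h⟩ := exists_norm_lt_abs_val_lt hT (ε := min (√(2 / T) / 2)
    (√(2 / T) * (2 * Real.pi * k / T) / 2)) (by positivity)
  refine ⟨δ, hδ, fun w hw => ?_⟩
  refine encard_zeros_of_close_cos (v' := dval (cosFun T k + w)) hT hk (val_continuousOn _)
    (fun t ht => hasDerivAt_val hT _ ht) hA rfl (fun t ht => ?_) fun t ht => ?_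
  · rw [val_add hT _ _ ht, Pi.add_apply, val_cosFun hT k ht, add_sub_cancel_left]
    exact (h w hw t ht).1.trans_le (min_le_left _ _)
  · have ht' := Ioo_subset_Icc_self ht
    rw [dval_add hT _ _ ht', Pi.add_apply, dval_cosFun hT k ht']
    beta_reduce
    rw [neg_mul, add_right_comm, neg_add_cancel, zero_add]
    exact (h w hw t ht').2.trans_le (min_le_right _ _)

/-- Oddness gives `u(T) = -u(0)` and periodicity gives `u(T) = u(0)`. -/
theorem val_zero_of_mem_H2odd (hT : 0 < T) {u : H2 T} (hu : u ∈ H2odd T) : val u 0 = 0 := by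
  have hr : ∀ᵐ t ∂(mu T), val u (T - t) = -val u t := by
    have hu' : ∀ᵐ t ∂(mu T), D 0 u (T - t) = -1 * D 0 u t := hu
    filter_upwards [hu', val_ae_eq u, (quasiMeasurePreserving_reflect T).ae (val_ae_eq u)]
      with t h1 h2 h3
    rw [← h2, ← h3, h1, neg_one_mul]
  have c1 : ContinuousOn (fun t => val u (T - t)) (Icc 0 T) :=
    (val_continuousOn u).comp (by fun_prop) fun t ht => ⟨by linarith [ht.2], by linarith [ht.1]⟩
  have h := eqOn_Icc_of_ae_eq hT hr c1 (val_continuousOn u).neg ⟨le_rfl, hT.le⟩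
  simp only [sub_zero] at h
  rw [← val_zero_eq] at h
  linarith

theorem exists_hasExactlyZeros_sinFun (hT : 0 < T) {k : ℕ} (hk : 1 ≤ k) :
    ∃ δ > 0, ∀ w : H2 T, ‖w‖ < δ → sinFun T k + w ∈ H2odd T →
      HasExactlyZeros (sinFun T k + w) (2 * k) := by
  have hk0 : (0 : ℝ) < k := by exact_mod_cast hk
  have hw0 : 0 < 2 * Real.pi * k / T := by positivity
  have hA : 0 < √(2 / T) := by positivity
  obtain ⟨δ, hδ, h⟩ := exists_norm_lt_abs_val_lt hT (ε := min (√(2 / T) / 2)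
    (√(2 / T) * (2 * Real.pi * k / T) / 2)) (by positivity)
  refine ⟨δ, hδ, fun w hw hodd => ?_⟩
  have hv0 := val_zero_of_mem_H2odd hT hodd
  refine encard_zeros_of_close_sin (v' := dval (sinFun T k + w)) hT hk (val_continuousOn _)
    (fun t ht => hasDerivAt_val hT _ ht) hA rfl hv0 ((val_zero_eq _).symm.trans hv0)
    (fun t ht => ?_) fun t ht => ?_
  · rw [val_add hT _ _ ht, Pi.add_apply, val_sinFun hT k ht, add_sub_cancel_left]
    exact (h w hw t ht).1.trans_le (min_le_left _ _)
  · have ht' := Ioo_subset_Icc_self ht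
    rw [dval_add hT _ _ ht', Pi.add_apply, dval_sinFun hT k ht', add_sub_cancel_left]
    exact (h w hw t ht').2.trans_le (min_le_right _ _)

theorem val_oneFun (hT : 0 < T) : EqOn (val (oneFun T)) (fun _ => 1) (Icc 0 T) :=
  val_eqOn hT continuousOn_const (memLp_of_continuous T continuous_const).coeFn_toLp

theorem H2.ext_val (hT : 0 < T) {u v : H2 T} (h : EqOn (val u) (val v) (Icc 0 T)) : u = v := by
  refine H2.ext hT (Lp.ext ?_)
  filter_upwards [val_ae_eq u, val_ae_eq v, ae_restrict_mem measurableSet_Ioc] with t h1 h2 h3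
  rw [h1, h2, h (Ioc_subset_Icc_self h3)]

theorem smul_trig_zero_eq_oneFun (hT : 0 < T) :
    (√(2 / T))⁻¹ • trig T (Sum.inl 0) = oneFun T := by
  have hA : 0 < √(2 / T) := by positivity
  refine H2.ext_val hT fun t ht => ?_
  rw [val_smul hT _ _ ht, Pi.smul_apply, val_oneFun hT ht]
  change _ • val (cosFun T 0) t = 1
  rw [val_cosFun hT 0 ht]
  beta_reduce
  rw [Nat.cast_zero, mul_zero, zero_div, zero_mul, Real.cos_zero, mul_one, smul_eq_mul,
    inv_mul_cancel₀ hA.ne']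

/-! ### Components, branches and bifurcation points -/

section Branches

variable {V : Submodule ℝ (L2 T)} {P : Freq → Prop}

theorem nontrivialSolutions_subset_top (hT : 0 < T) (hV : IsSpectral V P) (a : Linf T) :
    nontrivialSolutions a (H2in V) V ⊆ nontrivialSolutions a ⊤ ⊤ := by
  rintro p (⟨-, h⟩ | ⟨h1, h2⟩)
  · exact Or.inl ⟨trivial, h⟩
  · refine Or.inr ⟨h1, ?_⟩
    rw [genSpectrum_eq hT hV] at h2
    obtain ⟨i, -, hi⟩ := h2
    rw [← H2in_top, genSpectrum_eq hT isSpectral_top]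
    exact ⟨i, trivial, hi⟩

theorem component_subset_top (hT : 0 < T) (hV : IsSpectral V P) (a : Linf T) (lam : ℝ) :
    component a (H2in V) V lam ⊆ component a ⊤ ⊤ lam :=
  connectedComponentIn_mono _ (nontrivialSolutions_subset_top hT hV a)

/-- The positive half-branch is non-trivial, lies in the component and tends to `(σ,0)` as `s → 0+`.
-/
theorem IsBranchPair.mem_closure {a : Linf T} {U : Submodule ℝ (H2 T)} {sig : ℝ} {φ : H2 T}
    {ρ : ℝ} {Cp Cm : Set (ℝ × H2 T)} (h : IsBranchPair a U V sig φ ρ Cp Cm) (hφ : φ ≠ 0) :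
    (sig, 0) ∈ closure (component a U V sig \ trivialSet T) := by
  obtain ⟨⟨ε, hε, Lam, Gam, hc, rfl, rfl⟩, -, hn, hS, hcomp, -⟩ := h
  have h0 : Ioo (-ε) ε ∈ 𝓝 (0 : ℝ) := isOpen_Ioo.mem_nhds ⟨neg_lt_zero.2 hε, hε⟩
  have cl := hc.smooth_Lam.continuousOn.continuousAt h0
  have cg := hc.smooth_Gam.continuousOn.continuousAt h0
  have lim : ContinuousAt (fun s => (Lam s, s • (φ + Gam s))) 0 :=
    cl.prodMk (continuousAt_id.smul (continuousAt_const.add cg))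
  have lim' : Filter.Tendsto (fun s => (Lam s, s • (φ + Gam s))) (𝓝[>] 0) (𝓝 (sig, 0)) := by
    have := lim.tendsto
    simp only [hc.Lam_zero, zero_smul] at this
    exact this.mono_left nhdsWithin_le_nhds
  refine mem_closure_of_tendsto lim' ?_
  filter_upwards [Ioo_mem_nhdsGT hε] with s hs
  have hm : (Lam s, s • (φ + Gam s)) ∈ arc φ Lam Gam (Ioo 0 ε) ∪ arc φ Lam Gam (Ioo (-ε) 0) :=
    Or.inl ⟨s, hs, rfl⟩
  have hm' := hm
  rw [← hcomp] at hm'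
  refine ⟨hm'.2.1, fun h' => ?_⟩
  change s • (φ + Gam s) = 0 at h'
  have hg : φ + Gam s = 0 := (smul_eq_zero.1 h').resolve_left hs.1.ne'
  have ho := (hc.Gam_mem s ⟨by linarith [hs.1, hε], hs.2⟩).2
  rw [eq_neg_of_add_eq_zero_right hg, inner_neg_left, neg_eq_zero] at ho
  exact hφ (inner_self_eq_zero.1 ho)

/-- Besides the branch pair it retains the form `s(φ + w)` with `‖w‖ < δ` for prescribed `δ`, from
which the number of zeros is read off. -/
theorem exists_isBranchPair (hT : 0 < T) (hV : IsSpectral V P) (a : Linf T)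
    (hcub : ∀ u ∈ H2in V, cubic a u ∈ V) {i₀ : Freq} (hi₀ : P i₀) {c : ℝ} (hc : c ≠ 0)
    (hsimple : ∀ i, P i → waveNumber i = waveNumber i₀ → i = i₀) {δ : ℝ} (hδ : 0 < δ) :
    ∃ ρ₁ > 0, ∀ ρ, 0 < ρ → ρ < ρ₁ → ∃ Cp Cm,
      IsBranchPair a (H2in V) V (sigma T (waveNumber i₀)) (c • trig T i₀) ρ Cp Cm ∧
      (∀ p ∈ Cp, p.2 ∈ H2in V ∧ ∃ (s : ℝ) (w : H2 T),
        0 < s ∧ ‖w‖ < δ ∧ p.2 = s • (c • trig T i₀ + w)) ∧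
      (∀ p ∈ Cm, p.2 ∈ H2in V ∧ ∃ (s : ℝ) (w : H2 T),
        s < 0 ∧ ‖w‖ < δ ∧ p.2 = s • (c • trig T i₀ + w)) := by
  have hmem : c • trig T i₀ ∈ H2in V := by
    refine Submodule.smul_mem _ _ ?_
    rw [mem_H2in, hV]
    exact fun j hj => inner_trig_trig hT fun h => hj (h ▸ hi₀)
  have hne : c • trig T i₀ ≠ 0 := smul_ne_zero hc fun h => D0_trig_ne_zero hT i₀ (by rw [h]; rfl)
  obtain ⟨ε, r, Lam, Gam, h⟩ := exists_localBranch hT hV a hcub hi₀ hc hsimple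
  obtain ⟨η, hη, hlt⟩ := h.eventually_norm_lt hδ
  obtain ⟨ρ₁, hρ₁, hp⟩ := h.isBranchPair hT hV hi₀ hne hmem hη
  refine ⟨ρ₁, hρ₁, fun ρ hρ hρ' => ?_⟩
  obtain ⟨ε', hε', hεη, hpair⟩ := hp ρ hρ hρ'
  refine ⟨_, _, hpair, ?_, ?_⟩
  · rintro _ ⟨s, hs, rfl⟩
    obtain ⟨h1, h2, -⟩ := hlt s (abs_lt.2 ⟨by linarith [hs.1], by linarith [hs.2]⟩)
    exact ⟨(h.mem s h1).1, s, Gam s, hs.1, h2, rfl⟩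
  · rintro _ ⟨s, hs, rfl⟩
    obtain ⟨h1, h2, -⟩ := hlt s (abs_lt.2 ⟨by linarith [hs.1], by linarith [hs.2]⟩)
    exact ⟨(h.mem s h1).1, s, Gam s, hs.2, h2, rfl⟩

theorem waveNumber_eq_zero_iff {i : Freq} : waveNumber i = 0 ↔ i = Sum.inl 0 := by
  rcases i with i | i <;> simp [waveNumber]

/-- Near `(σ₀,0)` all solutions are even, and they do not change sign. -/
theorem exists_isBranchPair_zero (hT : 0 < T) (a : Linf T)
    (ha : ∀ᵐ t ∂(mu T), a (T - t) = a t) :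
    ∃ ρ > 0, ∃ Cp Cm : Set (ℝ × H2 T), IsBranchPair a ⊤ ⊤ (sigma T 0) (oneFun T) ρ Cp Cm ∧
      (∀ p ∈ Cp, p.2 ∈ H2ev T ∧ ∀ t ∈ Icc 0 T, 0 < val p.2 t) ∧
      (∀ p ∈ Cm, p.2 ∈ H2ev T ∧ ∀ t ∈ Icc 0 T, val p.2 t < 0) := by
  have hA : 0 < √(2 / T) := by positivity
  have hsimple : ∀ i, waveNumber i = waveNumber (Sum.inl 0) → i = Sum.inl 0 :=
    fun i => waveNumber_eq_zero_iff.1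
  obtain ⟨ε, r, Lam, Gam, h⟩ := exists_localBranch hT isSpectral_top a (fun _ _ => trivial)
    (i₀ := Sum.inl 0) trivial (inv_ne_zero hA.ne') fun i _ => hsimple i
  obtain ⟨ε₂, r₂, Lam₂, Gam₂, h₂⟩ := exists_localBranch hT (isSpectral_ev hT) a
    (fun u hu => cubic_mem_L2sym (by norm_num) ha hu) (i₀ := Sum.inl 0) rfl
    (inv_ne_zero hA.ne') fun i _ => hsimple i
  rw [smul_trig_zero_eq_oneFun hT] at h h₂
  have hne : oneFun T ≠ 0 := by
    rw [← smul_trig_zero_eq_oneFun hT]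
    exact smul_ne_zero (inv_ne_zero hA.ne') fun h => D0_trig_ne_zero hT _ (by rw [h]; rfl)
  -- Near `s = 0` the branch constructed in the full space is the one constructed among even
  -- functions, so it inherits evenness.
  obtain ⟨η₁, hη₁, hev⟩ := h.eventually_eq hne h₂ fun p hp => ⟨trivial, hp.2⟩
  obtain ⟨δ, hδ, hval⟩ := exists_norm_lt_abs_val_lt hT one_pos
  obtain ⟨η₂, hη₂, hlt⟩ := h.eventually_norm_lt hδ
  obtain ⟨ρ₁, hρ₁, hp⟩ := h.isBranchPair hT isSpectral_top (i₀ := Sum.inl 0) trivial hne trivial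
    (lt_min hη₁ hη₂)
  obtain ⟨ε', hε', hεη, hpair⟩ := hp (ρ₁ / 2) (by linarith) (by linarith)
  rw [H2in_top] at hpair
  have key : ∀ s, |s| < ε' → s • (oneFun T + Gam s) ∈ H2ev T ∧ ∀ t ∈ Icc 0 T,
      ∃ b > 0, val (s • (oneFun T + Gam s)) t = s * b := by
    intro s hs
    refine ⟨?_, fun t ht => ?_⟩
    · obtain ⟨h1, h2⟩ := hev s (hs.trans (hεη.trans_le (min_le_left _ _)))
      rw [h2]
      exact (h₂.mem s h1).1
    · have h1 := (hlt s (hs.trans (hεη.trans_le (min_le_right _ _)))).2.1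
      refine ⟨_, ?_, val_smul_add hT _ _ _ ht⟩
      rw [val_oneFun hT ht]
      linarith [(abs_lt.1 (hval _ h1 t ht).1).1]
  refine ⟨ρ₁ / 2, by linarith, _, _, hpair, ?_, ?_⟩
  · rintro _ ⟨s, hs, rfl⟩
    obtain ⟨h1, h2⟩ := key s (abs_lt.2 ⟨by linarith [hs.1], hs.2⟩)
    refine ⟨h1, fun t ht => ?_⟩
    obtain ⟨b, hb, e⟩ := h2 t ht
    exact e ▸ mul_pos hs.1 hb
  · rintro _ ⟨s, hs, rfl⟩
    obtain ⟨h1, h2⟩ := key s (abs_lt.2 ⟨hs.1, by linarith [hs.2]⟩)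
    refine ⟨h1, fun t ht => ?_⟩
    obtain ⟨b, hb, e⟩ := h2 t ht
    exact e ▸ mul_neg_of_neg_of_pos hs.2 hb

theorem exists_isBranchPair_ev (hT : 0 < T) (a : Linf T)
    (ha : ∀ᵐ t ∂(mu T), a (T - t) = a t) {k : ℕ} (hk : 1 ≤ k) :
    ∃ ρ₁ > 0, ∀ ρ, 0 < ρ → ρ < ρ₁ → ∃ Cp Cm : Set (ℝ × H2 T),
      IsBranchPair a (H2ev T) (L2ev T) (sigma T k) (cosFun T k) ρ Cp Cm ∧
      ∀ p ∈ Cp ∪ Cm, p.2 ∈ H2ev T ∧ HasExactlyZeros p.2 (2 * k) := by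
  obtain ⟨δ, hδ, hz⟩ := exists_hasExactlyZeros_cosFun hT hk
  obtain ⟨ρ₁, hρ₁, h⟩ := exists_isBranchPair hT (isSpectral_ev hT) a
    (fun u hu => cubic_mem_L2sym (by norm_num) ha hu) (i₀ := Sum.inl k) rfl one_ne_zero
    (fun i hi hw => freq_ext hw hi) hδ
  rw [one_smul] at h
  refine ⟨ρ₁, hρ₁, fun ρ h1 h2 => ?_⟩
  obtain ⟨Cp, Cm, hpair, hp, hm⟩ := h ρ h1 h2
  refine ⟨Cp, Cm, hpair, ?_⟩
  have key : ∀ (s : ℝ) (w p : H2 T), s ≠ 0 → ‖w‖ < δ → p = s • (cosFun T k + w) →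
      HasExactlyZeros p (2 * k) := by
    rintro s w p hs hw rfl
    exact hasExactlyZeros_smul hT hs (hz w hw)
  rintro p (hp' | hm')
  · obtain ⟨h3, s, w, hs, hw, e⟩ := hp p hp'
    exact ⟨h3, key s w _ hs.ne' hw e⟩
  · obtain ⟨h3, s, w, hs, hw, e⟩ := hm p hm'
    exact ⟨h3, key s w _ hs.ne hw e⟩

theorem exists_isBranchPair_odd (hT : 0 < T) (a : Linf T)
    (ha : ∀ᵐ t ∂(mu T), a (T - t) = a t) {k : ℕ} (hk : 1 ≤ k) :
    ∃ ρ₁ > 0, ∀ ρ, 0 < ρ → ρ < ρ₁ → ∃ Cp Cm : Set (ℝ × H2 T),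
      IsBranchPair a (H2odd T) (L2odd T) (sigma T k) (sinFun T k) ρ Cp Cm ∧
      ∀ p ∈ Cp ∪ Cm, p.2 ∈ H2odd T ∧ HasExactlyZeros p.2 (2 * k) := by
  obtain ⟨δ, hδ, hz⟩ := exists_hasExactlyZeros_sinFun hT hk
  obtain ⟨j, rfl⟩ : ∃ j, k = j + 1 := ⟨k - 1, by omega⟩
  obtain ⟨ρ₁, hρ₁, h⟩ := exists_isBranchPair hT (isSpectral_odd hT) a
    (fun u hu => cubic_mem_L2sym (by norm_num) ha hu) (i₀ := Sum.inr j) rfl one_ne_zero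
    (fun i hi hw => freq_ext hw hi) hδ
  rw [one_smul] at h
  refine ⟨ρ₁, hρ₁, fun ρ h1 h2 => ?_⟩
  obtain ⟨Cp, Cm, hpair, hp, hm⟩ := h ρ h1 h2
  refine ⟨Cp, Cm, hpair, ?_⟩
  have key : ∀ (s : ℝ) (w p : H2 T), s ≠ 0 → ‖w‖ < δ → p ∈ H2odd T →
      p = s • (sinFun T (j + 1) + w) → HasExactlyZeros p (2 * (j + 1)) := by
    rintro s w p hs hw hp rfl
    exact hasExactlyZeros_smul hT hs (hz w hw (((H2odd T).smul_mem_iff hs).1 hp))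
  rintro p (hp' | hm')
  · obtain ⟨h3, s, w, hs, hw, e⟩ := hp p hp'
    exact ⟨h3, key s w _ hs.ne' hw h3 e⟩
  · obtain ⟨h3, s, w, hs, hw, e⟩ := hm p hm'
    exact ⟨h3, key s w _ hs.ne hw h3 e⟩

theorem sigma_mem_component (hT : 0 < T) (a : Linf T) (k : ℕ) :
    (sigma T k, 0) ∈ component a ⊤ ⊤ (sigma T k) := by
  refine mem_connectedComponentIn (Or.inr ⟨rfl, ?_⟩)
  rw [← H2in_top, genSpectrum_eq hT isSpectral_top]
  exact ⟨Sum.inl k, trivial, rfl⟩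

/-- In the full space `σ_k` is double for `k ≥ 1`, so the branch is taken among even functions,
where `σ_k` is simple; the even component lies in the full one. -/
theorem sigma_mem_closure_component (hT : 0 < T) (a : Linf T)
    (ha : ∀ᵐ t ∂(mu T), a (T - t) = a t) (k : ℕ) :
    (sigma T k, 0) ∈ closure (component a ⊤ ⊤ (sigma T k) \ trivialSet T) := by
  have hne : cosFun T k ≠ 0 := fun h => D0_trig_ne_zero hT (Sum.inl k) (by
    change D 0 (cosFun T k) = 0
    rw [h]
    rfl)
  obtain ⟨ρ₁, hρ₁, h⟩ := exists_isBranchPair hT (isSpectral_ev hT) a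
    (fun u hu => cubic_mem_L2sym (by norm_num) ha hu) (i₀ := Sum.inl k) rfl one_ne_zero
    (fun i hi hw => freq_ext hw hi) one_pos
  obtain ⟨Cp, Cm, hpair, -⟩ := h (ρ₁ / 2) (by linarith) (by linarith)
  rw [one_smul] at hpair
  exact closure_mono (sdiff_subset_sdiff_left (component_subset_top hT (isSpectral_ev hT) a _))
    (hpair.mem_closure hne)

theorem isBifurcationPoint_of_mem_closure {a : Linf T} {U : Submodule ℝ (H2 T)} {lam : ℝ}
    (h : (lam, 0) ∈ closure (component a U V lam \ trivialSet T)) :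
    IsBifurcationPoint a (lam, 0) := by
  refine ⟨rfl, 1, one_pos, fun r hr _ => ?_⟩
  obtain ⟨q, ⟨h1, h2⟩, hd⟩ := Metric.mem_closure_iff.1 h r hr
  refine ⟨q, by rwa [Metric.mem_ball, dist_comm], ?_, h2⟩
  rcases connectedComponentIn_subset _ _ h1 with h3 | h3
  · exact h3.2.1
  · exact absurd h3.1 h2

theorem exists_norm_le_of_equiv {E E' : Type*} [NormedAddCommGroup E] [NormedSpace ℝ E]
    [NormedAddCommGroup E'] [NormedSpace ℝ E'] {U : Submodule ℝ E} {V : Submodule ℝ E'}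
    {f : E →L[ℝ] E'} (e : U ≃L[ℝ] V) (he : ∀ u : U, (e u : E') = f u) :
    ∃ K, 0 ≤ K ∧ ∀ u ∈ U, ‖u‖ ≤ K * ‖f u‖ := by
  refine ⟨‖(e.symm : V →L[ℝ] U)‖, ContinuousLinearMap.opNorm_nonneg _, fun u hu => ?_⟩
  have h := (e.symm : V →L[ℝ] U).le_opNorm (e ⟨u, hu⟩)
  rwa [ContinuousLinearEquiv.coe_coe, e.symm_apply_apply, Submodule.coe_norm,
    Submodule.coe_norm, he] at h

/-- Bifurcation occurs only at points of the spectrum of the linearization. -/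
theorem IsBifurcationPoint.mem_genSpectrum (hT : 0 < T) {a : Linf T} {p : ℝ × H2 T}
    (h : IsBifurcationPoint a p) : p.1 ∈ genSpectrum a ⊤ ⊤ := by
  by_contra hc
  simp only [genSpectrum, mem_ofPred_eq, not_not] at hc
  obtain ⟨e, he⟩ := hc
  obtain ⟨hp, r₀, hr₀, hball⟩ := h
  obtain ⟨C, hC, hcub⟩ := exists_norm_cubic_le hT a
  obtain ⟨K, hK0, hinv⟩ := @exists_norm_le_of_equiv (H2 T) (L2 T) inferInstance inferInstance
    inferInstance inferInstance _ _ _ e he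
  replace hinv : ∀ u : H2 T, ‖u‖ ≤ K * ‖linearization a p.1 u‖ :=
    fun u => hinv u Submodule.mem_top
  -- Small enough for `K r (1 + C) < 1`: a solution in the ball then satisfies `‖u‖ ≤ K r (1 + C)
  -- ‖u‖`, which is impossible for `u ≠ 0`.
  set r := min (r₀ / 2) (min 1 (1 / (2 * (K * (1 + C) + 1)))) with hr
  have hr0 : 0 < r := by positivity
  obtain ⟨⟨lam, u⟩, hq, hF, hu⟩ := hball r hr0 ((min_le_left _ _).trans_lt (by linarith))
  change u ≠ 0 at hu
  change p.2 = 0 at hp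
  rw [Metric.mem_ball, Prod.dist_eq, hp, dist_zero_right, Real.dist_eq, max_lt_iff] at hq
  obtain ⟨hl, hn⟩ := hq
  have hr1 : r ≤ 1 := (min_le_right _ _).trans (min_le_left _ _)
  have hr2 : r * (K * (1 + C)) < 1 := by
    have : r ≤ 1 / (2 * (K * (1 + C) + 1)) := (min_le_right _ _).trans (min_le_right _ _)
    rw [le_div_iff₀ (by positivity)] at this
    nlinarith [mul_nonneg hK0 (add_nonneg zero_le_one hC)]
  have hL : linearization a p.1 u = -((lam - p.1) • D 0 u + cubic a u) := by
    rw [linearization_apply hT, eq_neg_iff_add_eq_zero, ← hF]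
    change _ = D 2 u + lam • D 0 u + cubic a u
    module
  have h1 := hinv u
  have hpos : 0 < ‖u‖ := norm_pos_iff.2 hu
  have h2 : ‖linearization a p.1 u‖ ≤ r * (1 + C) * ‖u‖ := by
    rw [hL, norm_neg]
    refine (norm_add_le _ _).trans ?_
    have h3 : ‖(lam - p.1) • D 0 u‖ ≤ r * ‖u‖ := by
      rw [norm_smul, Real.norm_eq_abs]
      exact mul_le_mul hl.le (norm_D_le 0 u) (norm_nonneg _) hr0.le
    have h4 : ‖cubic a u‖ ≤ r * C * ‖u‖ := by
      refine (hcub u).trans ?_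
      have : ‖u‖ ^ 2 ≤ r := by nlinarith
      have : C * ‖u‖ ^ 2 ≤ C * r := by gcongr
      nlinarith
    linarith
  have h5 : K * ‖linearization a p.1 u‖ ≤ K * (r * (1 + C) * ‖u‖) := by gcongr
  nlinarith

theorem setOf_isBifurcationPoint (hT : 0 < T) (a : Linf T)
    (ha : ∀ᵐ t ∂(mu T), a (T - t) = a t) :
    {p | IsBifurcationPoint a p} = range fun k : ℕ => ((sigma T k, 0) : ℝ × H2 T) := by
  ext p
  constructor
  · intro h
    have h1 := h.mem_genSpectrum hT
    rw [← H2in_top, genSpectrum_eq hT isSpectral_top] at h1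
    obtain ⟨i, -, hi⟩ := h1
    exact ⟨waveNumber i, Prod.ext hi.symm h.1.symm⟩
  · rintro ⟨k, rfl⟩
    exact isBifurcationPoint_of_mem_closure (sigma_mem_closure_component hT a ha k)

end Branches

end PeriodicBif

end

theorem theorem3p10 (T : ℝ) (hT : 0 < T) (a : Linf T)
    (ha_nonneg : ∀ᵐ t ∂(mu T), 0 ≤ a t) (ha_ne : ¬ ∀ᵐ t ∂(mu T), a t = 0)
    (ha_even : ∀ᵐ t ∂(mu T), a (T - t) = a t) :
    -- (i) the bifurcation points from the trivial branch
    {p | IsBifurcationPoint a p} = range (fun k : ℕ => ((sigma T k, 0) : ℝ × H2 T)) ∧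
    -- (ii) a component of non-trivial solutions emanates from each of them
    (∀ k : ℕ, (sigma T k, 0) ∈ component a ⊤ ⊤ (sigma T k) ∧
      (sigma T k, 0) ∈ closure (component a ⊤ ⊤ (sigma T k) \ trivialSet T)) ∧
    -- (iii) the local structure at the first one
    (∃ ρ > 0, ∃ Cp Cm : Set (ℝ × H2 T),
      IsBranchPair a ⊤ ⊤ (sigma T 0) (oneFun T) ρ Cp Cm ∧
      (∀ p ∈ Cp, p.2 ∈ H2ev T ∧ ∀ t ∈ Icc 0 T, 0 < val p.2 t) ∧
      (∀ p ∈ Cm, p.2 ∈ H2ev T ∧ ∀ t ∈ Icc 0 T, val p.2 t < 0)) ∧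
    -- (iv) even and odd solutions at the others
    (∀ k : ℕ, 1 ≤ k →
      component a (H2ev T) (L2ev T) (sigma T k) ⊆ component a ⊤ ⊤ (sigma T k) ∧
      component a (H2odd T) (L2odd T) (sigma T k) ⊆ component a ⊤ ⊤ (sigma T k) ∧
      ∃ ρ > 0,
        (∃ Cp Cm : Set (ℝ × H2 T),
          IsBranchPair a (H2ev T) (L2ev T) (sigma T k) (cosFun T k) ρ Cp Cm ∧
          ∀ p ∈ Cp ∪ Cm, p.2 ∈ H2ev T ∧ HasExactlyZeros p.2 (2 * k)) ∧
        (∃ Cp Cm : Set (ℝ × H2 T),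
          IsBranchPair a (H2odd T) (L2odd T) (sigma T k) (sinFun T k) ρ Cp Cm ∧
          ∀ p ∈ Cp ∪ Cm, p.2 ∈ H2odd T ∧ HasExactlyZeros p.2 (2 * k))) := by
  refine ⟨setOf_isBifurcationPoint hT a ha_even, fun k => ⟨sigma_mem_component hT a k,
    sigma_mem_closure_component hT a ha_even k⟩, exists_isBranchPair_zero hT a ha_even,
    fun k hk => ⟨component_subset_top hT (isSpectral_ev hT) a _,
      component_subset_top hT (isSpectral_odd hT) a _, ?_⟩⟩
  obtain ⟨ρ₁, hρ₁, h₁⟩ := exists_isBranchPair_ev hT a ha_even hk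
  obtain ⟨ρ₂, hρ₂, h₂⟩ := exists_isBranchPair_odd hT a ha_even hk
  have hρ : 0 < min ρ₁ ρ₂ := lt_min hρ₁ hρ₂
  -- Both statements hold for all sufficiently small radii, so the even and odd branches can share
  -- one.
  exact ⟨min ρ₁ ρ₂ / 2, half_pos hρ,
    h₁ _ (half_pos hρ) ((half_lt_self hρ).trans_le (min_le_left _ _)),
    h₂ _ (half_pos hρ) ((half_lt_self hρ).trans_le (min_le_right _ _))⟩
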